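/- Throughout $n\ge 0$ and $w\cdot(a_1,\dots,a_n)=(a_{w(1)},\dots,a_{w(n)})$. **Odd shifted parking functions.** A parking function of size $n$ is a tuple $p=(p_1,\dots,p_n)$ of positive integers whose $i$th smallest entry is at most $i$; $\mathtt{sort}(p)$ is its weakly increasing rearrangement, $\alpha_k(p)=\#\{i:p_i=k\}$ for $1\le k\le n$, and the shape $\lambda(p)$ is the partition formed by the nonzero $\alpha_k(p)$. For $\sigma\in\{1,-1\}^n$ put $\overline\sigma_k=\prod_{p_i=k}\sigma_i$ if $\alpha_k(p)>0$ and $\overline\sigma_k=0$ otherwise. $\mathrm{OShPf}(n)$ is the set of triples $(p,\sigma,\tau)$ where $p$ is a parking function of size $n$ all of whose nonzero $\alpha_k(p)$ are odd, $\sigma\in\{1,-1\}^n$, and $\tau$ is a noncrossing partial matching of the integers appearing in $p$ (arcs written $(a,b)$ with $a<b$) such that (1) $\overline\sigma_a=-\overline\sigma_b$ for $(a,b)\in\tau$; (2) if $(a,c)\in\tau$ and $a<b<c$, then $b$ appears in $p$; (3) if $(a,d),(b,c)\in\tau$ and $a<b<c<d$, then $\overline\sigma_a=\overline\sigma_b$.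 Put $\mathtt{sort}(p,\sigma,\tau)=(\mathtt{sort}(p),\overline\sigma,\tau)$, and let $\overline{\mathrm{OShPf}}(n)$ be the set of all these sorted triples. **Symmetric functions.** $\mathrm{Sym}=\mathbb C[p_1,p_2,\dots]$ with $p_k$ the power sums; for $\lambda=(\lambda_1,\dots,\lambda_\ell)$, $p_\lambda=\prod_i p_{\lambda_i}$, $\ell(\lambda)=\ell$, $z_\lambda=\prod_i i^{m_i}m_i!$ with $m_i$ the number of parts equal to $i$; $h_k=\sum_{\lambda\vdash k}z_\lambda^{-1}p_\lambda$, $h_\lambda=\prod_i h_{\lambda_i}$. Let $\mathtt{sh}$ be the algebra endomorphism with $p_k\mapsto 2p_k$ for $k$ odd and $p_k\mapsto 0$ for $k$ even. Put $PF_n=\sum_p h_{\lambda(p)}$, over the weakly increasing parking functions $p$ of size $n$, and $SH_n=\mathtt{sh}(PF_n)$. **The double cover.** $\mathfrak S_n^-$ is generated by $s_1,\dots,s_{n-1},z$ with relations $z^2=1$, $s_i^2=z$, $s_is_j=zs_js_i$ for $|i-j|\ge2$, and $s_is_{i+1}s_i=s_{i+1}s_is_{i+1}$. It maps onto $\mathfrak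 S_n$ by $s_i\mapsto(i\ i{+}1)$, $z\mapsto1$. For weakly increasing $p$ with content $\alpha$, $\mathfrak S_\alpha^-$ is the double cover of the Young subgroup $\mathfrak S_\alpha$: it is generated by $z$ and the $s_j$ with $p_j=p_{j+1}$, subject to those of the above relations that involve only these generators. For $\lambda\vdash n$ with all parts odd and $r_j=\lambda_1+\dots+\lambda_{j-1}$, let $\pi_\lambda=\pi_1\cdots\pi_{\ell(\lambda)}$ with $\pi_j=s_{r_j+1}s_{r_j+2}\cdots s_{r_j+\lambda_j-1}$. The spin character of a finite-dimensional representation of $\mathfrak S_n^-$ on which $z$ acts by $-1$, with character $\psi$, is $$\mathtt{ch}'(\psi)=\sum_{\lambda\vdash n,\ \lambda\text{ odd}}z_\lambda^{-1}2^{\ell(\lambda)/2}\psi(\pi_\lambda)\,p_\lambda .$$ **The modules.** Let $\mathscr C_n$ be the complex Clifford algebra with generators $\xi_1,\dots,\xi_n$, $\xi_i^2=1$, $\xi_i\xi_j=-\xi_j\xi_i$ for $i\ne j$. Let $(p,\overline\sigma,\tau)\in\overline{\mathrm{OShPf}}(n)$, $\alpha=\alpha(p)$, and let $B_k=\{i:p_i=k\}$.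 The tensor product $\mathscr C_{\alpha_1}^{\overline\sigma_1}\otimes\cdots\otimes\mathscr C_{\alpha_n}^{\overline\sigma_n}$, where $\mathscr C_m^{1}$ and $\mathscr C_m^{-1}$ are the even and the odd part of $\mathscr C_m$ and $\mathscr C_0^{0}=\mathbb C$, is realised in $\mathscr C_n$ as the span of the $\xi_{i_1}\cdots\xi_{i_m}$ ($i_1<\dots<i_m$) such that $(-1)^{\#(\{i_1,\dots,i_m\}\cap B_k)}=\overline\sigma_k$ whenever $B_k\neq\varnothing$. For $B_k\ne\varnothing$ put $\omega_k=\sqrt{-1}^{\,\alpha_k(\alpha_k-1)/2}\prod_{i\in B_k}\xi_i$ (indices increasing) and $u_k=\alpha_k^{-1/2}\sum_{i\in B_k}\xi_i$. Then $\mathfrak S_\alpha^-$ acts on this space as follows: $z$ acts as $-1$, and $s_j$ with $j,j+1\in B_k$ acts as left multiplication by $$\Big(\prod_{c<k,\ B_c\neq\varnothing}u_c\omega_c\Big)\cdot\frac{\sqrt{-1}}{\sqrt2}\,(\xi_j-\xi_{j+1})\,\omega_k .$$ **Statement.** For each $p$, let $\hat\pi_p\in\mathfrak S_n^-$ be any element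 whose image $\pi_p\in\mathfrak S_n$ satisfies $\pi_p\cdot p=\mathtt{sort}(p)$. Then the rule $$(p,\sigma,\tau)\longmapsto\hat\pi_p\otimes\xi_{i_1}\cdots\xi_{i_m},\qquad\{i_1<\dots<i_m\}=\{i:\sigma_{\pi_p(i)}=-1\},$$ with image in the summand indexed by $\mathtt{sort}(p,\sigma,\tau)$, extends to a linear isomorphism $$\mathbb C[\mathrm{OShPf}(n)]\;\cong\bigoplus_{(p,\overline\sigma,\tau)\in\overline{\mathrm{OShPf}}(n)}\mathbb C[\mathfrak S_n^-]\otimes_{\mathbb C[\mathfrak S_{\alpha(p)}^-]}\Big(\mathscr C_{\alpha_1(p)}^{\overline\sigma_1}\otimes\cdots\otimes\mathscr C_{\alpha_n(p)}^{\overline\sigma_n}\Big).$$ Under this identification $\mathbb C[\mathrm{OShPf}(n)]$ is an $\mathfrak S_n^-$-module on which $z$ acts by $-1$, and its spin character is $2^{n/2}SH_n$. -/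

import Mathlib

open scoped DirectSum

noncomputable section

namespace OddParking

/-! ### Parking functions and odd shifted parking functions

The positions `1, …, n` are modelled by `Fin n`.  The entries of a parking function of size `n` lie
in `{1, …, n}`, so they are modelled by `Fin n` as well: `v : Fin n` stands for the integer `v + 1`.
-/

/-- `p` is a parking function: the `i`-th smallest entry is at most `i`. -/
def IsParking {n : ℕ} (p : Fin n → Fin n) : Prop :=
  ∀ i, p (Tuple.sort p i) ≤ i

/-- The positions at which the entry `k` occurs. -/
def block {n : ℕ} (p : Fin n → Fin n) (k : Fin n) : Finset (Fin n) :=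
  Finset.univ.filter fun i => p i = k

/-- The number of occurrences of `k` in `p`. -/
def content {n : ℕ} (p : Fin n → Fin n) (k : Fin n) : ℕ := (block p k).card

/-- The shape of `p`: the multiset of the nonzero contents. -/
def shape {n : ℕ} (p : Fin n → Fin n) : Multiset ℕ :=
  (Finset.univ.val.map (content p)).filter (0 < ·)

/-- All parts of the shape of `p` are odd. -/
def OddShape {n : ℕ} (p : Fin n → Fin n) : Prop := ∀ m ∈ shape p, Odd m

/-- The sign of each integer: the product of the signs at the positions where `k` occurs, and `0`
if `k` does not occur. -/
def blockSign {n : ℕ} (p : Fin n → Fin n) (σ : Fin n → ℤˣ) (k : Fin n) : ℤ :=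
  if content p k = 0 then 0 else ∏ i ∈ block p k, (σ i : ℤ)

/-- `τ` is a noncrossing (partial) matching of the integers appearing in `p`.  The arc joining
`a < b` is recorded as the pair `(a, b)`. -/
structure IsNoncrossingMatching {n : ℕ} (p : Fin n → Fin n) (τ : Finset (Fin n × Fin n)) :
    Prop where
  lt : ∀ a b, (a, b) ∈ τ → a < b
  occurs : ∀ a b, (a, b) ∈ τ → a ∈ Set.range p ∧ b ∈ Set.range p
  disjoint : ∀ e ∈ τ, ∀ f ∈ τ, e ≠ f → e.1 ≠ f.1 ∧ e.1 ≠ f.2 ∧ e.2 ≠ f.1 ∧ e.2 ≠ f.2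
  noncrossing : ∀ a b c d, (a, c) ∈ τ → (b, d) ∈ τ → ¬ (a < b ∧ b < c ∧ c < d)

/-- An odd shifted parking function `(p, σ, τ)` of size `n`. -/
@[ext]
structure OShPf (n : ℕ) where
  p : Fin n → Fin n
  σ : Fin n → ℤˣ
  τ : Finset (Fin n × Fin n)
  parking : IsParking p
  odd : OddShape p
  matching : IsNoncrossingMatching p τ
  arc_sign : ∀ a b, (a, b) ∈ τ → blockSign p σ a = -blockSign p σ b
  arc_cover : ∀ a b c, (a, c) ∈ τ → a < b → b < c → b ∈ Set.range p
  arc_nested : ∀ a b c d, (a, d) ∈ τ → (b, c) ∈ τ → a < b → b < c → c < d →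
    blockSign p σ a = blockSign p σ b

/-- The sort of an odd shifted parking function. -/
def OShPf.sort {n : ℕ} (t : OShPf n) :
    (Fin n → Fin n) × (Fin n → ℤ) × Finset (Fin n × Fin n) :=
  (t.p ∘ Tuple.sort t.p, blockSign t.p t.σ, t.τ)

/-- Sorted odd shifted parking functions. -/
def SortedOShPf (n : ℕ) : Type := Set.range (OShPf.sort (n := n))

def SortedOShPf.p {n : ℕ} (s : SortedOShPf n) : Fin n → Fin n := s.1.1

def SortedOShPf.sign {n : ℕ} (s : SortedOShPf n) : Fin n → ℤ := s.1.2.1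

def OShPf.toSorted {n : ℕ} (t : OShPf n) : SortedOShPf n := ⟨t.sort, t, rfl⟩

theorem card_block_comp {n : ℕ} (p : Fin n → Fin n) (w : Equiv.Perm (Fin n)) (k : Fin n) :
    content (p ∘ w) k = content p k := by
  unfold content block
  rw [← Finset.card_map w.toEmbedding]
  congr 1
  ext i
  simp only [Finset.mem_map, Finset.mem_filter, Finset.mem_univ, true_and, Function.comp]
  constructor
  · rintro ⟨j, hj, rfl⟩; exact hj
  · intro h; exact ⟨w.symm i, by simpa using h, by simp⟩

theorem SortedOShPf.oddShape {n : ℕ} (s : SortedOShPf n) : OddShape s.p := by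
  obtain ⟨_, t, rfl⟩ := s
  have h : shape (t.p ∘ Tuple.sort t.p) = shape t.p := by
    unfold shape
    congr 2
    funext k
    exact card_block_comp _ _ _
  show OddShape (t.p ∘ Tuple.sort t.p)
  unfold OddShape
  rw [h]
  exact t.odd

/-! ### Symmetric functions

Over `ℂ` the algebra of symmetric functions is the polynomial algebra in the power sums
`p₁, p₂, …`; the variable `X i` stands for the power sum of degree `i + 1`.
-/

/-- Symmetric functions with complex coefficients. -/
abbrev Sym : Type := MvPolynomial ℕ ℂ

/-- The power sum of degree `k ≥ 1`. -/
def psum (k : ℕ) : Sym := MvPolynomial.X (k - 1)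

/-- `p_λ = ∏ p_{λ_i}`. -/
def psumPart {n : ℕ} (l : n.Partition) : Sym := (l.parts.map psum).prod

/-- `z_λ = ∏ i ^ {m_i} m_i!`, the order of the centralizer of a permutation of cycle type `λ`. -/
def zee {n : ℕ} (l : n.Partition) : ℕ :=
  ∏ i ∈ l.parts.toFinset, i ^ l.parts.count i * (l.parts.count i).factorial

/-- The complete homogeneous symmetric function `h_n = ∑_{λ ⊢ n} p_λ / z_λ`. -/
def hsym (n : ℕ) : Sym := ∑ l : n.Partition, (zee l : ℂ)⁻¹ • psumPart l

/-- The shiftification operator: `p_k ↦ 2 p_k` for `k` odd and `p_k ↦ 0` for `k` even. -/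
def sh : Sym →ₐ[ℂ] Sym :=
  MvPolynomial.aeval fun i => if Odd (i + 1) then 2 * psum (i + 1) else 0

open Classical in
/-- The parking function symmetric function: the sum of `h_{shape p}` over the sorted parking
functions `p` of size `n`. -/
def PF (n : ℕ) : Sym :=
  ∑ p : Fin n → Fin n with IsParking p ∧ Monotone p, ((shape p).map hsym).prod

/-- The shifted parking function symmetric function. -/
def SH (n : ℕ) : Sym := sh (PF n)

/-! ### Double covers of the symmetric group and of its Young subgroups -/

/-- The defining relations of the group generated by `s_j` (`j ∈ J`) and `z`; the generator
`some j` is `s_j` and `none` is `z`. -/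
inductive CoverRel (J : Set ℕ) : FreeGroup (Option J) → Prop
  | z_sq : CoverRel J (.of none * .of none)
  | sq (i : J) : CoverRel J (.of (some i) * .of (some i) * (.of none)⁻¹)
  | far (i j : J) (h : (i : ℕ) + 2 ≤ j ∨ (j : ℕ) + 2 ≤ i) : CoverRel J
      (.of (some i) * .of (some j) * (.of none * .of (some j) * .of (some i))⁻¹)
  | braid (i j : J) (h : (j : ℕ) = i + 1) : CoverRel J
      (.of (some i) * .of (some j) * .of (some i) *
        (.of (some j) * .of (some i) * .of (some j))⁻¹)

/-- The group `⟨s_j (j ∈ J), z : z² = 1, s_j² = z, s_i s_j = z s_j s_i (|i - j| ≥ 2),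
s_i s_{i+1} s_i = s_{i+1} s_i s_{i+1}⟩`. -/
abbrev Cover (J : Set ℕ) : Type := PresentedGroup {r | CoverRel J r}

def Cover.s {J : Set ℕ} (j : J) : Cover J := PresentedGroup.of (some j)

def Cover.z {J : Set ℕ} : Cover J := PresentedGroup.of none

/-- The universal property of `Cover J`. -/
def Cover.lift {J : Set ℕ} {G : Type*} [Group G] (f : J → G) (c : G) (h1 : c * c = 1)
    (h2 : ∀ i, f i * f i = c)
    (h3 : ∀ i j : J, (i : ℕ) + 2 ≤ j ∨ (j : ℕ) + 2 ≤ i → f i * f j = c * f j * f i)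
    (h4 : ∀ i j : J, (j : ℕ) = i + 1 → f i * f j * f i = f j * f i * f j) : Cover J →* G :=
  PresentedGroup.toGroup (f := fun o => o.elim c f) (by
    rintro r hr
    cases hr with
    | z_sq => simpa using h1
    | sq i => simp [h2 i]
    | far i j h => simp only [map_mul, map_inv, FreeGroup.lift_apply_of, Option.elim]
                   rw [h3 i j h]; group
    | braid i j h => simp only [map_mul, map_inv, FreeGroup.lift_apply_of, Option.elim]
                     rw [h4 i j h]; group)

theorem Cover.z_sq {J : Set ℕ} : (Cover.z : Cover J) * Cover.z = 1 := by
  simpa [Cover.z, PresentedGroup.of] using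
    PresentedGroup.one_of_mem (rels := {r | CoverRel J r}) (CoverRel.z_sq)

theorem Cover.s_sq {J : Set ℕ} (i : J) : Cover.s i * Cover.s i = Cover.z := by
  have := PresentedGroup.mk_eq_mk_of_mul_inv_mem (rels := {r | CoverRel J r}) (CoverRel.sq i)
  simpa [Cover.s, Cover.z, PresentedGroup.of] using this

theorem Cover.s_far {J : Set ℕ} (i j : J) (h : (i : ℕ) + 2 ≤ j ∨ (j : ℕ) + 2 ≤ i) :
    Cover.s i * Cover.s j = Cover.z * Cover.s j * Cover.s i := by
  have := PresentedGroup.mk_eq_mk_of_mul_inv_mem (rels := {r | CoverRel J r}) (CoverRel.far i j h)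
  simpa [Cover.s, Cover.z, PresentedGroup.of] using this

theorem Cover.s_braid {J : Set ℕ} (i j : J) (h : (j : ℕ) = i + 1) :
    Cover.s i * Cover.s j * Cover.s i = Cover.s j * Cover.s i * Cover.s j := by
  have := PresentedGroup.mk_eq_mk_of_mul_inv_mem (rels := {r | CoverRel J r}) (CoverRel.braid i j h)
  simpa [Cover.s, Cover.z, PresentedGroup.of] using this

/-- The double cover of the symmetric group on `n` letters.  The generator `s_j` lies over the
transposition of the positions `j` and `j + 1`, counted from `0`. -/
abbrev DoubleCover (n : ℕ) : Type := Cover {j | j + 1 < n}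

/-- The projection of the double cover to the symmetric group. -/
def DoubleCover.proj (n : ℕ) : DoubleCover n →* Equiv.Perm (Fin n) :=
  Cover.lift
    (fun j => Equiv.swap ⟨j, lt_of_lt_of_le (Nat.lt_succ_self _) (le_of_lt j.2)⟩ ⟨j + 1, j.2⟩) 1
    (by simp) (by simp)
    (by
      rintro ⟨i, hi⟩ ⟨j, hj⟩ h
      simp only [one_mul]
      apply Equiv.Perm.Disjoint.commute
      rw [Equiv.Perm.disjoint_iff_disjoint_support, Equiv.Perm.support_swap (by simp),
        Equiv.Perm.support_swap (by simp)]
      simp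
      simp at h
      omega)
    (by
      rintro ⟨i, hi⟩ ⟨j, hj⟩ h
      simp only at h
      subst h
      have hi' : i + 1 < n := hi
      have hj' : i + 1 + 1 < n := hj
      have hx : (⟨i, by omega⟩ : Fin n) ≠ ⟨i + 1, hi⟩ := by simp
      have hy : (⟨i, by omega⟩ : Fin n) ≠ ⟨i + 1 + 1, hj⟩ := by simp; omega
      have hz : (⟨i + 1 + 1, hj⟩ : Fin n) ≠ ⟨i + 1, hi⟩ := by simp
      have h1 := Equiv.swap_mul_swap_mul_swap hx hy
      have h2 := Equiv.swap_mul_swap_mul_swap hz hy.symm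
      rw [Equiv.swap_comm (⟨i + 1 + 1, _⟩ : Fin n) ⟨i + 1, hi⟩,
        Equiv.swap_comm (⟨i + 1, _⟩ : Fin n) ⟨i, _⟩] at h2
      simp only
      rw [h1, h2, Equiv.swap_comm])

/-- The `j` for which the positions `j` and `j + 1` carry the same entry of `p`.  For a weakly
increasing `p`, the corresponding transpositions generate the Young subgroup `S_{α(p)}`. -/
def youngIndex {n : ℕ} (p : Fin n → Fin n) : Set ℕ :=
  {j | ∃ h : j + 1 < n, p ⟨j, lt_of_lt_of_le (Nat.lt_succ_self _) (le_of_lt h)⟩ = p ⟨j + 1, h⟩}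

/-- The double cover of the Young subgroup `S_{α(p)}` of the symmetric group, for `p` weakly
increasing. -/
abbrev YoungCover {n : ℕ} (p : Fin n → Fin n) : Type := Cover (youngIndex p)

/-- The inclusion of the double cover of the Young subgroup. -/
def YoungCover.incl {n : ℕ} (p : Fin n → Fin n) : YoungCover p →* DoubleCover n :=
  Cover.lift (fun j => Cover.s ⟨j, j.2.1⟩) Cover.z Cover.z_sq (fun _ => Cover.s_sq _)
    (fun _ _ h => Cover.s_far _ _ h) (fun _ _ h => Cover.s_braid _ _ h)

/-- The product of the consecutive generators over each cycle, the cycles occupying consecutive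
intervals of positions starting at position `r`. -/
def cycleWord {n : ℕ} : ℕ → List ℕ → DoubleCover n
  | _, [] => 1
  | r, m :: l =>
    ((List.range' r (m - 1)).map fun j =>
      if h : j + 1 < n then Cover.s (J := {j | j + 1 < n}) ⟨j, h⟩ else 1).prod *
    cycleWord (r + m) l

/-- The representative `π_λ` of the positive class of cycle type `λ`: with `r` the sum of the
preceding parts, the part `m` contributes (counting positions from `1`) the factor
`s_{r+1} s_{r+2} ⋯ s_{r+m-1}`. -/
def posRep {n : ℕ} (l : n.Partition) : DoubleCover n :=
  cycleWord 0 (l.parts.sort (· ≥ ·))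

/-- The spin characteristic of a class function on the double cover. -/
def spinCh (n : ℕ) (ψ : DoubleCover n → ℂ) : Sym :=
  ∑ l ∈ Nat.Partition.odds n,
    ((zee l : ℂ)⁻¹ * ((Real.sqrt 2 : ℝ) : ℂ) ^ l.parts.card * ψ (posRep l)) • psumPart l

/-! ### Clifford algebras -/

/-- The quadratic form `x₁² + ⋯ + x_n²`. -/
def Q (n : ℕ) : QuadraticForm ℂ (Fin n → ℂ) :=
  QuadraticMap.weightedSumSquares ℂ (fun _ : Fin n => (1 : ℂ))

/-- The Clifford algebra on `n` generators. -/
abbrev Cl (n : ℕ) : Type := CliffordAlgebra (Q n)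

/-- A vector, as an element of the Clifford algebra. -/
def vec {n : ℕ} (v : Fin n → ℂ) : Cl n := CliffordAlgebra.ι (Q n) v

/-- The generators `ξ_i`, with `ξ_i² = 1` and `ξ_i ξ_j = -ξ_j ξ_i`. -/
def ξ {n : ℕ} (i : Fin n) : Cl n := vec (Pi.single i 1)

/-- `ξ_I = ξ_{i_1} ⋯ ξ_{i_k}` for `I = {i_1 < ⋯ < i_k}`. -/
def mono {n : ℕ} (I : Finset (Fin n)) : Cl n := ((I.sort (· ≤ ·)).map ξ).prod

/-- For `p` weakly increasing with content `α`, the tensor product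
`C_{α_1}^{s_1} ⊗ ⋯ ⊗ C_{α_n}^{s_n}` of even (`s_k = 1`) and odd (`s_k = -1`) parts of Clifford
algebras, realised inside `C_n = C_{α_1} ⊗ ⋯ ⊗ C_{α_n}`, where the factor `C_{α_k}` is generated by
the `ξ_i` for `i` in the block of `k`.  It is spanned by the `ξ_I` for which the parity of the
number of elements of `I` in the block of `k` is given by `s_k`, for each `k` occurring in `p`. -/
def tensorPart {n : ℕ} (p : Fin n → Fin n) (s : Fin n → ℤ) : Submodule ℂ (Cl n) :=
  Submodule.span ℂ
    {x | ∃ I : Finset (Fin n), (∀ k, content p k ≠ 0 → (-1) ^ (I ∩ block p k).card = s k) ∧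
      x = mono I}

/-- The volume element `ω_k = 𝐢^{m(m-1)/2} ∏ ξ_i` of the `k`-th factor, `m` its number of
generators.  If `m` is odd it is central in that factor and has square `1`. -/
def vol {n : ℕ} (p : Fin n → Fin n) (k : Fin n) : Cl n :=
  Complex.I ^ (content p k * (content p k - 1) / 2) • mono (block p k)

/-- The unit vector `u_k = m^{-1/2} ∑ ξ_i` of the `k`-th factor, `m` its number of generators. -/
def unitVec {n : ℕ} (p : Fin n → Fin n) (k : Fin n) : Cl n :=
  vec fun i => if p i = k then ((Real.sqrt (content p k) : ℝ) : ℂ)⁻¹ else 0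

/-- The product of the associators `u_c ω_c` over all `c < k` occurring in `p`. -/
def assocBelow {n : ℕ} (p : Fin n → Fin n) (k : Fin n) : Cl n :=
  (((List.finRange n).filter fun c => c < k ∧ content p c ≠ 0).map
    fun c => unitVec p c * vol p c).prod

/-- The element of the Clifford algebra by which the generator `s_j` of the double cover of the
Young subgroup acts.  In a single factor with an odd number of generators, `s_j` acts as
`2^{-1/2} 𝐢 (ξ_j - ξ_{j+1})`, where `ξ_i` acts on the even and on the odd part as left
multiplication by `ξ_i ω`, which preserves parity; as `ω` is central with `ω² = 1`, this is left
multiplication by `ξ_i` on the left ideal `C (1 + ω)`, transported along `x ↦ x (1 + ω)`.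
In the preceding factors `s_j` acts by the associators, operators of square `1` which anticommute
with the `s_i` of their factor, so that generators from different factors anticommute. -/
def youngElt {n : ℕ} (p : Fin n → Fin n) (j : youngIndex p) : Cl n :=
  let i : Fin n := ⟨j, lt_of_lt_of_le (Nat.lt_succ_self _) (le_of_lt j.2.1)⟩
  let i' : Fin n := ⟨j + 1, j.2.1⟩
  (Complex.I / ((Real.sqrt 2 : ℝ) : ℂ)) •
    (assocBelow p (p i) * ((ξ i - ξ i') * vol p (p i)))

section Clifford

variable {n : ℕ}

theorem Q_apply (v : Fin n → ℂ) : Q n v = ∑ i, v i * v i := by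
  simp [Q, QuadraticMap.weightedSumSquares_apply]

theorem vec_sq (v : Fin n → ℂ) : vec v * vec v = algebraMap ℂ _ (∑ i, v i * v i) := by
  rw [vec, CliffordAlgebra.ι_sq_scalar, Q_apply]

theorem vec_add_swap (v w : Fin n → ℂ) :
    vec v * vec w + vec w * vec v = algebraMap ℂ _ (2 * ∑ i, v i * w i) := by
  rw [vec, vec, CliffordAlgebra.ι_mul_ι_add_swap]
  congr 1
  simp only [QuadraticMap.polar, Q_apply, Pi.add_apply]
  rw [← Finset.sum_sub_distrib, ← Finset.sum_sub_distrib, Finset.mul_sum]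
  exact Finset.sum_congr rfl fun i _ => by ring

theorem vec_anti {v w : Fin n → ℂ} (h : ∑ i, v i * w i = 0) : vec v * vec w = -(vec w * vec v) := by
  have := vec_add_swap v w
  rw [h, mul_zero, map_zero] at this
  exact eq_neg_of_add_eq_zero_left this

theorem ξ_sq (i : Fin n) : ξ i * ξ i = 1 := by
  rw [ξ, vec_sq]
  simp [Pi.single_apply]

theorem ξ_anti {i j : Fin n} (h : i ≠ j) : ξ i * ξ j = -(ξ j * ξ i) :=
  vec_anti (by simp [Pi.single_apply, h.symm])

theorem neg_one_comm (m : ℕ) (x : Cl n) : Commute ((-1) ^ m) x :=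
  (Commute.neg_one_left x).pow_left m

theorem ξ_list_not_mem (i : Fin n) (l : List (Fin n)) (h : i ∉ l) :
    ξ i * (l.map ξ).prod = (-1) ^ l.length * ((l.map ξ).prod * ξ i) := by
  induction l with
  | nil => simp
  | cons a l ih =>
    simp only [List.mem_cons, not_or] at h
    simp only [List.map_cons, List.prod_cons, List.length_cons]
    rw [← mul_assoc, ξ_anti h.1, neg_mul, mul_assoc, ih h.2, pow_succ, mul_neg_one, neg_mul,
      mul_assoc (ξ a), (neg_one_comm l.length (ξ a)).left_comm]

theorem ξ_list_mem (i : Fin n) (l : List (Fin n)) (hl : l.Nodup) (h : i ∈ l) :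
    ξ i * (l.map ξ).prod = -((-1) ^ l.length * ((l.map ξ).prod * ξ i)) := by
  induction l with
  | nil => simp at h
  | cons a l ih =>
    rw [List.nodup_cons] at hl
    simp only [List.map_cons, List.prod_cons, List.length_cons]
    rw [pow_succ, mul_neg_one, neg_mul, neg_neg, mul_assoc (ξ a) _ (ξ i),
      (neg_one_comm l.length (ξ a)).left_comm]
    by_cases hia : i = a
    · subst hia
      rw [← ξ_list_not_mem i l hl.1]
    · have hi : i ∈ l := by simpa [hia] using h
      rw [← mul_assoc, ξ_anti hia, neg_mul, mul_assoc, ih hl.2 hi, mul_neg, neg_neg]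

theorem list_sq (l : List (Fin n)) (hl : l.Nodup) :
    (l.map ξ).prod * (l.map ξ).prod = (-1) ^ (l.length * (l.length - 1) / 2) := by
  induction l with
  | nil => simp
  | cons a l ih =>
    rw [List.nodup_cons] at hl
    have e : (l.length + 1) * (l.length + 1 - 1) / 2 =
        l.length + l.length * (l.length - 1) / 2 := by
      rw [Nat.triangle_succ, add_comm]
    simp only [List.map_cons, List.prod_cons, List.length_cons]
    rw [e, pow_add, ← ih hl.2]
    nth_rewrite 1 [ξ_list_not_mem a l hl.1]
    rw [mul_assoc, mul_assoc, ← mul_assoc (ξ a) (ξ a), ξ_sq, one_mul]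

theorem sort_length (p : Fin n → Fin n) (k : Fin n) :
    ((block p k).sort (· ≤ ·)).length = content p k := by simp [content]

theorem mem_block {p : Fin n → Fin n} {k i : Fin n} : i ∈ block p k ↔ p i = k := by
  simp [block]

/-- All occurring contents are odd. -/
def OddContent (p : Fin n → Fin n) : Prop := ∀ k, content p k ≠ 0 → Odd (content p k)

theorem OddShape.content {p : Fin n → Fin n} (h : OddShape p) : OddContent p := by
  intro k hk
  apply h
  simp only [shape, Multiset.mem_filter, Multiset.mem_map]
  exact ⟨⟨k, by simp, rfl⟩, Nat.pos_of_ne_zero hk⟩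

theorem content_ne_zero {p : Fin n → Fin n} {i k : Fin n} (h : p i = k) : content p k ≠ 0 :=
  Finset.card_ne_zero_of_mem (mem_block.2 h)

theorem vol_comm_of_mem {p : Fin n → Fin n} {k i : Fin n} (hk : Odd (content p k))
    (h : p i = k) : ξ i * vol p k = vol p k * ξ i := by
  rw [vol, mul_smul_comm, smul_mul_assoc, mono,
    ξ_list_mem i _ (Finset.sort_nodup _ _) (by simpa using mem_block.2 h), sort_length,
    hk.neg_one_pow]
  simp

theorem vol_anti {p : Fin n → Fin n} {k i : Fin n} (hk : Odd (content p k))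
    (h : p i ≠ k) : ξ i * vol p k = -(vol p k * ξ i) := by
  rw [vol, mul_smul_comm, smul_mul_assoc, mono,
    ξ_list_not_mem i _ (by simpa using fun h1 => h (mem_block.1 h1)), sort_length,
    hk.neg_one_pow]
  simp

theorem vol_sq (p : Fin n → Fin n) (k : Fin n) : vol p k * vol p k = 1 := by
  rw [vol, smul_mul_smul_comm, mono, list_sq _ (Finset.sort_nodup _ _), sort_length, ← mul_pow,
    Complex.I_mul_I]
  rcases Nat.even_or_odd (content p k * (content p k - 1) / 2) with h | h <;>
  simp [h.neg_one_pow]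

theorem unitVec_sq {p : Fin n → Fin n} {k : Fin n} (hk : content p k ≠ 0) :
    unitVec p k * unitVec p k = 1 := by
  rw [unitVec, vec_sq]
  have : ∑ i, ((if p i = k then ((Real.sqrt (content p k) : ℝ) : ℂ)⁻¹ else 0) *
      (if p i = k then ((Real.sqrt (content p k) : ℝ) : ℂ)⁻¹ else 0)) = 1 := by
    have h0 : ((content p k : ℝ) : ℂ) ≠ 0 := by simpa using hk
    have h1 : ((Real.sqrt (content p k) : ℝ) : ℂ)⁻¹ * ((Real.sqrt (content p k) : ℝ) : ℂ)⁻¹ =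
        ((content p k : ℝ) : ℂ)⁻¹ := by
      rw [← mul_inv, ← Complex.ofReal_mul, Real.mul_self_sqrt (Nat.cast_nonneg _)]
    have h2 : ∀ i, ((if p i = k then ((Real.sqrt (content p k) : ℝ) : ℂ)⁻¹ else 0) *
      (if p i = k then ((Real.sqrt (content p k) : ℝ) : ℂ)⁻¹ else 0)) =
        if p i = k then ((content p k : ℝ) : ℂ)⁻¹ else 0 := by
      intro i; split_ifs <;> simp [h1]
    rw [Finset.sum_congr rfl fun i _ => h2 i, ← Finset.sum_filter, Finset.sum_const,
      show (Finset.univ.filter fun i => p i = k).card = content p k from rfl, nsmul_eq_mul]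
    simpa using mul_inv_cancel₀ h0
  rw [this, map_one]

theorem vec_eq_sum (v : Fin n → ℂ) : vec v = ∑ i, v i • (ξ i : Cl n) := by
  simp only [vec, ξ]
  simp_rw [← map_smul, ← map_sum]
  congr 1
  exact pi_eq_sum_univ' v

theorem unitVec_eq (p : Fin n → Fin n) (k : Fin n) : unitVec p k =
    ∑ i, (if p i = k then ((Real.sqrt (content p k) : ℝ) : ℂ)⁻¹ else 0) • (ξ i : Cl n) :=
  vec_eq_sum _

/-! Parity -/

theorem perm_sign {l l' : List (Fin n)} (h : l.Perm l') (hl : l.Nodup) :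
    (l.map ξ).prod = (l'.map ξ).prod ∨ (l.map ξ).prod = -(l'.map ξ).prod := by
  induction h with
  | nil => simp
  | cons x _ ih =>
    rw [List.nodup_cons] at hl
    rcases ih hl.2 with h | h <;> simp [h]
  | swap x y l =>
    simp only [List.nodup_cons, List.mem_cons, not_or] at hl
    right
    simp only [List.map_cons, List.prod_cons, ← mul_assoc, ξ_anti hl.1.1, neg_mul]
  | trans h1 _ ih1 ih2 =>
    rcases ih1 hl with h | h <;> rcases ih2 (h1.nodup_iff.1 hl) with h' | h' <;> simp [h, h']

theorem ξ_mul_mono_of_not_mem {i : Fin n} {I : Finset (Fin n)} (h : i ∉ I) :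
    ξ i * mono I = mono (insert i I) ∨ ξ i * mono I = -mono (insert i I) := by
  have := perm_sign (l := i :: I.sort (· ≤ ·)) (l' := (insert i I).sort (· ≤ ·)) (by
    rw [← Multiset.coe_eq_coe, ← Multiset.cons_coe, Finset.sort_eq, Finset.sort_eq,
      Finset.insert_val_of_notMem h]) (by simp [h])
  simpa [mono] using this

theorem ξ_mul_mono_of_mem {i : Fin n} {I : Finset (Fin n)} (h : i ∈ I) :
    ξ i * mono I = mono (I.erase i) ∨ ξ i * mono I = -mono (I.erase i) := by
  have := ξ_mul_mono_of_not_mem (Finset.notMem_erase i I)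
  rw [Finset.insert_erase h] at this
  rcases this with h | h
  · left; rw [← h, ← mul_assoc, ξ_sq, one_mul]
  · right; rw [← neg_eq_iff_eq_neg] at h; rw [← h, mul_neg, ← mul_assoc, ξ_sq, one_mul]

/-- Left multiplication by `x` changes the parity in the factor `k` only. -/
def Flips (p : Fin n → Fin n) (k : Fin n) (x : Cl n) : Prop :=
  ∀ s, ∀ w ∈ tensorPart p s, x * w ∈ tensorPart p (Function.update s k (-s k))

/-- Left multiplication by `x` preserves all parities. -/
def Keeps (p : Fin n → Fin n) (x : Cl n) : Prop :=
  ∀ s, ∀ w ∈ tensorPart p s, x * w ∈ tensorPart p s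

theorem flips_ξ (p : Fin n → Fin n) (i : Fin n) : Flips p (p i) (ξ i) := by
  intro s w hw
  induction hw using Submodule.span_induction with
  | zero => simp
  | add x y _ _ hx hy => rw [mul_add]; exact add_mem hx hy
  | smul c x _ hx => rw [mul_smul_comm]; exact Submodule.smul_mem _ _ hx
  | mem x hx =>
    obtain ⟨I, hI, rfl⟩ := hx
    by_cases h : i ∈ I
    · have hm : mono (I.erase i) ∈ tensorPart p (Function.update s (p i) (-s (p i))) := by
        refine Submodule.subset_span ⟨_, fun k hk => ?_, rfl⟩
        rcases eq_or_ne k (p i) with rfl | hki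
        · have h1 : i ∈ I ∩ block p (p i) := by simp [h, block]
          rw [Function.update_self, ← hI _ hk, Finset.erase_inter,
            ← Finset.card_erase_add_one h1, pow_succ]
          simp
        · rw [Function.update_of_ne hki, ← hI _ hk, Finset.erase_inter, Finset.erase_eq_of_notMem]
          simp [mem_block, hki.symm]
      rcases ξ_mul_mono_of_mem h with h | h <;> rw [h]
      exacts [hm, neg_mem hm]
    · have hm : mono (insert i I) ∈ tensorPart p (Function.update s (p i) (-s (p i))) := by
        refine Submodule.subset_span ⟨_, fun k hk => ?_, rfl⟩
        rcases eq_or_ne k (p i) with rfl | hki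
        · rw [Function.update_self, ← hI _ hk, Finset.insert_inter_of_mem (by simp [block]),
            Finset.card_insert_of_notMem (by simp [h]), pow_succ]
          simp
        · rw [Function.update_of_ne hki, ← hI _ hk, Finset.insert_inter_of_notMem]
          simp [mem_block, hki.symm]
      rcases ξ_mul_mono_of_not_mem h with h | h <;> rw [h]
      exacts [hm, neg_mem hm]

theorem Flips.smul {p : Fin n → Fin n} {k : Fin n} {x : Cl n} (h : Flips p k x) (c : ℂ) :
    Flips p k (c • x) := fun s w hw => by
  rw [smul_mul_assoc]; exact Submodule.smul_mem _ _ (h s w hw)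

theorem Flips.sub {p : Fin n → Fin n} {k : Fin n} {x y : Cl n} (h : Flips p k x)
    (h' : Flips p k y) : Flips p k (x - y) := fun s w hw => by
  rw [sub_mul]; exact sub_mem (h s w hw) (h' s w hw)

theorem Flips.mul {p : Fin n → Fin n} {k : Fin n} {x y : Cl n} (h : Flips p k x)
    (h' : Flips p k y) : Keeps p (x * y) := fun s w hw => by
  rw [mul_assoc]
  simpa using h _ _ (h' s w hw)

theorem Keeps.mul {p : Fin n → Fin n} {x y : Cl n} (h : Keeps p x)
    (h' : Keeps p y) : Keeps p (x * y) := fun s w hw => by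
  rw [mul_assoc]; exact h _ _ (h' s w hw)

theorem Keeps.smul {p : Fin n → Fin n} {x : Cl n} (h : Keeps p x) (c : ℂ) :
    Keeps p (c • x) := fun s w hw => by
  rw [smul_mul_assoc]; exact Submodule.smul_mem _ _ (h s w hw)

theorem Flips.mul_keeps {p : Fin n → Fin n} {k : Fin n} {x y : Cl n} (h : Flips p k x)
    (h' : Keeps p y) : Flips p k (x * y) := fun s w hw => by
  rw [mul_assoc]; exact h _ _ (h' s w hw)

theorem flips_list (p : Fin n → Fin n) (k : Fin n) (l : List (Fin n)) (hl : ∀ i ∈ l, p i = k) :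
    (Odd l.length → Flips p k (l.map ξ).prod) ∧ (Even l.length → Keeps p (l.map ξ).prod) := by
  induction l with
  | nil => simp [Keeps]
  | cons a l ih =>
    have ha : Flips p k (ξ a) := hl a (by simp) ▸ flips_ξ p a
    have ih := ih fun i hi => hl i (by simp [hi])
    simp only [List.map_cons, List.prod_cons, List.length_cons]
    refine ⟨fun h => ha.mul_keeps (ih.2 ?_), fun h => ha.mul (ih.1 ?_)⟩
    · rcases Nat.even_or_odd l.length with h' | h'
      · exact h'
      · exact absurd h'.add_one (Nat.not_even_iff_odd.2 h)
    · rcases Nat.even_or_odd l.length with h' | h'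
      · exact absurd h (Nat.not_even_iff_odd.2 h'.add_one)
      · exact h'

theorem flips_vol {p : Fin n → Fin n} {k : Fin n} (hk : Odd (content p k)) :
    Flips p k (vol p k) :=
  ((flips_list p k _ fun i hi => mem_block.1 (by simpa using hi)).1
    (by rwa [sort_length])).smul _

theorem flips_unitVec (p : Fin n → Fin n) (k : Fin n) : Flips p k (unitVec p k) := by
  intro s w hw
  rw [unitVec_eq, Finset.sum_mul]
  refine sum_mem fun i _ => ?_
  split_ifs with h
  · subst h; exact (flips_ξ p i).smul _ s w hw
  · simp

theorem keeps_assocBelow {p : Fin n → Fin n} (hp : OddContent p) (k : Fin n) :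
    Keeps p (assocBelow p k) := by
  unfold assocBelow
  have : ∀ l : List (Fin n), (∀ c ∈ l, content p c ≠ 0) →
      Keeps p (l.map fun c => unitVec p c * vol p c).prod := by
    intro l
    induction l with
    | nil => intro _; simp [Keeps]
    | cons a l ih =>
      intro hl
      simp only [List.map_cons, List.prod_cons]
      exact ((flips_unitVec p a).mul (flips_vol (hp a (hl a (by simp))))).mul
        (ih fun c hc => hl c (by simp [hc]))
  exact this _ fun c hc => by simp at hc; exact hc.2

/-! Relations between the elements `youngElt` -/

theorem commute_assoc {p : Fin n → Fin n} {c i : Fin n} (hc : Odd (content p c)) (h : p i ≠ c) :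
    Commute (ξ i) (unitVec p c * vol p c) := by
  have h1 : ξ i * unitVec p c = -(unitVec p c * ξ i) :=
    vec_anti (by
      simp only [Pi.single_apply, ite_mul, one_mul, zero_mul, Finset.sum_ite_eq', Finset.mem_univ,
        if_true, if_neg h])
  unfold Commute SemiconjBy
  rw [← mul_assoc, h1, neg_mul, mul_assoc, vol_anti hc h, mul_neg, neg_neg, mul_assoc]

theorem commute_vol {p : Fin n → Fin n} {k : Fin n} {x : Cl n}
    (h : ∀ i, p i = k → Commute x (ξ i)) : Commute x (vol p k) := by
  refine Commute.smul_right (Commute.list_prod_right _ _ fun y hy => ?_) _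
  obtain ⟨i, hi, rfl⟩ := List.mem_map.1 hy
  exact h i (mem_block.1 (by simpa using hi))

theorem commute_unitVec {p : Fin n → Fin n} {k : Fin n} {x : Cl n}
    (h : ∀ i, p i = k → Commute x (ξ i)) : Commute x (unitVec p k) := by
  rw [unitVec_eq]
  refine Commute.sum_right _ _ _ fun i _ => ?_
  split_ifs with hi
  · exact (h i hi).smul_right _
  · simp

theorem assoc_commute {p : Fin n → Fin n} (hp : OddContent p) {c d : Fin n}
    (hc : content p c ≠ 0) :
    Commute (unitVec p c * vol p c) (unitVec p d * vol p d) := by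
  rcases eq_or_ne c d with rfl | h
  · exact Commute.refl _
  have : ∀ i, p i = d → Commute (unitVec p c * vol p c) (ξ i) := fun i hi =>
    (commute_assoc (hp c hc) (by rw [hi]; exact h.symm)).symm
  exact (commute_unitVec this).mul_right (commute_vol this)

theorem vol_commute_of_mem {p : Fin n → Fin n} {k : Fin n} (hk : Odd (content p k)) :
    Commute (unitVec p k) (vol p k) :=
  (commute_unitVec fun _ hi => Commute.symm (vol_comm_of_mem hk hi)).symm

theorem assoc_sq {p : Fin n → Fin n} (hp : OddContent p) {c : Fin n} (hc : content p c ≠ 0) :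
    (unitVec p c * vol p c) * (unitVec p c * vol p c) = 1 := by
  rw [(vol_commute_of_mem (hp c hc)).symm.mul_mul_mul_comm, unitVec_sq hc, vol_sq, one_mul]

theorem assocBelow_commute {p : Fin n → Fin n} (hp : OddContent p) (b d : Fin n) :
    Commute (assocBelow p b) (assocBelow p d) := by
  refine Commute.list_prod_left _ _ fun x hx => Commute.list_prod_right _ _ fun y hy => ?_
  obtain ⟨c, hc, rfl⟩ := List.mem_map.1 hx
  obtain ⟨e, he, rfl⟩ := List.mem_map.1 hy
  simp at hc
  exact assoc_commute hp hc.2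

theorem assocBelow_sq {p : Fin n → Fin n} (hp : OddContent p) (b : Fin n) :
    assocBelow p b * assocBelow p b = 1 := by
  unfold assocBelow
  have : ∀ l : List (Fin n), (∀ c ∈ l, content p c ≠ 0) →
      (l.map fun c => unitVec p c * vol p c).prod *
        (l.map fun c => unitVec p c * vol p c).prod = 1 := by
    intro l
    induction l with
    | nil => intro _; simp
    | cons a l ih =>
      intro hl
      simp only [List.map_cons, List.prod_cons]
      have hc : Commute (l.map fun c => unitVec p c * vol p c).prod (unitVec p a * vol p a) :=
        Commute.list_prod_left _ _ fun x hx => by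
          obtain ⟨c, hc, rfl⟩ := List.mem_map.1 hx
          exact assoc_commute hp (hl c (by simp [hc]))
      rw [hc.mul_mul_mul_comm, assoc_sq hp (hl a (by simp)), one_mul,
        ih fun c hc => hl c (by simp [hc])]
  exact this _ fun c hc => by simp at hc; exact hc.2

/-- The action of `ξ_i - ξ_j` inside a factor, for `i` and `j` in the same block. -/
def blockDiff (p : Fin n → Fin n) (i j : Fin n) : Cl n := (ξ i - ξ j) * vol p (p i)

theorem blockDiff_commute_of {p : Fin n → Fin n} {i j : Fin n} (hij : p i = p j) {x : Cl n}
    (h : ∀ m, p m = p i → Commute x (ξ m)) : Commute x (blockDiff p i j) :=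
  ((h i rfl).sub_right (h j hij.symm)).mul_right (commute_vol h)

theorem diff_eq (i j : Fin n) : (ξ i - ξ j : Cl n) = vec (Pi.single i 1 - Pi.single j 1) := by
  simp [ξ, vec]

theorem blockDiff_assoc_anti {p : Fin n → Fin n} {i j : Fin n} (hk : Odd (content p (p i)))
    (hij : p i = p j) :
    blockDiff p i j * (unitVec p (p i) * vol p (p i)) =
      -((unitVec p (p i) * vol p (p i)) * blockDiff p i j) := by
  have h1 : (ξ i - ξ j) * unitVec p (p i) = -(unitVec p (p i) * (ξ i - ξ j)) := by
    rw [diff_eq]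
    refine vec_anti ?_
    simp only [Pi.sub_apply, Pi.single_apply, sub_mul, ite_mul, one_mul, zero_mul,
      Finset.sum_sub_distrib, Finset.sum_ite_eq', Finset.mem_univ, if_true, hij, sub_self]
  have h2 : Commute (vol p (p i)) (ξ i - ξ j) :=
    ((show Commute (ξ i) (vol p (p i)) from vol_comm_of_mem hk rfl).sub_left
      (show Commute (ξ j) (vol p (p i)) from vol_comm_of_mem hk hij.symm)).symm
  unfold blockDiff
  rw [(vol_commute_of_mem hk).symm.mul_mul_mul_comm, h2.mul_mul_mul_comm, h1, neg_mul]

theorem blockDiff_below {p : Fin n → Fin n} (hp : OddContent p) {i j : Fin n}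
    (hij : p i = p j) (d : Fin n) :
    blockDiff p i j * assocBelow p d =
      if p i < d then -(assocBelow p d * blockDiff p i j)
      else assocBelow p d * blockDiff p i j := by
  have hk : content p (p i) ≠ 0 := content_ne_zero rfl
  have hcomm : ∀ c, content p c ≠ 0 → p i ≠ c →
      Commute (blockDiff p i j) (unitVec p c * vol p c) := fun c hc h =>
    (blockDiff_commute_of hij fun m hm =>
      (commute_assoc (hp c hc) (by rw [hm]; exact h)).symm).symm
  have : ∀ l : List (Fin n), l.Nodup → (∀ c ∈ l, content p c ≠ 0) →
      blockDiff p i j * (l.map fun c => unitVec p c * vol p c).prod =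
        if p i ∈ l then -((l.map fun c => unitVec p c * vol p c).prod * blockDiff p i j)
        else (l.map fun c => unitVec p c * vol p c).prod * blockDiff p i j := by
    intro l
    induction l with
    | nil => simp
    | cons a l ih =>
      intro hl hc
      rw [List.nodup_cons] at hl
      have ih := ih hl.2 fun c h => hc c (by simp [h])
      simp only [List.map_cons, List.prod_cons]
      by_cases h : p i = a
      · subst h
        rw [if_neg hl.1] at ih
        rw [if_pos (by simp), ← mul_assoc, blockDiff_assoc_anti (hp _ hk) hij, neg_mul, mul_assoc,
          ih, ← mul_assoc]
      · rw [← mul_assoc, (hcomm a (hc a (by simp)) h).eq, mul_assoc, ih]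
        simp only [List.mem_cons, h, false_or]
        split_ifs
        · rw [mul_neg, ← mul_assoc]
        · rw [← mul_assoc]
  have h := this ((List.finRange n).filter fun c => c < d ∧ content p c ≠ 0)
    ((List.nodup_finRange n).filter _) (fun c hc => by simp at hc; exact hc.2)
  simpa [hk, assocBelow] using h

theorem blockDiff_mul {p : Fin n → Fin n} (hp : OddContent p) {i i' j j' : Fin n}
    (hij : p i = p j) (hj : p j = p j') :
    blockDiff p i i' * blockDiff p j j' = (ξ i - ξ i') * (ξ j - ξ j') := by
  have hk := hp (p i) (content_ne_zero rfl)
  have h2 : Commute (vol p (p i)) (ξ j - ξ j') :=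
    ((show Commute (ξ j) (vol p (p i)) from vol_comm_of_mem hk hij.symm).sub_left
      (show Commute (ξ j') (vol p (p i)) from vol_comm_of_mem hk (hij.trans hj).symm)).symm
  unfold blockDiff
  rw [← hij, h2.mul_mul_mul_comm, vol_sq, mul_one]

theorem blockDiff_commute {p : Fin n → Fin n} (hp : OddContent p) {i i' j j' : Fin n}
    (hi : p i = p i') (hij : p i ≠ p j) (hj : p j = p j') :
    Commute (blockDiff p i i') (blockDiff p j j') := by
  refine blockDiff_commute_of hj fun m hm => (Commute.symm ?_)
  have hm' : p m ≠ p i := by rw [hm]; exact hij.symm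
  have hk := hp (p i) (content_ne_zero rfl)
  have hne : m ≠ i := fun h => hm' (by rw [h])
  have hne' : m ≠ i' := fun h => hm' (by rw [h, hi])
  unfold Commute SemiconjBy blockDiff
  rw [← mul_assoc, mul_sub, ξ_anti hne, ξ_anti hne', mul_assoc _ _ (ξ m), ← neg_neg (vol p (p i) * ξ m),
    ← vol_anti hk hm']
  simp only [mul_neg, ← mul_assoc, sub_mul, neg_mul]
  abel

/-- The positions `j` and `j + 1` exchanged by `s_j`. -/
def fstPos {p : Fin n → Fin n} (j : youngIndex p) : Fin n :=
  ⟨j, lt_of_lt_of_le (Nat.lt_succ_self _) (le_of_lt j.2.1)⟩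

def sndPos {p : Fin n → Fin n} (j : youngIndex p) : Fin n := ⟨j + 1, j.2.1⟩

theorem fst_snd {p : Fin n → Fin n} (j : youngIndex p) : p (fstPos j) = p (sndPos j) := j.2.2

theorem youngElt_eq (p : Fin n → Fin n) (j : youngIndex p) : youngElt p j =
    (Complex.I / ((Real.sqrt 2 : ℝ) : ℂ)) •
      (assocBelow p (p (fstPos j)) * blockDiff p (fstPos j) (sndPos j)) := rfl

theorem I_div_sq : (Complex.I / ((Real.sqrt 2 : ℝ) : ℂ)) * (Complex.I / ((Real.sqrt 2 : ℝ) : ℂ)) =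
    -(1 / 2 : ℂ) := by
  rw [div_mul_div_comm, Complex.I_mul_I, ← Complex.ofReal_mul,
    Real.mul_self_sqrt (by norm_num)]
  norm_num

theorem diff_mul_add (i i' j j' : Fin n) (r : ℂ)
    (h : 2 * ∑ m, (Pi.single i 1 - Pi.single i' 1 : Fin n → ℂ) m *
      (Pi.single j 1 - Pi.single j' 1 : Fin n → ℂ) m = r) :
    (ξ i - ξ i') * (ξ j - ξ j') + (ξ j - ξ j') * (ξ i - ξ i') = algebraMap ℂ (Cl n) r := by
  rw [diff_eq, diff_eq, vec_add_swap, h]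

theorem youngElt_mul_same {p : Fin n → Fin n} (hp : OddContent p) (i j : youngIndex p)
    (h : p (fstPos i) = p (fstPos j)) :
    youngElt p i * youngElt p j =
      (-(1 / 2 : ℂ)) • ((ξ (fstPos i) - ξ (sndPos i)) * (ξ (fstPos j) - ξ (sndPos j))) := by
  have hb := blockDiff_below hp (fst_snd i) (p (fstPos i))
  rw [if_neg (lt_irrefl _)] at hb
  rw [youngElt_eq, youngElt_eq, smul_mul_smul_comm, I_div_sq, ← h,
    Commute.mul_mul_mul_comm hb, assocBelow_sq hp, one_mul,
    blockDiff_mul hp h (fst_snd j)]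

theorem youngElt_sq {p : Fin n → Fin n} (hp : OddContent p) (i : youngIndex p) :
    youngElt p i * youngElt p i = -1 := by
  have hne : fstPos i ≠ sndPos i := by simp [fstPos, sndPos]
  rw [youngElt_mul_same hp i i rfl, diff_eq, vec_sq]
  have : ∑ m, (Pi.single (fstPos i) 1 - Pi.single (sndPos i) 1 : Fin n → ℂ) m *
      (Pi.single (fstPos i) 1 - Pi.single (sndPos i) 1 : Fin n → ℂ) m = 2 := by
    simp only [Pi.sub_apply, sub_mul, Finset.sum_sub_distrib, Pi.single_apply, ite_mul, one_mul,
      zero_mul, Finset.sum_ite_eq', Finset.mem_univ, if_true, hne, hne.symm, if_false]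
    norm_num
  rw [this, Algebra.smul_def, ← map_mul]
  norm_num

theorem youngElt_far {p : Fin n → Fin n} (hp : OddContent p) (i j : youngIndex p)
    (h : (i : ℕ) + 2 ≤ j ∨ (j : ℕ) + 2 ≤ i) :
    youngElt p i * youngElt p j = -(youngElt p j * youngElt p i) := by
  by_cases hb : p (fstPos i) = p (fstPos j)
  · rw [youngElt_mul_same hp i j hb, youngElt_mul_same hp j i hb.symm, ← smul_neg]
    congr 1
    have h1 : fstPos i ≠ fstPos j := by simp [fstPos]; omega
    have h2 : fstPos i ≠ sndPos j := by simp [fstPos, sndPos]; omega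
    have h3 : sndPos i ≠ fstPos j := by simp [fstPos, sndPos]; omega
    have h4 : sndPos i ≠ sndPos j := by simp [sndPos]; omega
    rw [diff_eq, diff_eq]
    apply vec_anti
    simp [sub_mul, Finset.sum_sub_distrib, Pi.single_apply, h1, h2, h3, h4]
  · have key : ∀ i j : youngIndex p, p (fstPos i) < p (fstPos j) →
        youngElt p i * youngElt p j = -(youngElt p j * youngElt p i) := by
      intro i j h
      have h1 := blockDiff_below hp (fst_snd i) (p (fstPos j))
      have h2 := blockDiff_below hp (fst_snd j) (p (fstPos i))
      rw [if_pos h] at h1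
      rw [if_neg (not_lt_of_gt h)] at h2
      rw [youngElt_eq, youngElt_eq, smul_mul_smul_comm, smul_mul_smul_comm, ← smul_neg,
        Commute.mul_mul_mul_comm h2, mul_assoc, ← mul_assoc (blockDiff _ _ _) (assocBelow _ _), h1,
        neg_mul, mul_neg, ← (blockDiff_commute hp (fst_snd i) h.ne (fst_snd j)).eq,
        ← (assocBelow_commute hp (p (fstPos i)) (p (fstPos j))).eq]
      simp only [mul_assoc]
    rcases lt_or_gt_of_ne hb with h | h
    · exact key i j h
    · rw [key j i h, neg_neg]

theorem youngElt_braid {p : Fin n → Fin n} (hp : OddContent p) (i j : youngIndex p)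
    (h : (j : ℕ) = i + 1) :
    youngElt p i * youngElt p j * youngElt p i = youngElt p j * youngElt p i * youngElt p j := by
  have hs : sndPos i = fstPos j := by simp [fstPos, sndPos, h]
  have hb : p (fstPos i) = p (fstPos j) := by rw [fst_snd i, hs]
  have h1 : fstPos i ≠ fstPos j := by simp [fstPos]; omega
  have h2 : fstPos i ≠ sndPos j := by simp [fstPos, sndPos]; omega
  have h3 : fstPos j ≠ sndPos j := by simp [fstPos, sndPos]
  have hadd : youngElt p i * youngElt p j + youngElt p j * youngElt p i = 1 := by
    rw [youngElt_mul_same hp i j hb, youngElt_mul_same hp j i hb.symm, ← smul_add,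
      diff_mul_add _ _ _ _ (-2), Algebra.smul_def, ← map_mul]
    · norm_num
    · simp [hs, sub_mul, Finset.sum_sub_distrib, Pi.single_apply, h1, h2, h3]
  have e : youngElt p j * youngElt p i = 1 - youngElt p i * youngElt p j := eq_sub_of_add_eq' hadd
  rw [mul_assoc, e, mul_sub, mul_one, ← mul_assoc, youngElt_sq hp, sub_mul, one_mul, mul_assoc,
    youngElt_sq hp]
  simp [add_comm]

theorem keeps_youngElt {p : Fin n → Fin n} (hp : OddContent p) (i : youngIndex p) :
    Keeps p (youngElt p i) := by
  refine ((keeps_assocBelow hp _).mul (Flips.mul (k := p (fstPos i)) ?_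
    (flips_vol (hp _ (content_ne_zero rfl))))).smul _
  refine (flips_ξ p _).sub ?_
  have := flips_ξ p (sndPos i)
  rwa [← fst_snd i] at this

end Clifford

/-! ### The representations -/

/-- Left multiplication by `youngElt p j` on the tensor product of even and odd parts. -/
def youngOp {n : ℕ} (p : Fin n → Fin n) (hp : OddContent p) (s : Fin n → ℤ) (j : youngIndex p) :
    Module.End ℂ (tensorPart p s) :=
  (LinearMap.mulLeft ℂ (youngElt p j)).restrict (keeps_youngElt hp j s)

theorem youngOp_apply {n : ℕ} (p : Fin n → Fin n) (hp : OddContent p) (s : Fin n → ℤ)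
    (j : youngIndex p) (x : tensorPart p s) : (youngOp p hp s j x : Cl n) = youngElt p j * x := rfl

theorem youngOp_sq {n : ℕ} (p : Fin n → Fin n) (hp : OddContent p) (s : Fin n → ℤ)
    (j : youngIndex p) : youngOp p hp s j * youngOp p hp s j = -1 := by
  ext x
  simp [youngOp_apply, ← mul_assoc, youngElt_sq hp]

def youngUnit {n : ℕ} (p : Fin n → Fin n) (hp : OddContent p) (s : Fin n → ℤ)
    (j : youngIndex p) : (Module.End ℂ (tensorPart p s))ˣ where
  val := youngOp p hp s j
  inv := -youngOp p hp s j
  val_inv := LinearMap.ext fun x => Subtype.ext (by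
    simp [youngOp_apply, ← mul_assoc, youngElt_sq hp])
  inv_val := LinearMap.ext fun x => Subtype.ext (by
    simp [youngOp_apply, ← mul_assoc, youngElt_sq hp])

/-- The operator `-1`. -/
def negUnit {n : ℕ} (p : Fin n → Fin n) (s : Fin n → ℤ) : (Module.End ℂ (tensorPart p s))ˣ where
  val := -1
  inv := -1
  val_inv := LinearMap.ext fun x => by simp
  inv_val := LinearMap.ext fun x => by simp

/-- The spin representation of the double cover of the Young subgroup `S_{α(p)}` on the tensor
product of even and odd parts of Clifford algebras: `s_j` acts as left multiplication by
`youngElt p j`, and `z` acts as `-1`. -/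
def youngRep {n : ℕ} (p : Fin n → Fin n) (hp : OddContent p) (s : Fin n → ℤ) :
    Representation ℂ (YoungCover p) (tensorPart p s) :=
  (Units.coeHom _).comp <| Cover.lift (G := (Module.End ℂ (tensorPart p s))ˣ)
    (youngUnit p hp s) (negUnit p s) (Units.ext (negUnit p s).val_inv)
    (fun i => Units.ext (youngOp_sq p hp s i))
    (fun i j h => Units.ext (LinearMap.ext fun x => Subtype.ext (by
      simp [youngUnit, negUnit, youngOp_apply, ← mul_assoc, youngElt_far hp i j h])))
    (fun i j h => Units.ext (LinearMap.ext fun x => Subtype.ext (by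
      simp [youngUnit, youngOp_apply, ← mul_assoc, youngElt_braid hp i j h])))

theorem youngRep_s {n : ℕ} (p : Fin n → Fin n) (hp : OddContent p) (s : Fin n → ℤ)
    (j : youngIndex p) (x : tensorPart p s) :
    (youngRep p hp s (Cover.s j) x : Cl n) = youngElt p j * x := by
  simp [youngRep, Cover.lift, Cover.s, youngUnit, youngOp_apply]

theorem youngRep_z {n : ℕ} (p : Fin n → Fin n) (hp : OddContent p) (s : Fin n → ℤ) :
    youngRep p hp s Cover.z = -1 := by
  simp [youngRep, Cover.lift, Cover.z, negUnit]

/-- The module `ℂ[S_n^-] ⊗_{ℂ[S_{α(p)}^-]} (C_{α_1}^{s_1} ⊗ ⋯ ⊗ C_{α_n}^{s_n})` attached to a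
sorted odd shifted parking function.  Note that `IndV.mk _ _ h x` is the class written
`h⁻¹ ⊗ x` in the usual notation. -/
abbrev Summand {n : ℕ} (s : SortedOShPf n) : Type :=
  Representation.IndV (YoungCover.incl s.p) (youngRep s.p s.oddShape.content s.sign)

/-- The direct sum of the induced modules over all sorted odd shifted parking functions. -/
abbrev InducedSum (n : ℕ) : Type := ⨁ s : SortedOShPf n, Summand s

/-- The action of the double cover on the direct sum of the induced modules. -/
def inducedSumRep (n : ℕ) : Representation ℂ (DoubleCover n) (InducedSum n) :=
  Representation.directSum fun s : SortedOShPf n =>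
    Representation.ind (YoungCover.incl s.p) (youngRep s.p s.oddShape.content s.sign)

/-- For `π` in the symmetric group, the set of the positions `i` with `σ_{π(i)} = -1`. -/
def negSet {n : ℕ} (σ : Fin n → ℤˣ) (w : Equiv.Perm (Fin n)) : Finset (Fin n) :=
  Finset.univ.filter fun i => σ (w i) = -1

theorem mono_negSet_mem {n : ℕ} (t : OShPf n) (w : Equiv.Perm (Fin n))
    (hw : Monotone (t.p ∘ w)) : mono (negSet t.σ w) ∈ tensorPart t.toSorted.p t.toSorted.sign := by
  have e : t.toSorted.p = t.p ∘ w := (Tuple.comp_sort_eq_comp_iff_monotone.2 hw).symm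
  rw [e]
  refine Submodule.subset_span ⟨_, fun k hk => ?_, rfl⟩
  show _ = blockSign t.p t.σ k
  rw [card_block_comp] at hk
  rw [blockSign, if_neg hk]
  have h1 : ∏ i ∈ block t.p k, (t.σ i : ℤ) = ∏ i ∈ block (t.p ∘ w) k, (t.σ (w i) : ℤ) := by
    refine Finset.prod_bij' (fun i _ => w.symm i) (fun i _ => w i) ?_ ?_ ?_ ?_ ?_ <;>
      simp [block]
  have h2 : ∀ i, (t.σ (w i) : ℤ) = if t.σ (w i) = -1 then -1 else 1 := by
    intro i
    rcases Int.units_eq_one_or (t.σ (w i)) with h | h <;> simp [h]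
  rw [h1, Finset.prod_congr rfl fun i _ => h2 i, Finset.prod_ite, Finset.prod_const,
    Finset.prod_const_one, mul_one]
  congr 2
  ext i
  simp [negSet, and_comm]

open Classical in
/-- The element `π ⊗ ξ_{i_1} ⋯ ξ_{i_k}` of the direct sum of induced modules attached to
`(p, σ, τ)`, where `g` is an element of the double cover lying over a permutation `π` for which
`(p_{π(1)}, …, p_{π(n)})` is weakly increasing, and `i_1 < ⋯ < i_k` are the indices `i` with
`σ_{π(i)} = -1`. -/
def tensorVector {n : ℕ} (t : OShPf n) (g : DoubleCover n)
    (hg : Monotone (t.p ∘ DoubleCover.proj n g)) : InducedSum n :=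
  DirectSum.lof ℂ (SortedOShPf n) Summand t.toSorted
    (Representation.IndV.mk _ _ g⁻¹ ⟨mono (negSet t.σ (DoubleCover.proj n g)),
      mono_negSet_mem t _ hg⟩)

/-- Transport of a representation along a linear isomorphism `e`. -/
def transport {G V W : Type*} [Group G] [AddCommGroup V] [Module ℂ V] [AddCommGroup W]
    [Module ℂ W] (e : V ≃ₗ[ℂ] W) (ρ : Representation ℂ G W) : Representation ℂ G V where
  toFun g := e.symm.toLinearMap ∘ₗ ρ g ∘ₗ e.toLinearMap
  map_one' := by ext; simp
  map_mul' g h := by ext; simp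

end OddParking

end

/-! The isomorphism. An induced module has the basis r ⊗ x, with r running over coset
representatives and x over a basis of the inducing module. Here the cosets of the Young cover
correspond to the rearrangements p of the sorted function, with representative `π p`, and the
monomials ξ_I of prescribed parities correspond to the sign vectors σ with prescribed block signs.
For this bookkeeping to be exact, the monomials must be linearly independent in the Clifford algebra
(`toggleRep_mono`) and the Young cover must embed in the double cover (`incl_injective`). The
embedding rests on the normal form in Coxeter groups of type A (`eq_one_of_apply_eq_one`) and on the
basic spin representation, which separates z from 1.

The character. The diagonal coefficient of g at (p, σ, τ) vanishes unless the permutation under g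
fixes p; otherwise it is the coefficient `tr0` of 1 in the Clifford element by which a conjugate of
g acts, and it does not depend on σ and τ. A generator of the Young cover acts as in the basic spin
representation, up to a factor that commutes up to sign with everything relevant and has square ±1.
For elements of odd order modulo z these factors disappear (`youngSpin_eq_basicSpin`). So each
triple with p fixed by π_λ contributes the basic spin value 2^((ℓ(λ)-n)/2) (`tr0_basicSpin_posRep`),
and the character at π_λ is this value times the number of such triples (`character_posRep`).

The count. Over a p of content α there are 2^n w(α) triples, where w(α) is `stackWeight 0` of α
(`card_OShPf_over`): relative to two free signs per occurring integer, a factor 1/2 is lost whenever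
an integer closes an arc or opens one inside another. Products of complete homogeneous functions
count the functions fixed by π_λ by content (`prod_hgen`). The spin character is therefore 2^(n/2) ∑
w(α) ∏ q_{α_k}, where q_k = sh(h_k) and α runs over the contents of parking functions with odd
nonzero entries. It remains to see that this sum equals ∑ ∏ q_{α_k} over the contents of all parking
functions.

The generating function. Contents of parking functions are lattice paths with steps α_k - 1, and the
paths of n steps from height h to 0 have total weight [t^(n-h)] q^n (q - t q'). As sh kills the even
power sums, q(t) q(-t) = 1, so the even and odd parts e and o of q satisfy e² - o² = 1. With ρ =
o/(1+e) this gives q = 1 + o + oρ and 2qρ = o(1+ρ)². These two identities say that [t^(n-h)] q^n (q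
- t q') ρ^d solves the recursion for weighted odd paths with d open arcs; at d = 0 both sums agree
(`sum_pathWeight_eq_sum_oddPathWeight`). -/

noncomputable section

namespace OddParking

/-! ### Monomials form a basis of the Clifford algebra -/

section Clifford

variable {n : ℕ}

/-- An algebra map out of `Cl n` from anticommuting elements of square `1`. -/
def Cl.lift {A : Type*} [Ring A] [Algebra ℂ A] (T : Fin n → A) (h1 : ∀ i, T i * T i = 1)
    (h2 : ∀ i j, i ≠ j → T i * T j = -(T j * T i)) : Cl n →ₐ[ℂ] A :=
  CliffordAlgebra.lift (Q n) ⟨Fintype.linearCombination ℂ T, fun v => by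
    have key : ∀ i j, T i * T j + T j * T i = if i = j then 2 else 0 := by
      intro i j
      split_ifs with h
      · rw [h, h1, one_add_one_eq_two]
      · rw [h2 i j h, neg_add_cancel]
    -- The square is doubled so that the double sum can be symmetrised in i and j; then only the
    -- anticommutators in `key` occur.
    have h3 : (2 : ℂ) • (Fintype.linearCombination ℂ T v * Fintype.linearCombination ℂ T v) =
        (2 : ℂ) • algebraMap ℂ A (Q n v) := by
      simp only [Fintype.linearCombination_apply, Finset.sum_mul_sum, two_smul]
      nth_rewrite 2 [Finset.sum_comm]
      rw [← Finset.sum_add_distrib]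
      have : ∀ i, (∑ j, v i • T i * v j • T j + ∑ j, v j • T j * v i • T i) =
          algebraMap ℂ A (2 * (v i * v i)) := by
        intro i
        rw [← Finset.sum_add_distrib]
        have : ∀ j, v i • T i * v j • T j + v j • T j * v i • T i =
            if i = j then algebraMap ℂ A (2 * (v i * v i)) else 0 := by
          intro j
          rw [smul_mul_smul_comm, smul_mul_smul_comm, mul_comm (v j), ← smul_add, key]
          split_ifs with h
          · subst h
            rw [Algebra.smul_def, mul_comm 2, map_mul _ _ (2 : ℂ), map_ofNat (algebraMap ℂ A) 2]
          · simp
        rw [Finset.sum_congr rfl fun j _ => this j]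
        simp only [Finset.sum_ite_eq, Finset.mem_univ, if_true]
      rw [Finset.sum_congr rfl fun i _ => this i, ← map_sum, Q_apply, ← Finset.mul_sum, ← map_add,
        two_mul]
    exact smul_right_injective A (two_ne_zero : (2 : ℂ) ≠ 0) h3⟩

theorem Cl.lift_ξ {A : Type*} [Ring A] [Algebra ℂ A] (T : Fin n → A) (h1 : ∀ i, T i * T i = 1)
    (h2 : ∀ i j, i ≠ j → T i * T j = -(T j * T i)) (i : Fin n) :
    Cl.lift T h1 h2 (ξ i) = T i := by
  simp [Cl.lift, ξ, vec, Fintype.linearCombination_apply_single]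

/-- Membership of `i` is toggled. -/
def toggle (i : Fin n) (I : Finset (Fin n)) : Finset (Fin n) := symmDiff I {i}

theorem mem_toggle {i j : Fin n} {I : Finset (Fin n)} :
    j ∈ toggle i I ↔ (j ∈ I ∧ j ≠ i) ∨ (j ∉ I ∧ j = i) := by
  simp only [toggle, Finset.mem_symmDiff, Finset.mem_singleton]
  tauto

theorem toggle_toggle (i : Fin n) (I : Finset (Fin n)) : toggle i (toggle i I) = I := by
  simp [toggle]

theorem toggle_comm (i j : Fin n) (I : Finset (Fin n)) :
    toggle i (toggle j I) = toggle j (toggle i I) := by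
  simp only [toggle, symmDiff_assoc, symmDiff_comm {i} {j}]

/-- The sign of moving `ξ_i` past the smaller generators of `ξ_I`. -/
def passSign (i : Fin n) (I : Finset (Fin n)) : ℂ := (-1) ^ (I.filter (· < i)).card

theorem passSign_sq (i : Fin n) (I : Finset (Fin n)) : passSign i I * passSign i I = 1 := by
  rw [passSign, ← mul_pow]; simp

theorem passSign_toggle_of_le {i j : Fin n} (h : i ≤ j) (I : Finset (Fin n)) :
    passSign i (toggle j I) = passSign i I := by
  unfold passSign
  congr 2
  ext k
  simp only [Finset.mem_filter, mem_toggle]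
  constructor
  · rintro ⟨h1 | h1, h2⟩
    · exact ⟨h1.1, h2⟩
    · exact absurd (h1.2 ▸ h2) (not_lt_of_ge h)
  · rintro ⟨h1, h2⟩
    exact ⟨Or.inl ⟨h1, (lt_of_lt_of_le h2 h).ne⟩, h2⟩

theorem passSign_toggle_of_lt {i j : Fin n} (h : j < i) (I : Finset (Fin n)) :
    passSign i (toggle j I) = -passSign i I := by
  unfold passSign
  by_cases hj : j ∈ I
  · have : I.filter (· < i) = insert j ((toggle j I).filter (· < i)) := by
      ext k
      simp only [Finset.mem_filter, Finset.mem_insert, mem_toggle]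
      by_cases hk : k = j
      · subst hk; simp [hj, h]
      · simp [hk]
    rw [this, Finset.card_insert_of_notMem (by simp [mem_toggle, hj]), pow_succ]
    simp
  · have : (toggle j I).filter (· < i) = insert j (I.filter (· < i)) := by
      ext k
      simp only [Finset.mem_filter, Finset.mem_insert, mem_toggle]
      by_cases hk : k = j
      · subst hk; simp [hj, h]
      · simp [hk]
    rw [this, Finset.card_insert_of_notMem (by simp [hj]), pow_succ]
    simp

/-- The operator of left multiplication by `ξ_i` in the basis of monomials. -/
def toggleOp (i : Fin n) : Module.End ℂ (Finset (Fin n) → ℂ) where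
  toFun f I := passSign i I * f (toggle i I)
  map_add' f g := by ext I; simp [mul_add]
  map_smul' c f := by ext I; simp; ring

theorem toggleOp_apply (i : Fin n) (f : Finset (Fin n) → ℂ) (I : Finset (Fin n)) :
    toggleOp i f I = passSign i I * f (toggle i I) := rfl

theorem toggleOp_single (i : Fin n) (I : Finset (Fin n)) :
    toggleOp i (Pi.single I 1) = passSign i I • Pi.single (toggle i I) 1 := by
  ext J
  rw [toggleOp_apply, Pi.smul_apply, smul_eq_mul]
  by_cases h : J = toggle i I
  · subst h
    rw [toggle_toggle, passSign_toggle_of_le le_rfl]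
    simp
  · have : toggle i J ≠ I := fun h' => h (by rw [← h', toggle_toggle])
    rw [Pi.single_eq_of_ne h, Pi.single_eq_of_ne this]
    simp

theorem toggleOp_sq (i : Fin n) : toggleOp i * toggleOp i = 1 := by
  ext f I
  simp only [Module.End.mul_apply, toggleOp_apply, LinearMap.coe_comp, Function.comp]
  rw [passSign_toggle_of_le le_rfl, toggle_toggle, ← mul_assoc, passSign_sq]
  simp

/-- The toggles themselves commute. Toggling the smaller index changes the pass sign of the larger
one, but not conversely, so exactly one sign appears. -/
theorem toggleOp_anti (i j : Fin n) (h : i ≠ j) :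
    toggleOp i * toggleOp j = -(toggleOp j * toggleOp i) := by
  refine LinearMap.ext fun f => funext fun I => ?_
  simp only [Module.End.mul_apply, toggleOp_apply, LinearMap.neg_apply, Pi.neg_apply]
  rw [toggle_comm j i]
  rcases lt_or_gt_of_ne h with h | h
  · rw [passSign_toggle_of_le h.le, passSign_toggle_of_lt h]; ring
  · rw [passSign_toggle_of_le h.le, passSign_toggle_of_lt h]; ring

/-- The regular representation in the basis of monomials. -/
def Cl.toggleRep : Cl n →ₐ[ℂ] Module.End ℂ (Finset (Fin n) → ℂ) :=
  Cl.lift toggleOp toggleOp_sq toggleOp_anti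

/-- The coefficient of `ξ_I`. -/
def coef (I : Finset (Fin n)) : Cl n →ₗ[ℂ] ℂ :=
  LinearMap.proj I ∘ₗ LinearMap.applyₗ (Pi.single ∅ 1) ∘ₗ Cl.toggleRep.toLinearMap

theorem coef_apply (I : Finset (Fin n)) (x : Cl n) :
    coef I x = Cl.toggleRep x (Pi.single ∅ 1) I := rfl

/-- Built up from the right, each new generator is smaller than all those present and passes none of
them, so no signs arise. This makes `coef` dual to the monomials and proves their independence. -/
theorem toggleRep_mono (I : Finset (Fin n)) :
    Cl.toggleRep (mono I) (Pi.single ∅ 1) = Pi.single I 1 := by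
  have : ∀ l : List (Fin n), l.Pairwise (· < ·) →
      Cl.toggleRep (l.map ξ).prod (Pi.single ∅ 1) = Pi.single l.toFinset 1 := by
    intro l hl
    induction l with
    | nil => simp
    | cons a l ih =>
      rw [List.pairwise_cons] at hl
      rw [List.map_cons, List.prod_cons, map_mul, Module.End.mul_apply, ih hl.2, Cl.toggleRep,
        Cl.lift_ξ, toggleOp_single]
      have h1 : passSign a l.toFinset = 1 := by
        rw [passSign, Finset.filter_eq_empty_iff.2]
        · simp
        · intro x hx
          exact not_lt_of_gt (hl.1 x (by simpa using hx))
      have h2 : toggle a l.toFinset = (a :: l).toFinset := by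
        ext k
        simp only [mem_toggle, List.mem_toFinset, List.mem_cons]
        have : a ∉ l := fun h => lt_irrefl _ (hl.1 a h)
        by_cases hk : k = a
        · subst hk; simp [this]
        · simp [hk]
      rw [h1, h2, one_smul]
  rw [mono, this _ (Finset.sortedLT_sort I).pairwise, Finset.sort_toFinset]

theorem coef_mono (I J : Finset (Fin n)) : coef I (mono J) = if I = J then 1 else 0 := by
  rw [coef_apply, toggleRep_mono, Pi.single_apply]

theorem mono_empty : mono (∅ : Finset (Fin n)) = 1 := by simp [mono]

theorem ξ_mul_mono (i : Fin n) (I : Finset (Fin n)) :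
    ξ i * mono I = mono (toggle i I) ∨ ξ i * mono I = -mono (toggle i I) := by
  by_cases h : i ∈ I
  · have : toggle i I = I.erase i := by
      ext k; rw [mem_toggle, Finset.mem_erase]
      by_cases hk : k = i
      · subst hk; simp [h]
      · simp [hk]
    rw [this]; exact ξ_mul_mono_of_mem h
  · have : toggle i I = insert i I := by
      ext k; rw [mem_toggle, Finset.mem_insert]
      by_cases hk : k = i
      · subst hk; simp [h]
      · simp [hk]
    rw [this]; exact ξ_mul_mono_of_not_mem h

theorem mono_mul_mono (I J : Finset (Fin n)) :
    mono I * mono J = mono (symmDiff I J) ∨ mono I * mono J = -mono (symmDiff I J) := by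
  have : ∀ l : List (Fin n), l.Nodup →
      (l.map ξ).prod * mono J = mono (symmDiff l.toFinset J) ∨
      (l.map ξ).prod * mono J = -mono (symmDiff l.toFinset J) := by
    intro l hl
    induction l with
    | nil => left; simp [symmDiff]
    | cons a l ih =>
      rw [List.nodup_cons] at hl
      have e : symmDiff (a :: l).toFinset J = toggle a (symmDiff l.toFinset J) := by
        ext k
        simp only [mem_toggle, Finset.mem_symmDiff, List.mem_toFinset, List.mem_cons]
        by_cases hk : k = a
        · subst hk
          simp only [true_or, hl.1]; tauto
        · simp only [hk]; tauto
      rw [List.map_cons, List.prod_cons, mul_assoc, e]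
      rcases ih hl.2 with h | h <;> rw [h]
      · exact ξ_mul_mono _ _
      · rw [mul_neg, neg_inj, neg_eq_iff_eq_neg]; exact (ξ_mul_mono _ _).symm
  simpa [mono] using this (I.sort (· ≤ ·)) (Finset.sort_nodup _ _)

theorem span_mono : Submodule.span ℂ (Set.range (mono (n := n))) = ⊤ := by
  rw [Submodule.eq_top_iff']
  intro x
  induction x using CliffordAlgebra.left_induction with
  | algebraMap r =>
    rw [Algebra.algebraMap_eq_smul_one, ← mono_empty]
    exact Submodule.smul_mem _ _ (Submodule.subset_span ⟨_, rfl⟩)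
  | add x y hx hy => exact add_mem hx hy
  | ι_mul x m hx =>
    rw [show CliffordAlgebra.ι (Q n) m = vec m from rfl, vec_eq_sum, Finset.sum_mul]
    refine sum_mem fun i _ => ?_
    rw [smul_mul_assoc]
    refine Submodule.smul_mem _ _ ?_
    induction hx using Submodule.span_induction with
    | zero => simp
    | add x y _ _ hx hy => rw [mul_add]; exact add_mem hx hy
    | smul c x _ hx => rw [mul_smul_comm]; exact Submodule.smul_mem _ _ hx
    | mem x hx =>
      obtain ⟨I, rfl⟩ := hx
      rcases ξ_mul_mono i I with h | h <;> rw [h]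
      · exact Submodule.subset_span ⟨_, rfl⟩
      · exact neg_mem (Submodule.subset_span ⟨_, rfl⟩)

theorem Cl.mono_induction {P : Cl n → Prop} (h0 : P 0) (hadd : ∀ x y, P x → P y → P (x + y))
    (hsmul : ∀ (c : ℂ) x, P x → P (c • x)) (hm : ∀ I, P (mono I)) (x : Cl n) : P x := by
  have hx : x ∈ Submodule.span ℂ (Set.range (mono (n := n))) := by rw [span_mono]; trivial
  induction hx using Submodule.span_induction with
  | zero => exact h0
  | add x y _ _ hx hy => exact hadd _ _ hx hy
  | smul c x _ hx => exact hsmul _ _ hx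
  | mem x hx => obtain ⟨I, rfl⟩ := hx; exact hm I

/-- The normalized trace: the coefficient of `1`. -/
def tr0 : Cl n →ₗ[ℂ] ℂ := coef ∅

theorem tr0_mono (J : Finset (Fin n)) : tr0 (mono J) = if J = ∅ then 1 else 0 := by
  rw [tr0, coef_mono]; simp [eq_comm]

theorem tr0_one : tr0 (1 : Cl n) = 1 := by rw [← mono_empty, tr0_mono]; simp

/-- Multiplication by ξ_J with J nonempty sends ξ_I to a different monomial up to sign. So all
diagonal entries of left multiplication by x equal the constant coefficient of x, which later makes
diagonal coefficients independent of σ. -/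
theorem coef_mul_mono (x : Cl n) (I : Finset (Fin n)) : coef I (x * mono I) = tr0 x := by
  induction x using Cl.mono_induction with
  | h0 => simp
  | hadd x y hx hy => rw [add_mul, map_add, map_add, hx, hy]
  | hsmul c x hx => rw [smul_mul_assoc, map_smul, map_smul, hx]
  | hm J =>
    rw [tr0_mono]
    by_cases hJ : J = ∅
    · subst hJ; rw [mono_empty, one_mul, coef_mono]; simp
    · rw [if_neg hJ]
      have : I ≠ symmDiff J I := fun h => hJ (by
        have := congrArg (symmDiff · I) h
        simpa using this.symm)
      rcases mono_mul_mono J I with h | h <;> rw [h]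
      · rw [coef_mono, if_neg this]
      · rw [map_neg, coef_mono, if_neg this, neg_zero]

theorem tr0_mono_mul (I J : Finset (Fin n)) (h : I ≠ J) : tr0 (mono I * mono J) = 0 := by
  have : symmDiff I J ≠ ∅ := fun h' => h (symmDiff_eq_bot.1 h')
  rcases mono_mul_mono I J with h | h <;> rw [h]
  · rw [tr0_mono, if_neg this]
  · rw [map_neg, tr0_mono, if_neg this, neg_zero]

/-- On monomials, both sides vanish unless the two index sets are equal, and then there is nothing
to prove. -/
theorem tr0_mul_comm (x y : Cl n) : tr0 (x * y) = tr0 (y * x) := by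
  induction x using Cl.mono_induction with
  | h0 => simp
  | hadd x x' hx hy => rw [add_mul, mul_add, map_add, map_add, hx, hy]
  | hsmul c x hx => rw [smul_mul_assoc, mul_smul_comm, map_smul, map_smul, hx]
  | hm I =>
    induction y using Cl.mono_induction with
    | h0 => simp
    | hadd x x' hx hy => rw [add_mul, mul_add, map_add, map_add, hx, hy]
    | hsmul c x hx => rw [smul_mul_assoc, mul_smul_comm, map_smul, map_smul, hx]
    | hm J =>
      by_cases h : I = J
      · rw [h]
      · rw [tr0_mono_mul I J h, tr0_mono_mul J I (Ne.symm h)]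

/-! ### The trace of products of consecutive differences -/

/-- The span of the monomials in the generators `ξ_i` with `i ≥ r`. -/
def supportedFrom (n r : ℕ) : Submodule ℂ (Cl n) :=
  Submodule.span ℂ {x | ∃ I : Finset (Fin n), (∀ i ∈ I, r ≤ (i : ℕ)) ∧ x = mono I}

theorem supportedFrom_anti {r r' : ℕ} (h : r ≤ r') : supportedFrom n r' ≤ supportedFrom n r :=
  Submodule.span_mono fun _ ⟨I, hI, e⟩ => ⟨I, fun i hi => h.trans (hI i hi), e⟩

theorem one_mem_supportedFrom (r : ℕ) : (1 : Cl n) ∈ supportedFrom n r :=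
  Submodule.subset_span ⟨∅, by simp, mono_empty.symm⟩

theorem ξ_mul_mem_supportedFrom {r : ℕ} {i : Fin n} (hi : r ≤ (i : ℕ)) {y : Cl n}
    (hy : y ∈ supportedFrom n r) : ξ i * y ∈ supportedFrom n r := by
  induction hy using Submodule.span_induction with
  | zero => simp
  | add x y _ _ hx hy => rw [mul_add]; exact add_mem hx hy
  | smul c x _ hx => rw [mul_smul_comm]; exact Submodule.smul_mem _ _ hx
  | mem x hx =>
    obtain ⟨I, hI, rfl⟩ := hx
    have : mono (toggle i I) ∈ supportedFrom n r := by
      refine Submodule.subset_span ⟨_, fun j hj => ?_, rfl⟩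
      rw [mem_toggle] at hj
      rcases hj with h | h
      · exact hI j h.1
      · rwa [h.2]
    rcases ξ_mul_mono i I with h | h <;> rw [h]
    exacts [this, neg_mem this]

theorem tr0_ξ_mul {i : Fin n} {y : Cl n} (hy : y ∈ supportedFrom n (i + 1)) :
    tr0 (ξ i * y) = 0 := by
  induction hy using Submodule.span_induction with
  | zero => simp
  | add x y _ _ hx hy => rw [mul_add, map_add, hx, hy, add_zero]
  | smul c x _ hx => rw [mul_smul_comm, map_smul, hx, smul_zero]
  | mem x hx =>
    obtain ⟨I, hI, rfl⟩ := hx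
    have hi : i ∉ I := fun h => by have := hI i h; omega
    rcases ξ_mul_mono_of_not_mem hi with h | h <;> rw [h]
    · rw [tr0_mono, if_neg (Finset.insert_ne_empty _ _)]
    · rw [map_neg, tr0_mono, if_neg (Finset.insert_ne_empty _ _), neg_zero]

/-- Only the term -ξ_j ξ_j y survives: in ξ_i (ξ_j - ξ_k) y and in ξ_j ξ_k y the leading generator
does not occur in the rest, so the trace is zero. -/
theorem tr0_diff_diff {i j k : Fin n} (hj : (j : ℕ) = i + 1) (hk : (k : ℕ) = j + 1) {y : Cl n}
    (hy : y ∈ supportedFrom n k) : tr0 ((ξ i - ξ j) * ((ξ j - ξ k) * y)) = -tr0 y := by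
  have h1 : (ξ j - ξ k) * y ∈ supportedFrom n (i + 1) := by
    rw [sub_mul]
    have hy' := supportedFrom_anti (n := n) (show (i : ℕ) + 1 ≤ k by omega) hy
    exact sub_mem (ξ_mul_mem_supportedFrom (by omega) hy')
      (ξ_mul_mem_supportedFrom (by omega) hy')
  have h2 : ξ k * y ∈ supportedFrom n (j + 1) := by
    rw [← hk]; exact ξ_mul_mem_supportedFrom le_rfl hy
  rw [sub_mul, map_sub, tr0_ξ_mul h1, sub_mul, mul_sub, ← mul_assoc, ξ_sq, one_mul, map_sub,
    tr0_ξ_mul h2]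
  simp

end Clifford

/-! ### Faithfulness of the permutation action of type `A` Coxeter groups -/

section Coxeter

variable {K : Type*} [Group K] (t : ℕ → K) (J : Set ℕ)

/-- The product `t_{k+d-1} ⋯ t_{k+1} t_k`. -/
def descProd : ℕ → ℕ → K
  | _, 0 => 1
  | k, d + 1 => descProd (k + 1) d * t k

variable {t J} (hsq : ∀ j ∈ J, t j * t j = 1)
  (hfar : ∀ i ∈ J, ∀ j ∈ J, i + 2 ≤ j → t i * t j = t j * t i)
  (hbraid : ∀ i ∈ J, i + 1 ∈ J → t i * t (i + 1) * t i = t (i + 1) * t i * t (i + 1))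

include hfar in
theorem descProd_comm {j : ℕ} (hj : j ∈ J) (k d : ℕ) (hk : j + 1 < k)
    (hJ : ∀ i, k ≤ i → i < k + d → i ∈ J) : t j * descProd t k d = descProd t k d * t j := by
  induction d generalizing k with
  | zero => simp [descProd]
  | succ d ih =>
    rw [descProd, ← mul_assoc, ih (k + 1) (by omega) fun i h1 h2 => hJ i (by omega) (by omega),
      mul_assoc, hfar j hj k (hJ k le_rfl (by omega)) (by omega), mul_assoc]

-- The factor t_j moves left past t_k, …, t_{j-2}; one braid relation turns t_j t_{j-1} t_j into
-- t_{j-1} t_j t_{j-1}; and the new t_{j-1} moves past the remaining factors, whose indices are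
-- larger than j.
include hfar hbraid in
theorem descProd_mul {j : ℕ} (k d : ℕ) (hk : k < j) (hj : j < k + d)
    (hJ : ∀ i, k ≤ i → i < k + d → i ∈ J) :
    descProd t k d * t j = t (j - 1) * descProd t k d := by
  induction d generalizing k with
  | zero => omega
  | succ d ih =>
    rcases Nat.lt_or_ge (k + 1) j with h | h
    · rw [descProd, mul_assoc, hfar k (hJ k le_rfl (by omega)) j (hJ j (by omega) hj) (by omega),
        ← mul_assoc, ih (k + 1) h (by omega) fun i h1 h2 => hJ i (by omega) (by omega), mul_assoc]
    · obtain rfl : j = k + 1 := by omega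
      obtain ⟨d, rfl⟩ : ∃ e, d = e + 1 := ⟨d - 1, by omega⟩
      have h0 : k ∈ J := hJ k le_rfl (by omega)
      have h1 : k + 1 ∈ J := hJ (k + 1) (by omega) (by omega)
      rw [descProd, descProd, Nat.add_sub_cancel, mul_assoc, mul_assoc, ← mul_assoc (t (k + 1)),
        ← hbraid k h0 h1, ← mul_assoc, ← mul_assoc, ← mul_assoc, ← mul_assoc,
        descProd_comm hfar h0 (k + 1 + 1) d (by omega)
          fun i h1 h2 => hJ i (by omega) (by omega)]

-- Coset representatives of the parabolic subgroup on the indices below m in the one on the indices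
-- below m + 1 are 1 and the products t_m ⋯ t_k. The set of products x t_m ⋯ t_k contains 1 and is
-- stable under right multiplication by generators, hence is everything.
include hsq hfar hbraid in
theorem exists_eq_mul_descProd (m : ℕ) {w : K}
    (hw : w ∈ Subgroup.closure {x | ∃ j ∈ J, j < m + 1 ∧ x = t j}) :
    ∃ x ∈ Subgroup.closure {x | ∃ j ∈ J, j < m ∧ x = t j}, ∃ k d, k + d = m + 1 ∧
      (∀ i, k ≤ i → i < k + d → i ∈ J) ∧ w = x * descProd t k d := by
  have step : ∀ w : K, (∃ x ∈ Subgroup.closure {x | ∃ j ∈ J, j < m ∧ x = t j}, ∃ k d,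
      k + d = m + 1 ∧ (∀ i, k ≤ i → i < k + d → i ∈ J) ∧ w = x * descProd t k d) →
      ∀ j ∈ J, j < m + 1 → ∃ x ∈ Subgroup.closure {x | ∃ j ∈ J, j < m ∧ x = t j}, ∃ k d,
      k + d = m + 1 ∧ (∀ i, k ≤ i → i < k + d → i ∈ J) ∧ w * t j = x * descProd t k d := by
    rintro _ ⟨x, hx, k, d, hkd, hJ, rfl⟩ j hj hjm
    have hmem : ∀ i ∈ J, i < m → x * t i ∈ Subgroup.closure {x | ∃ j ∈ J, j < m ∧ x = t j} :=
      fun i hi him => mul_mem hx (Subgroup.subset_closure ⟨i, hi, him, rfl⟩)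
    -- Relative to t_m ⋯ t_k, the generator t_j commutes with it (j + 1 < k), lengthens it (j + 1 =
    -- k), cancels its last factor (j = k), or passes through it and becomes t_{j-1} (j > k).
    rcases lt_trichotomy (j + 1) k with h | h | h
    · refine ⟨x * t j, hmem j hj (by omega), k, d, hkd, hJ, ?_⟩
      rw [mul_assoc, mul_assoc, descProd_comm hfar hj k d h hJ]
    · subst h
      refine ⟨x, hx, j, d + 1, by omega, fun i h1 h2 => ?_, ?_⟩
      · rcases eq_or_lt_of_le h1 with rfl | h1
        · exact hj
        · exact hJ i h1 (by omega)
      · rw [descProd, mul_assoc]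
    · rcases eq_or_lt_of_le (show k ≤ j by omega) with rfl | h'
      · obtain ⟨d, rfl⟩ : ∃ e, d = e + 1 := ⟨d - 1, by omega⟩
        refine ⟨x, hx, k + 1, d, by omega, fun i h1 h2 => hJ i (by omega) (by omega), ?_⟩
        rw [descProd, mul_assoc, mul_assoc, hsq k hj, mul_one]
      · refine ⟨x * t (j - 1), hmem _ (hJ _ (by omega) (by omega)) (by omega), k, d, hkd, hJ, ?_⟩
        rw [mul_assoc, mul_assoc, descProd_mul hfar hbraid k d h' (by omega) hJ]
  induction hw using Subgroup.closure_induction_right with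
  | one => exact ⟨1, one_mem _, m + 1, 0, rfl, fun i h1 h2 => by omega, by simp [descProd]⟩
  | mul_right w y _ hy ih =>
    obtain ⟨j, hj, hjm, rfl⟩ := hy
    exact step w ih j hj hjm
  | mul_inv_cancel w y _ hy ih =>
    obtain ⟨j, hj, hjm, rfl⟩ := hy
    rw [inv_eq_of_mul_eq_one_left (hsq j hj)]
    exact step w ih j hj hjm

variable (f : K →* Equiv.Perm ℕ) (hf : ∀ j ∈ J, f (t j) = Equiv.swap j (j + 1))

include hf in
theorem apply_descProd (k d : ℕ) (hJ : ∀ i, k ≤ i → i < k + d → i ∈ J) :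
    f (descProd t k d) k = k + d := by
  induction d generalizing k with
  | zero => simp [descProd]
  | succ d ih =>
    rw [descProd, map_mul, hf k (hJ k le_rfl (by omega)), Equiv.Perm.mul_apply,
      Equiv.swap_apply_left, ih (k + 1) fun i h1 h2 => hJ i (by omega) (by omega)]
    omega

include hf in
theorem apply_closure_of_lt {m : ℕ} {x : K}
    (hx : x ∈ Subgroup.closure {x | ∃ j ∈ J, j < m ∧ x = t j}) {i : ℕ} (hi : m < i) :
    f x i = i := by
  induction hx using Subgroup.closure_induction with
  | mem x hx =>
    obtain ⟨j, hj, hjm, rfl⟩ := hx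
    rw [hf j hj, Equiv.swap_apply_of_ne_of_ne (by omega) (by omega)]
  | one => simp
  | mul x y _ _ hx hy => rw [map_mul, Equiv.Perm.mul_apply, hy, hx]
  | inv x _ hx =>
    rw [map_inv, Equiv.Perm.inv_eq_iff_eq, hx]

-- Write w = x t_m ⋯ t_k. The descending product sends k to m + 1, which x fixes; so f w = 1 forces
-- k = m + 1, the product is empty, and w = x lies in the smaller subgroup.
include hsq hfar hbraid hf in
theorem eq_one_of_apply_eq_one (m : ℕ) {w : K}
    (hw : w ∈ Subgroup.closure {x | ∃ j ∈ J, j < m ∧ x = t j}) (h1 : f w = 1) : w = 1 := by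
  induction m generalizing w with
  | zero => simpa using hw
  | succ m ih =>
    obtain ⟨x, hx, k, d, hkd, hJ, rfl⟩ := exists_eq_mul_descProd hsq hfar hbraid m hw
    have h2 := congrArg (fun e : Equiv.Perm ℕ => e k) h1
    simp only [map_mul, Equiv.Perm.mul_apply, apply_descProd f hf k d hJ,
      Equiv.Perm.one_apply] at h2
    rw [apply_closure_of_lt f hf hx (by omega)] at h2
    obtain rfl : d = 0 := by omega
    rw [descProd, mul_one] at h1 ⊢
    exact ih hx h1

end Coxeter

/-! ### The double covers -/

namespace Cover

variable {J : Set ℕ}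

/-- Centrality is not among the relations; it follows from z = s_j², which commutes with s_j. -/
theorem z_comm (g : Cover J) : z * g = g * z := by
  have : g ∈ Subgroup.centralizer {(z : Cover J)} := by
    have h : (⊤ : Subgroup (Cover J)) ≤ Subgroup.centralizer {(z : Cover J)} := by
      rw [← PresentedGroup.closure_range_of, Subgroup.closure_le]
      rintro _ ⟨o, rfl⟩
      rw [SetLike.mem_coe, Subgroup.mem_centralizer_singleton_iff]
      cases o with
      | none => rfl
      | some j =>
        change s j * z = z * s j
        rw [← s_sq j, mul_assoc]
    exact h trivial
  rw [Subgroup.mem_centralizer_singleton_iff] at this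
  exact this.symm

theorem z_inv : (z : Cover J)⁻¹ = z := inv_eq_of_mul_eq_one_left z_sq

theorem s_inv (j : J) : (s j)⁻¹ = s j * z := by
  rw [inv_eq_iff_mul_eq_one, ← mul_assoc, s_sq, z_sq]

theorem induction_on {P : Cover J → Prop} (one : P 1) (mul_s : ∀ g j, P g → P (g * s j))
    (mul_z : ∀ g, P g → P (g * z)) (g : Cover J) : P g := by
  have hg : g ∈ Subgroup.closure
      (Set.range (PresentedGroup.of : Option J → PresentedGroup {r | CoverRel J r})) := by
    rw [PresentedGroup.closure_range_of]; trivial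
  induction hg using Subgroup.closure_induction_right with
  | one => exact one
  | mul_right x y _ hy ih =>
    obtain ⟨o, rfl⟩ := hy
    cases o with
    | none => exact mul_z _ ih
    | some j => exact mul_s _ j ih
  | mul_inv_cancel x y _ hy ih =>
    obtain ⟨o, rfl⟩ := hy
    cases o with
    | none =>
      change P (x * z⁻¹)
      rw [z_inv]; exact mul_z _ ih
    | some j =>
      change P (x * (s j)⁻¹)
      rw [s_inv, ← mul_assoc]; exact mul_z _ (mul_s _ j ih)

theorem lift_s {G : Type*} [Group G] (f : J → G) (c : G) (h1 h2 h3 h4) (j : J) :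
    Cover.lift f c h1 h2 h3 h4 (s j) = f j := by
  simp [Cover.lift, s]

theorem lift_z {G : Type*} [Group G] (f : J → G) (c : G) (h1 h2 h3 h4) :
    Cover.lift f c h1 h2 h3 h4 (z : Cover J) = c := by
  simp [Cover.lift, z]

theorem hom_ext {G : Type*} [Group G] {f f' : Cover J →* G} (hs : ∀ j, f (s j) = f' (s j))
    (hz : f z = f' z) : f = f' := by
  refine MonoidHom.ext fun g => ?_
  induction g using induction_on with
  | one => simp
  | mul_s g j ih => rw [map_mul, map_mul, ih, hs]
  | mul_z g ih => rw [map_mul, map_mul, ih, hz]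

/-- The action on `ℕ`, the generator `s_j` acting as the transposition of `j` and `j + 1`. -/
def toPerm (J : Set ℕ) : Cover J →* Equiv.Perm ℕ :=
  Cover.lift (fun j => Equiv.swap (j : ℕ) (j + 1)) 1 (by simp) (by simp)
    (by
      rintro ⟨i, hi⟩ ⟨j, hj⟩ h
      simp only [one_mul]
      refine Equiv.Perm.Disjoint.commute fun k => ?_
      simp only at h
      by_cases hk : k = i ∨ k = i + 1
      · right; apply Equiv.swap_apply_of_ne_of_ne <;> omega
      · left; apply Equiv.swap_apply_of_ne_of_ne <;> omega)
    (by
      rintro ⟨i, hi⟩ ⟨j, hj⟩ h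
      simp only at h
      subst h
      simp only
      have h1 := Equiv.swap_mul_swap_mul_swap (show i ≠ i + 1 by omega) (show i ≠ i + 1 + 1 by omega)
      have h2 := Equiv.swap_mul_swap_mul_swap (show i + 1 + 1 ≠ i + 1 by omega)
        (show i + 1 + 1 ≠ i by omega)
      rw [Equiv.swap_comm (i + 1 + 1) (i + 1), Equiv.swap_comm (i + 1) i] at h2
      rw [h1, h2, Equiv.swap_comm])

theorem toPerm_s (j : J) : toPerm J (s j) = Equiv.swap (j : ℕ) (j + 1) := lift_s _ _ _ _ _ _ j

theorem toPerm_z : toPerm J z = 1 := lift_z _ _ _ _ _ _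

/-- Modulo z the relations become the Coxeter relations of type A on J, possibly with gaps, and the
permutation action of that quotient is faithful. -/
theorem eq_one_or_z_of_toPerm {w : Cover J} (hw : toPerm J w = 1) : w = 1 ∨ w = z := by
  classical
  let N : Subgroup (Cover J) := Subgroup.zpowers z
  have hN : N.Normal := ⟨fun x hx g => by
    obtain ⟨k, rfl⟩ := Subgroup.mem_zpowers_iff.1 hx
    have : Commute (z ^ k) g := Commute.zpow_left (z_comm g) k
    rw [← this.eq, mul_inv_cancel_right]
    exact hx⟩
  have hz : ∀ x ∈ N, x = 1 ∨ x = z := by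
    intro x hx
    obtain ⟨k, rfl⟩ := Subgroup.mem_zpowers_iff.1 hx
    have h2 : (z : Cover J) ^ (2 : ℤ) = 1 := by rw [zpow_two, z_sq]
    rcases Int.even_or_odd' k with ⟨m, rfl | rfl⟩
    · left; rw [zpow_mul, h2, one_zpow]
    · right; rw [zpow_add, zpow_mul, h2, one_zpow, one_mul, zpow_one]
  let q := QuotientGroup.mk' N
  have hqz : q z = 1 := (QuotientGroup.eq_one_iff _).2 (Subgroup.mem_zpowers z)
  let f : Cover J ⧸ N →* Equiv.Perm ℕ := QuotientGroup.lift N (toPerm J) (by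
    intro x hx
    rcases hz x hx with rfl | rfl
    · simp
    · exact toPerm_z)
  let t : ℕ → Cover J ⧸ N := fun j => if h : j ∈ J then q (s ⟨j, h⟩) else 1
  have ht : ∀ j (h : j ∈ J), t j = q (s ⟨j, h⟩) := fun j h => dif_pos h
  -- Faithfulness was proved by induction on a bound for the indices; a single word involves
  -- finitely many generators, so it has such a bound.
  have hmem : ∀ w : Cover J, ∃ m, q w ∈ Subgroup.closure {x | ∃ j ∈ J, j < m ∧ x = t j} := by
    intro w
    induction w using induction_on with
    | one => exact ⟨0, by simp⟩
    | mul_s g j ih =>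
      obtain ⟨m, hm⟩ := ih
      refine ⟨max m (j + 1), ?_⟩
      rw [map_mul]
      refine mul_mem (Subgroup.closure_mono ?_ hm)
        (Subgroup.subset_closure ⟨j, j.2, by omega, (ht j j.2).symm⟩)
      rintro x ⟨i, hi, him, rfl⟩
      exact ⟨i, hi, by omega, rfl⟩
    | mul_z g ih => rwa [map_mul, hqz, mul_one]
  obtain ⟨m, hm⟩ := hmem w
  have := eq_one_of_apply_eq_one (t := t) (J := J)
    (fun j hj => by rw [ht j hj, ← map_mul, s_sq, hqz])
    (fun i hi j hj h => by
      rw [ht i hi, ht j hj, ← map_mul, s_far _ _ (Or.inl h), map_mul, map_mul, hqz, one_mul])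
    (fun i hi hi' => by
      rw [ht i hi, ht _ hi', ← map_mul, ← map_mul, s_braid _ _ rfl, map_mul, map_mul])
    f (fun j hj => by
      rw [ht j hj]
      exact toPerm_s ⟨j, hj⟩) m hm hw
  exact hz w ((QuotientGroup.eq_one_iff _).1 this)

end Cover

/-! ### The basic spin representation -/

section BasicSpin

variable {n : ℕ}

/-- The unit vector along `ξ_j - ξ_{j+1}`, up to a factor `𝐢`. -/
def basicElt (j : {j | j + 1 < n}) : Cl n :=
  (Complex.I / ((Real.sqrt 2 : ℝ) : ℂ)) •
    (ξ ⟨j, lt_of_lt_of_le (Nat.lt_succ_self _) (le_of_lt j.2)⟩ - ξ ⟨j + 1, j.2⟩)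

theorem basicElt_sq (j : {j | j + 1 < n}) : basicElt j * basicElt j = -1 := by
  rw [basicElt, smul_mul_smul_comm, I_div_sq, diff_eq, vec_sq, Algebra.smul_def, ← map_mul]
  rw [show (-1 : Cl n) = algebraMap ℂ _ (-1) by simp]
  congr 1
  simp [sub_mul, Finset.sum_sub_distrib, Pi.single_apply]
  norm_num

theorem basicElt_far (i j : {j | j + 1 < n}) (h : (i : ℕ) + 2 ≤ j ∨ (j : ℕ) + 2 ≤ i) :
    basicElt i * basicElt j = -(basicElt j * basicElt i) := by
  rw [basicElt, basicElt, smul_mul_smul_comm, smul_mul_smul_comm, ← smul_neg, diff_eq, diff_eq]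
  congr 1
  apply vec_anti
  have h1 : (i : ℕ) ≠ j := by omega
  have h2 : (i : ℕ) ≠ j + 1 := by omega
  have h3 : (i : ℕ) + 1 ≠ j := by omega
  simp [sub_mul, Finset.sum_sub_distrib, Pi.single_apply, h1, h2, h3]

/-- Two elements a, b of square -1 with ab + ba = 1 satisfy aba = a(1 - ab) = a + b, which is
symmetric in a and b. The value 1 is (-1/2)·2·(-1), the last factor being the scalar product of
consecutive simple roots. -/
theorem basicElt_braid (i j : {j | j + 1 < n}) (h : (j : ℕ) = i + 1) :
    basicElt i * basicElt j * basicElt i = basicElt j * basicElt i * basicElt j := by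
  have hadd : basicElt i * basicElt j + basicElt j * basicElt i = 1 := by
    rw [basicElt, basicElt, smul_mul_smul_comm, smul_mul_smul_comm, I_div_sq, ← smul_add,
      diff_mul_add _ _ _ _ (-2), Algebra.smul_def, ← map_mul]
    · norm_num
    · have : ¬ (i : ℕ) = i + 1 + 1 := by omega
      simp [h, sub_mul, Finset.sum_sub_distrib, Pi.single_apply, this]
  have e : basicElt j * basicElt i = 1 - basicElt i * basicElt j := eq_sub_of_add_eq' hadd
  rw [mul_assoc, e, mul_sub, mul_one, ← mul_assoc, basicElt_sq, sub_mul, one_mul, mul_assoc,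
    basicElt_sq]
  simp [add_comm]

/-- A unit of square `-1`. -/
def unitOfSq {A : Type*} [Ring A] (x : A) (h : x * x = -1) : Aˣ where
  val := x
  inv := -x
  val_inv := by rw [mul_neg, h, neg_neg]
  inv_val := by rw [neg_mul, h, neg_neg]

/-- The basic spin representation, as a map to the units of the Clifford algebra. -/
def basicSpin (n : ℕ) : DoubleCover n →* (Cl n)ˣ :=
  Cover.lift (fun j => unitOfSq (basicElt j) (basicElt_sq j)) (-1) (by simp)
    (fun i => Units.ext (basicElt_sq i))
    (fun i j h => Units.ext (by simpa [unitOfSq] using basicElt_far i j h))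
    (fun i j h => Units.ext (basicElt_braid i j h))

theorem basicSpin_s (j : {j | j + 1 < n}) : (basicSpin n (Cover.s j) : Cl n) = basicElt j := by
  rw [basicSpin, Cover.lift_s]; rfl

theorem basicSpin_z : basicSpin n Cover.z = -1 := Cover.lift_z _ _ _ _ _ _

/-- The presentation does not collapse: z acts by -1 in the basic spin representation, and the
constant coefficient tells -1 from 1. -/
theorem z_ne_one : (Cover.z : DoubleCover n) ≠ 1 := by
  intro h
  have h1 := basicSpin_z (n := n)
  rw [h, map_one] at h1
  have h2 := congrArg (fun u : (Cl n)ˣ => tr0 (u : Cl n)) h1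
  simp [tr0_one] at h2
  norm_num at h2

/-- The action of the double cover of the Young subgroup, as a map to the units of the Clifford
algebra. -/
def youngSpin (p : Fin n → Fin n) (hp : OddContent p) : YoungCover p →* (Cl n)ˣ :=
  Cover.lift (fun j => unitOfSq (youngElt p j) (youngElt_sq hp j)) (-1) (by simp)
    (fun i => Units.ext (youngElt_sq hp i))
    (fun i j h => Units.ext (by simpa [unitOfSq] using youngElt_far hp i j h))
    (fun i j h => Units.ext (youngElt_braid hp i j h))

theorem youngSpin_s (p : Fin n → Fin n) (hp : OddContent p) (j : youngIndex p) :
    (youngSpin p hp (Cover.s j) : Cl n) = youngElt p j := by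
  rw [youngSpin, Cover.lift_s]; rfl

theorem youngSpin_z (p : Fin n → Fin n) (hp : OddContent p) :
    youngSpin p hp Cover.z = -1 := Cover.lift_z _ _ _ _ _ _

/-- The acting unit is the same for all sign patterns s, so traces can be computed inside the full
Clifford algebra. -/
theorem youngRep_apply (p : Fin n → Fin n) (hp : OddContent p) (s : Fin n → ℤ) (h : YoungCover p)
    (x : tensorPart p s) : (youngRep p hp s h x : Cl n) = youngSpin p hp h * (x : Cl n) := by
  induction h using Cover.induction_on generalizing x with
  | one => simp
  | mul_s g j ih =>
    rw [map_mul, Module.End.mul_apply, ih, youngRep_s, map_mul, Units.val_mul, youngSpin_s,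
      mul_assoc]
  | mul_z g ih =>
    rw [map_mul, Module.End.mul_apply, ih, youngRep_z, map_mul, Units.val_mul, youngSpin_z]
    simp

end BasicSpin

/-! ### The double cover of a Young subgroup inside the double cover -/

section Young

variable {n : ℕ}

theorem proj_s (j : {j | j + 1 < n}) : DoubleCover.proj n (Cover.s j) =
    Equiv.swap ⟨j, lt_of_lt_of_le (Nat.lt_succ_self _) (le_of_lt j.2)⟩ ⟨j + 1, j.2⟩ :=
  Cover.lift_s _ _ _ _ _ _ j

theorem proj_z : DoubleCover.proj n Cover.z = 1 := Cover.lift_z _ _ _ _ _ _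

theorem incl_s (p : Fin n → Fin n) (j : youngIndex p) :
    YoungCover.incl p (Cover.s j) = Cover.s ⟨j, j.2.1⟩ := Cover.lift_s _ _ _ _ _ _ j

theorem incl_z (p : Fin n → Fin n) : YoungCover.incl p Cover.z = Cover.z :=
  Cover.lift_z _ _ _ _ _ _

theorem val_proj (g : DoubleCover n) (i : Fin n) :
    (DoubleCover.proj n g i : ℕ) = Cover.toPerm _ g i := by
  induction g using Cover.induction_on generalizing i with
  | one => simp
  | mul_s g j ih =>
    rw [map_mul, Equiv.Perm.mul_apply, ih, map_mul, Equiv.Perm.mul_apply, proj_s, Cover.toPerm_s]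
    congr 1
    simp only [Equiv.swap_apply_def, Fin.ext_iff]
    split_ifs <;> rfl
  | mul_z g ih => rw [map_mul, map_mul, proj_z, Cover.toPerm_z, mul_one, mul_one, ih]

theorem toPerm_of_le (g : DoubleCover n) {i : ℕ} (hi : n ≤ i) : Cover.toPerm _ g i = i := by
  induction g using Cover.induction_on with
  | one => simp
  | mul_s g j ih =>
    have := j.2
    simp only [Set.mem_ofPred_eq] at this
    rw [map_mul, Equiv.Perm.mul_apply, Cover.toPerm_s,
      Equiv.swap_apply_of_ne_of_ne (by omega) (by omega), ih]
  | mul_z g ih => rw [map_mul, Cover.toPerm_z, mul_one, ih]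

theorem eq_one_or_z_of_proj {g : DoubleCover n} (hg : DoubleCover.proj n g = 1) :
    g = 1 ∨ g = Cover.z := by
  apply Cover.eq_one_or_z_of_toPerm
  ext i
  by_cases hi : i < n
  · rw [← val_proj g ⟨i, hi⟩, hg]; rfl
  · rw [toPerm_of_le g (by omega)]; rfl

theorem toPerm_incl (p : Fin n → Fin n) (h : YoungCover p) :
    Cover.toPerm _ (YoungCover.incl p h) = Cover.toPerm _ h := by
  have : (Cover.toPerm _).comp (YoungCover.incl p) = Cover.toPerm _ :=
    Cover.hom_ext
      (fun j => by rw [MonoidHom.comp_apply, incl_s, Cover.toPerm_s, Cover.toPerm_s])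
      (by rw [MonoidHom.comp_apply, incl_z, Cover.toPerm_z, Cover.toPerm_z])
  exact DFunLike.congr_fun this h

/-- An element of the kernel acts trivially on ℕ, hence is 1 or z; the second is excluded because z
survives in the double cover. -/
theorem incl_injective (p : Fin n → Fin n) : Function.Injective (YoungCover.incl p) := by
  rw [injective_iff_map_eq_one]
  intro h hh
  have h1 : Cover.toPerm _ h = 1 := by rw [← toPerm_incl, hh, map_one]
  rcases Cover.eq_one_or_z_of_toPerm h1 with rfl | rfl
  · rfl
  · rw [incl_z] at hh
    exact absurd hh z_ne_one

theorem comp_proj_incl (p : Fin n → Fin n) (h : YoungCover p) :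
    p ∘ DoubleCover.proj n (YoungCover.incl p h) = p := by
  induction h using Cover.induction_on with
  | one => simp
  | mul_s g j ih =>
    rw [map_mul, map_mul, Equiv.Perm.coe_mul, ← Function.comp_assoc, ih, incl_s, proj_s]
    funext i
    have := fst_snd j
    simp only [fstPos, sndPos] at this
    simp only [Function.comp, Equiv.swap_apply_def]
    split_ifs with h1 h2
    · rw [h1]; exact this.symm
    · rw [h2]; exact this
    · rfl
  | mul_z g ih => rw [map_mul, map_mul, incl_z, proj_z, mul_one, ih]

/-- A permutation lies in a subgroup generated by transpositions as soon as it preserves the orbits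
of that subgroup. The blocks of a weakly increasing function are intervals, so adjacent
transpositions inside them already act transitively on each block. -/
theorem exists_proj_incl {p : Fin n → Fin n} (hp : Monotone p) {w : Equiv.Perm (Fin n)}
    (hw : p ∘ w = p) : ∃ h : YoungCover p, DoubleCover.proj n (YoungCover.incl p h) = w := by
  let S : Set (Equiv.Perm (Fin n)) :=
    {x | ∃ j : youngIndex p, x = Equiv.swap (fstPos j) (sndPos j)}
  have hS : ∀ x ∈ S, x.IsSwap := by
    rintro _ ⟨j, rfl⟩
    exact ⟨_, _, by simp [fstPos, sndPos], rfl⟩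
  have hup : ∀ d (a b : Fin n), (b : ℕ) = a + d → p a = p b →
      b ∈ MulAction.orbit (Subgroup.closure S) a := by
    intro d
    induction d with
    | zero =>
      intro a b h _
      rw [show b = a from Fin.ext (by omega)]
      exact MulAction.mem_orbit_self a
    | succ d ih =>
      intro a b h hab
      let b' : Fin n := ⟨a + d, by omega⟩
      have hb' : p a = p b' := le_antisymm (hp (by simp [b', Fin.le_def]))
        (hab ▸ hp (by simp [b', Fin.le_def]; omega))
      have hj : (a : ℕ) + d ∈ youngIndex p := ⟨by omega, by
        have : (⟨a + d + 1, by omega⟩ : Fin n) = b := Fin.ext (by simp; omega)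
        rw [this, ← hab, hb']⟩
      obtain ⟨x, hx⟩ := ih a b' rfl hb'
      refine ⟨⟨_, Subgroup.subset_closure ⟨⟨_, hj⟩, rfl⟩⟩ * x, ?_⟩
      simp only at hx ⊢
      rw [mul_smul, hx]
      change Equiv.swap (fstPos ⟨_, hj⟩) (sndPos ⟨_, hj⟩) (fstPos ⟨_, hj⟩) = b
      rw [Equiv.swap_apply_left]
      exact Fin.ext (by simp [sndPos]; omega)
  have hmem : w ∈ Subgroup.closure S := by
    rw [mem_closure_isSwap hS]
    refine ⟨Set.toFinite _, fun x => ?_⟩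
    have hx : p x = p (w x) := (congrFun hw x).symm
    rcases le_total x (w x) with h | h
    · exact hup (w x - x) x (w x) (by rw [Fin.le_def] at h; omega) hx
    · rw [MulAction.mem_orbit_symm]
      exact hup (x - w x) (w x) x (by rw [Fin.le_def] at h; omega) hx.symm
  have hle : Subgroup.closure S ≤
      ((DoubleCover.proj n).comp (YoungCover.incl p)).range := by
    rw [Subgroup.closure_le]
    rintro _ ⟨j, rfl⟩
    exact ⟨Cover.s j, by rw [MonoidHom.comp_apply, incl_s, proj_s]; rfl⟩
  exact hle hmem

/-- A lift of the permutation differs from g by 1 or z, and z itself comes from the Young cover. -/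
theorem exists_incl {p : Fin n → Fin n} (hp : Monotone p) {g : DoubleCover n}
    (hg : p ∘ DoubleCover.proj n g = p) : ∃ h : YoungCover p, YoungCover.incl p h = g := by
  obtain ⟨h, hh⟩ := exists_proj_incl hp hg
  have : DoubleCover.proj n ((YoungCover.incl p h)⁻¹ * g) = 1 := by
    rw [map_mul, map_inv, hh, inv_mul_cancel]
  rcases eq_one_or_z_of_proj this with h1 | h1
  · exact ⟨h, inv_mul_eq_one.1 h1⟩
  · exact ⟨h * Cover.z, by rw [map_mul, incl_z, ← h1, mul_inv_cancel_left]⟩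

end Young

/-! ### Induced representations -/

section IndLift

open Representation

variable {G H A B : Type*} [Group G] [Group H] [AddCommGroup A] [Module ℂ A] [AddCommGroup B]
  [Module ℂ B] (φ : G →* H) (ρ : Representation ℂ G A)

/-- With `IndV.mk` at g and x read as g⁻¹ ⊗ x, this is the balancing relation g⁻¹ φ(h)⁻¹ ⊗ hx = g⁻¹
⊗ x. -/
theorem indV_mk_mul (h : G) (g : H) (x : A) :
    IndV.mk φ ρ (φ h * g) (ρ h x) = IndV.mk φ ρ g x := by
  have := Coinvariants.mk_self_apply (Representation.tprod ((leftRegular ℂ H).comp φ) ρ) h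
    (MonoidAlgebra.single g 1 ⊗ₜ x)
  simpa [IndV.mk] using this

/-- The linear map out of an induced representation given by a compatible family of linear maps. -/
def indLift (F : H → A →ₗ[ℂ] B) (hF : ∀ h g x, F (φ h * g) (ρ h x) = F g x) :
    IndV φ ρ →ₗ[ℂ] B :=
  Coinvariants.lift _ (TensorProduct.lift ((Finsupp.linearCombination ℂ F) ∘ₗ
    (MonoidAlgebra.coeffLinearEquiv ℂ).toLinearMap)) fun h => by
      refine TensorProduct.ext (MonoidAlgebra.lhom_ext' fun g => LinearMap.ext_ring ?_)
      refine LinearMap.ext fun x => ?_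
      simp [hF]

theorem indLift_mk (F : H → A →ₗ[ℂ] B) (hF : ∀ h g x, F (φ h * g) (ρ h x) = F g x) (g : H)
    (x : A) : indLift φ ρ F hF (IndV.mk φ ρ g x) = F g x := by
  simp [indLift, IndV.mk]

end IndLift

/-! ### Coordinate functionals on an induced representation -/

section Coordinates

variable {n : ℕ}

/-- The coefficient of `r ⊗ ξ_I`. -/
def indCoordAux (p : Fin n → Fin n) (hp : OddContent p) (s : Fin n → ℤ) (r : DoubleCover n)
    (I : Finset (Fin n)) (g : DoubleCover n) : tensorPart p s →ₗ[ℂ] ℂ :=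
  open Classical in
  -- If g⁻¹ = r h with h in the Young cover, then g⁻¹ ⊗ x = r ⊗ hx; vectors over other cosets have
  -- coefficient zero.
  if h : ∃ h, YoungCover.incl p h = r⁻¹ * g⁻¹ then
    coef I ∘ₗ LinearMap.mulLeft ℂ (youngSpin p hp h.choose : Cl n) ∘ₗ (tensorPart p s).subtype
  else 0

/-- The chosen preimage is irrelevant because the Young cover embeds; this is where `incl_injective`
enters the linear independence. -/
theorem indCoordAux_of {p : Fin n → Fin n} (hp : OddContent p) {s : Fin n → ℤ}
    {r : DoubleCover n} {I : Finset (Fin n)} {g : DoubleCover n} {h : YoungCover p}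
    (hh : YoungCover.incl p h = r⁻¹ * g⁻¹) (x : tensorPart p s) :
    indCoordAux p hp s r I g x = coef I (youngSpin p hp h * (x : Cl n)) := by
  have hex : ∃ h, YoungCover.incl p h = r⁻¹ * g⁻¹ := ⟨h, hh⟩
  have : hex.choose = h := incl_injective p (hex.choose_spec.trans hh.symm)
  rw [indCoordAux, dif_pos hex, this]
  rfl

theorem indCoordAux_not {p : Fin n → Fin n} (hp : OddContent p) {s : Fin n → ℤ}
    {r : DoubleCover n} {I : Finset (Fin n)} {g : DoubleCover n}
    (hh : ¬ ∃ h, YoungCover.incl p h = r⁻¹ * g⁻¹) (x : tensorPart p s) :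
    indCoordAux p hp s r I g x = 0 := by
  rw [indCoordAux, dif_neg hh]; rfl

/-- The coefficient of `r ⊗ ξ_I`, as a functional on the induced representation. -/
def indCoord (p : Fin n → Fin n) (hp : OddContent p) (s : Fin n → ℤ) (r : DoubleCover n)
    (I : Finset (Fin n)) :
    Representation.IndV (YoungCover.incl p) (youngRep p hp s) →ₗ[ℂ] ℂ :=
  indLift _ _ (indCoordAux p hp s r I) fun h g x => by
    by_cases hex : ∃ h, YoungCover.incl p h = r⁻¹ * g⁻¹
    · obtain ⟨k, hk⟩ := hex
      have hk' : YoungCover.incl p (k * h⁻¹) = r⁻¹ * (YoungCover.incl p h * g)⁻¹ := by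
        rw [map_mul, hk, map_inv, mul_inv_rev, mul_assoc]
      rw [indCoordAux_of hp hk, indCoordAux_of hp hk', youngRep_apply, ← mul_assoc,
        ← Units.val_mul, ← map_mul, inv_mul_cancel_right]
    · rw [indCoordAux_not hp hex, indCoordAux_not hp]
      rintro ⟨k, hk⟩
      exact hex ⟨k * h, by rw [map_mul, hk, mul_inv_rev, mul_assoc, inv_mul_cancel_right]⟩

theorem indCoord_mk_of {p : Fin n → Fin n} (hp : OddContent p) {s : Fin n → ℤ}
    {r : DoubleCover n} {I : Finset (Fin n)} {g : DoubleCover n} {h : YoungCover p}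
    (hh : YoungCover.incl p h = r⁻¹ * g⁻¹) (x : tensorPart p s) :
    indCoord p hp s r I (Representation.IndV.mk _ _ g x) =
      coef I (youngSpin p hp h * (x : Cl n)) := by
  rw [indCoord, indLift_mk, indCoordAux_of hp hh]

theorem indCoord_mk_not {p : Fin n → Fin n} (hp : OddContent p) {s : Fin n → ℤ}
    {r : DoubleCover n} {I : Finset (Fin n)} {g : DoubleCover n}
    (hh : ¬ ∃ h, YoungCover.incl p h = r⁻¹ * g⁻¹) (x : tensorPart p s) :
    indCoord p hp s r I (Representation.IndV.mk _ _ g x) = 0 := by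
  rw [indCoord, indLift_mk, indCoordAux_not hp hh]

end Coordinates

/-! ### Rearranging odd shifted parking functions -/

section Rearrange

variable {n : ℕ}

instance : Finite (OShPf n) := by
  refine Finite.of_injective (β := (Fin n → Fin n) × (Fin n → ℤˣ) × Finset (Fin n × Fin n))
    (fun t => (t.p, t.σ, t.τ)) fun t u h => ?_
  simp only [Prod.mk.injEq] at h
  exact OShPf.ext h.1 h.2.1 h.2.2

instance : Fintype (OShPf n) := Fintype.ofFinite _

theorem OShPf.toSorted_p (t : OShPf n) {w : Equiv.Perm (Fin n)} (hw : Monotone (t.p ∘ w)) :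
    t.toSorted.p = t.p ∘ w :=
  (Tuple.comp_sort_eq_comp_iff_monotone.2 hw).symm

theorem SortedOShPf.monotone (s : SortedOShPf n) : Monotone s.p := by
  obtain ⟨_, t, rfl⟩ := s
  exact Tuple.monotone_sort t.p

theorem blockSign_eq (p : Fin n → Fin n) (σ : Fin n → ℤˣ) (w : Equiv.Perm (Fin n)) {k : Fin n}
    (hk : content p k ≠ 0) :
    blockSign p σ k = (-1) ^ (negSet σ w ∩ block (p ∘ w) k).card := by
  rw [blockSign, if_neg hk]
  have h1 : ∏ i ∈ block p k, (σ i : ℤ) = ∏ i ∈ block (p ∘ w) k, (σ (w i) : ℤ) := by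
    refine Finset.prod_bij' (fun i _ => w.symm i) (fun i _ => w i) ?_ ?_ ?_ ?_ ?_ <;>
      simp [block]
  have h2 : ∀ i, (σ (w i) : ℤ) = if σ (w i) = -1 then -1 else 1 := by
    intro i
    rcases Int.units_eq_one_or (σ (w i)) with h | h <;> simp [h]
  rw [h1, Finset.prod_congr rfl fun i _ => h2 i, Finset.prod_ite, Finset.prod_const,
    Finset.prod_const_one, mul_one]
  congr 2
  ext i
  simp [negSet, and_comm]

theorem isParking_comp {p : Fin n → Fin n} (hp : IsParking p) (w : Equiv.Perm (Fin n)) :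
    IsParking (p ∘ w) := fun i => by
  have := congrFun (Tuple.comp_perm_comp_sort_eq_comp_sort (f := p) (σ := w)) i
  simp only [Function.comp] at this
  simp only [Function.comp, this]
  exact hp i

theorem shape_comp (p : Fin n → Fin n) (w : Equiv.Perm (Fin n)) : shape (p ∘ w) = shape p := by
  unfold shape
  congr 2
  funext k
  exact card_block_comp _ _ _

/-- Rearrange the entries of an odd shifted parking function, and change the signs without
changing the signs of the blocks. -/
def OShPf.rearrange (t : OShPf n) (w : Equiv.Perm (Fin n)) (σ : Fin n → ℤˣ)
    (h : blockSign (t.p ∘ w) σ = blockSign t.p t.σ) : OShPf n where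
  p := t.p ∘ w
  σ := σ
  τ := t.τ
  parking := isParking_comp t.parking w
  odd := by unfold OddShape; rw [shape_comp]; exact t.odd
  matching := by
    obtain ⟨h1, h2, h3, h4⟩ := t.matching
    refine ⟨h1, fun a b hab => ?_, h3, h4⟩
    rw [w.surjective.range_comp]
    exact h2 a b hab
  arc_sign := by rw [h]; exact t.arc_sign
  arc_cover := by rw [w.surjective.range_comp]; exact t.arc_cover
  arc_nested := by rw [h]; exact t.arc_nested

theorem OShPf.rearrange_toSorted (t : OShPf n) (w : Equiv.Perm (Fin n)) (σ : Fin n → ℤˣ)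
    (h : blockSign (t.p ∘ w) σ = blockSign t.p t.σ) :
    (t.rearrange w σ h).toSorted = t.toSorted := by
  refine Subtype.ext ?_
  change ((t.p ∘ w) ∘ Tuple.sort (t.p ∘ w), blockSign (t.p ∘ w) σ, t.τ) = t.sort
  rw [Tuple.comp_perm_comp_sort_eq_comp_sort, h]
  rfl

/-- The function is determined by w, and σ must be -1 exactly on w(I). The parity condition on I
says that these signs have the prescribed block signs, so the matching τ remains valid. -/
theorem exists_rearrangement (s : SortedOShPf n) (w : Equiv.Perm (Fin n)) (I : Finset (Fin n))
    (hI : ∀ k, content s.p k ≠ 0 → (-1) ^ (I ∩ block s.p k).card = s.sign k) :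
    ∃ t : OShPf n, t.toSorted = s ∧ t.p = s.p ∘ (w⁻¹ : Equiv.Perm (Fin n)) ∧ negSet t.σ w = I := by
  obtain ⟨_, t, rfl⟩ := s
  let v := Tuple.sort t.p
  let σ : Fin n → ℤˣ := fun i => if w⁻¹ i ∈ I then -1 else 1
  have hσ : negSet σ w = I := by
    ext i
    simp [negSet, σ]
  have h : blockSign (t.p ∘ (v * w⁻¹ : Equiv.Perm (Fin n))) σ = blockSign t.p t.σ := by
    funext k
    by_cases hk : content t.p k = 0
    · have hk' := card_block_comp t.p (v * w⁻¹) k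
      rw [hk] at hk'
      rw [blockSign, blockSign, if_pos hk', if_pos hk]
    · have hk' : content (t.p ∘ (v * w⁻¹ : Equiv.Perm (Fin n))) k ≠ 0 := by
        rwa [card_block_comp]
      rw [blockSign_eq _ σ w hk', hσ]
      have e : (t.p ∘ (v * w⁻¹ : Equiv.Perm (Fin n))) ∘ w = t.p ∘ v := by
        funext i; simp
      rw [e]
      refine hI k ?_
      change content (t.p ∘ v) k ≠ 0
      rwa [card_block_comp]
  exact ⟨t.rearrange _ σ h, t.rearrange_toSorted _ σ h, rfl, hσ⟩

end Rearrange

/-! ### The basis of the direct sum of induced representations -/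

section Basis

variable {n : ℕ}

open Classical in
/-- The class of `g⁻¹ ⊗ x` in the summand of `s`. -/
def summandMk (s : SortedOShPf n) (g : DoubleCover n) :
    tensorPart s.p s.sign →ₗ[ℂ] InducedSum n :=
  DirectSum.lof ℂ (SortedOShPf n) Summand s ∘ₗ Representation.IndV.mk _ _ g

theorem tensorVector_eq (t : OShPf n) (g : DoubleCover n)
    (hg : Monotone (t.p ∘ DoubleCover.proj n g)) : tensorVector t g hg =
    summandMk t.toSorted g⁻¹ ⟨mono (negSet t.σ (DoubleCover.proj n g)),
      mono_negSet_mem t _ hg⟩ := rfl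

theorem summandMk_mul (s : SortedOShPf n) (g : DoubleCover n) (h : YoungCover s.p)
    (x : tensorPart s.p s.sign) :
    summandMk s (YoungCover.incl s.p h * g) (youngRep s.p s.oddShape.content s.sign h x) =
      summandMk s g x := by
  classical
  exact congrArg (DirectSum.lof ℂ (SortedOShPf n) Summand s) (indV_mk_mul _ _ h g x)

theorem inducedSumRep_summandMk (s : SortedOShPf n) (g g' : DoubleCover n)
    (x : tensorPart s.p s.sign) :
    inducedSumRep n g (summandMk s g' x) = summandMk s (g' * g⁻¹) x := by
  classical
  rw [summandMk, summandMk, LinearMap.comp_apply, LinearMap.comp_apply]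
  change DirectSum.lmap _ (DirectSum.lof ℂ _ _ s _) = _
  rw [DirectSum.lmap_lof]
  exact congrArg (DirectSum.lof ℂ (SortedOShPf n) Summand s) (Representation.ind_mk _ _ g g' x)

theorem InducedSum.hom_ext {B : Type*} [AddCommGroup B] [Module ℂ B] {f f' : InducedSum n →ₗ[ℂ] B}
    (h : ∀ s g x, f (summandMk s g x) = f' (summandMk s g x)) : f = f' := by
  classical
  refine DirectSum.linearMap_ext (R := ℂ) fun s => ?_
  refine Representation.IndV.hom_ext _ _ fun g => LinearMap.ext fun x => ?_
  exact h s g x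

/-- Being central and in the Young cover, z slides through the tensor sign onto the second factor,
where it is -1. -/
theorem inducedSumRep_z : inducedSumRep n Cover.z = -1 := by
  refine InducedSum.hom_ext fun s g x => ?_
  rw [inducedSumRep_summandMk, Cover.z_inv, ← Cover.z_comm, ← incl_z s.p]
  have h := summandMk_mul s g Cover.z (-x)
  rw [youngRep_z] at h
  simpa using h

/-- The coefficient of `r ⊗ ξ_I` in the summand of `s`. -/
def sumCoord (s : SortedOShPf n) (r : DoubleCover n) (I : Finset (Fin n)) :
    InducedSum n →ₗ[ℂ] ℂ :=
  indCoord s.p s.oddShape.content s.sign r I ∘ₗ DirectSum.component ℂ _ _ s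

theorem sumCoord_mk_of (s : SortedOShPf n) (r : DoubleCover n) (I : Finset (Fin n))
    {g : DoubleCover n} {h : YoungCover s.p}
    (hh : YoungCover.incl s.p h = r⁻¹ * g⁻¹) (x : tensorPart s.p s.sign) :
    sumCoord s r I (summandMk s g x) =
      coef I (youngSpin s.p s.oddShape.content h * (x : Cl n)) := by
  classical
  rw [sumCoord, summandMk, LinearMap.comp_apply, LinearMap.comp_apply,
    DirectSum.component.lof_self, indCoord_mk_of _ hh]

theorem sumCoord_mk_not (s : SortedOShPf n) (r : DoubleCover n) (I : Finset (Fin n))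
    {g : DoubleCover n} (hh : ¬ ∃ h, YoungCover.incl s.p h = r⁻¹ * g⁻¹)
    (x : tensorPart s.p s.sign) :
    sumCoord s r I (summandMk s g x) = 0 := by
  classical
  rw [sumCoord, summandMk, LinearMap.comp_apply, LinearMap.comp_apply,
    DirectSum.component.lof_self, indCoord_mk_not _ hh]

theorem sumCoord_mk_ne {s s' : SortedOShPf n} (hs : s' ≠ s) (r : DoubleCover n)
    (I : Finset (Fin n)) (g : DoubleCover n) (x : tensorPart s'.p s'.sign) :
    sumCoord s r I (summandMk s' g x) = 0 := by
  classical
  rw [sumCoord, summandMk, LinearMap.comp_apply, LinearMap.comp_apply, DirectSum.component.of,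
    dif_neg hs, map_zero]

variable (π : (Fin n → Fin n) → DoubleCover n)
  (hπ : ∀ p : Fin n → Fin n, Monotone (p ∘ DoubleCover.proj n (π p)))

/-- The functional dual to `tensorVector t`. -/
def dualVector (t : OShPf n) : InducedSum n →ₗ[ℂ] ℂ :=
  sumCoord t.toSorted (π t.p) (negSet t.σ (DoubleCover.proj n (π t.p)))

theorem negSet_injective {σ σ' : Fin n → ℤˣ} {w : Equiv.Perm (Fin n)}
    (h : negSet σ w = negSet σ' w) : σ = σ' := by
  funext i
  have := congrArg (w⁻¹ i ∈ ·) h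
  simp only [negSet, Finset.mem_filter, Finset.mem_univ, true_and, Equiv.Perm.coe_inv,
    Equiv.apply_symm_apply, eq_iff_iff] at this
  rcases Int.units_eq_one_or (σ i) with h | h <;> rcases Int.units_eq_one_or (σ' i) with h' | h' <;>
    simp_all

-- Conjugation by `π t.p` carries the stabilizer of p to that of its sorted form, which is the image
-- of the Young cover.
include hπ in
theorem incl_exists_iff (t : OShPf n) (g : DoubleCover n) :
    (∃ h, YoungCover.incl t.toSorted.p h = (π t.p)⁻¹ * g * π t.p) ↔
      t.p ∘ DoubleCover.proj n g = t.p := by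
  have hp := t.toSorted_p (hπ t.p)
  have key : t.toSorted.p ∘ DoubleCover.proj n ((π t.p)⁻¹ * g * π t.p) = t.toSorted.p ↔
      t.p ∘ DoubleCover.proj n g = t.p := by
    rw [hp]
    have e : (t.p ∘ DoubleCover.proj n (π t.p)) ∘ DoubleCover.proj n ((π t.p)⁻¹ * g * π t.p) =
        (t.p ∘ DoubleCover.proj n g) ∘ DoubleCover.proj n (π t.p) := by
      funext i; simp [map_mul]
    rw [e]
    exact ((DoubleCover.proj n (π t.p)).surjective.injective_comp_right).eq_iff
  rw [← key]
  constructor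
  · rintro ⟨h, hh⟩
    rw [← hh, comp_proj_incl]
  · exact exists_incl t.toSorted.monotone

/-- The summand determines the sorted triple, hence τ; inside a summand the coset determines p; for
equal p the coset representatives agree, and the monomial determines σ. -/
theorem dualVector_tensorVector [DecidableEq (OShPf n)] (t u : OShPf n) :
    dualVector π t (tensorVector u (π u.p) (hπ u.p)) = if t = u then 1 else 0 := by
  rw [tensorVector_eq]
  split_ifs with htu
  · subst htu
    rw [dualVector, sumCoord_mk_of (h := 1) _ _ _ (by simp)]
    simp [coef_mono]
  · by_cases hs : u.toSorted = t.toSorted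
    · rw [dualVector, ← hs]
      by_cases hex : ∃ h, YoungCover.incl u.toSorted.p h = (π t.p)⁻¹ * ((π u.p)⁻¹)⁻¹
      · obtain ⟨h, hh⟩ := hex
        -- The quotient of the two representatives stabilizes the common sorted function, so
        -- unsorting it by either one gives the same function.
        have hp : t.p = u.p := by
          have h1 := comp_proj_incl u.toSorted.p h
          rw [hh, inv_inv] at h1
          nth_rewrite 1 [hs] at h1
          rw [t.toSorted_p (hπ t.p), u.toSorted_p (hπ u.p)] at h1
          have e : (t.p ∘ DoubleCover.proj n (π t.p)) ∘
              DoubleCover.proj n ((π t.p)⁻¹ * π u.p) = t.p ∘ DoubleCover.proj n (π u.p) := by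
            funext i; simp [map_mul]
          rw [e] at h1
          exact (DoubleCover.proj n (π u.p)).surjective.injective_comp_right h1
        have hτ : t.τ = u.τ := (congrArg (fun s : SortedOShPf n => s.1.2.2) hs).symm
        have hσ : t.σ ≠ u.σ := fun hσ => htu (OShPf.ext hp hσ hτ)
        have h1 : h = 1 := incl_injective _ (by rw [hh, hp]; simp)
        rw [sumCoord_mk_of _ _ _ hh, h1, map_one, Units.val_one, one_mul, coef_mono, if_neg, ]
        rw [hp]
        exact fun h => hσ (negSet_injective h)
      · exact sumCoord_mk_not _ _ _ hex _
    · exact sumCoord_mk_ne hs _ _ _ _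

-- The coefficient of ξ_I in h ξ_I is `tr0` of h for every I, so neither σ nor τ enters.
include hπ in
theorem dualVector_action (t : OShPf n) (g : DoubleCover n) {h : YoungCover t.toSorted.p}
    (hh : YoungCover.incl t.toSorted.p h = (π t.p)⁻¹ * g * π t.p) :
    dualVector π t (inducedSumRep n g (tensorVector t (π t.p) (hπ t.p))) =
      tr0 (youngSpin t.toSorted.p t.toSorted.oddShape.content h : Cl n) := by
  rw [tensorVector_eq, inducedSumRep_summandMk, dualVector, sumCoord_mk_of (h := h),
    coef_mul_mono]
  rw [hh, mul_inv_rev, inv_inv, inv_inv, mul_assoc]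

include hπ in
theorem dualVector_action_of_ne (t : OShPf n) (g : DoubleCover n)
    (hh : t.p ∘ DoubleCover.proj n g ≠ t.p) :
    dualVector π t (inducedSumRep n g (tensorVector t (π t.p) (hπ t.p))) = 0 := by
  rw [tensorVector_eq, inducedSumRep_summandMk, dualVector, sumCoord_mk_not]
  rintro ⟨h, hh'⟩
  refine hh ((incl_exists_iff π hπ t g).1 ⟨h, ?_⟩)
  rw [hh', mul_inv_rev, inv_inv, inv_inv, mul_assoc]

/-- The vector g⁻¹ ⊗ x lies over the rearrangement p' of the sorted function by g. Since `π p'`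
represents the same coset as g⁻¹, the balancing relation replaces g⁻¹ by `π p'`, and monomials in
place of x then give tensor vectors. -/
theorem summandMk_mem_span (s : SortedOShPf n) (g : DoubleCover n)
    (x : tensorPart s.p s.sign) : summandMk s g x ∈ Submodule.span ℂ
      (Set.range fun t : OShPf n => tensorVector t (π t.p) (hπ t.p)) := by
  set p' : Fin n → Fin n := s.p ∘ DoubleCover.proj n g with hp'
  have hsp : s.p = p' ∘ DoubleCover.proj n (π p') := by
    have h1 : Monotone (p' ∘ ((DoubleCover.proj n g)⁻¹ : Equiv.Perm (Fin n))) := by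
      convert! s.monotone using 1
      funext i; simp [p']
    rw [Tuple.unique_monotone (hπ p') h1]
    funext i; simp [p']
  obtain ⟨h, hh⟩ : ∃ h, YoungCover.incl s.p h = (π p')⁻¹ * g⁻¹ := by
    apply exists_incl s.monotone
    nth_rewrite 1 [hsp]
    funext i
    simp [map_mul, p']
  have hg : (π p')⁻¹ = YoungCover.incl s.p h * g := by rw [hh, inv_mul_cancel_right]
  rw [← summandMk_mul s g h x, ← hg]
  generalize youngRep s.p s.oddShape.content s.sign h x = y
  obtain ⟨y, hy⟩ := y
  induction hy using Submodule.span_induction with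
  | zero =>
    rw [show (⟨0, _⟩ : tensorPart s.p s.sign) = 0 from rfl, map_zero]; exact zero_mem _
  | add y z hy hz h1 h2 =>
    rw [show (⟨y + z, _⟩ : tensorPart s.p s.sign) = ⟨y, hy⟩ + ⟨z, hz⟩ from rfl, map_add]
    exact add_mem h1 h2
  | smul c y hy h1 =>
    rw [show (⟨c • y, _⟩ : tensorPart s.p s.sign) = c • ⟨y, hy⟩ from rfl, map_smul]
    exact Submodule.smul_mem _ _ h1
  | mem y hy =>
    obtain ⟨I, hI, rfl⟩ := hy
    obtain ⟨t, rfl, htp, htI⟩ := exists_rearrangement s (DoubleCover.proj n (π p')) I hI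
    have htp' : t.p = p' := by
      rw [htp]; nth_rewrite 1 [hsp]; funext i; simp
    refine Submodule.subset_span ⟨t, ?_⟩
    simp only [tensorVector_eq, htp', htI]

/-- The basis of the direct sum of the induced representations. -/
def tensorBasis : Module.Basis (OShPf n) ℂ (InducedSum n) :=
  Module.Basis.mk (v := fun t : OShPf n => tensorVector t (π t.p) (hπ t.p))
    (by
      classical
      refine LinearIndependent.of_pairwise_dual_eq_zero_one _ (dualVector π) ?_ ?_
      · intro t u htu
        simp only [dualVector_tensorVector, if_neg htu]
      · intro t
        simp only [dualVector_tensorVector, if_true])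
    (by
      intro x _
      -- The quotient map by the span vanishes on all g⁻¹ ⊗ x, hence is zero, so the span is
      -- everything.
      have : LinearMap.range (Submodule.subtype (Submodule.span ℂ
          (Set.range fun t : OShPf n => tensorVector t (π t.p) (hπ t.p)))) = ⊤ := by
        rw [← Submodule.ker_mkQ (LinearMap.range _), LinearMap.ker_eq_top]
        refine InducedSum.hom_ext fun s g x => ?_
        rw [LinearMap.zero_apply, Submodule.mkQ_apply, Submodule.Quotient.mk_eq_zero,
          Submodule.range_subtype]
        exact summandMk_mem_span π hπ s g x
      rw [Submodule.range_subtype] at this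
      rw [this]; trivial)

theorem tensorBasis_apply (t : OShPf n) :
    tensorBasis π hπ t = tensorVector t (π t.p) (hπ t.p) := by
  simp [tensorBasis]

theorem tensorBasis_repr (x : InducedSum n) (t : OShPf n) :
    (tensorBasis π hπ).repr x t = dualVector π t x := by
  classical
  have : Finsupp.lapply t ∘ₗ (tensorBasis π hπ).repr.toLinearMap = dualVector π t := by
    refine (tensorBasis π hπ).ext fun u => ?_
    rw [tensorBasis_apply, dualVector_tensorVector, ← tensorBasis_apply π hπ]
    simp [Finsupp.single_apply, eq_comm]
  exact LinearMap.congr_fun this x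

theorem character_transport (g : DoubleCover n) :
    (transport (tensorBasis π hπ).repr.symm (inducedSumRep n)).character g =
      ∑ t : OShPf n, dualVector π t (inducedSumRep n g (tensorVector t (π t.p) (hπ t.p))) := by
  classical
  rw [Representation.character,
    LinearMap.trace_eq_matrix_trace ℂ (Finsupp.basisSingleOne (R := ℂ) (ι := OShPf n)),
    Matrix.trace]
  refine Finset.sum_congr rfl fun t _ => ?_
  rw [Matrix.diag_apply, LinearMap.toMatrix_apply, ← tensorBasis_repr π hπ,
    ← tensorBasis_apply π hπ]
  simp [transport]

end Basis

/-! ### Commuting up to sign -/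

section CommSign

variable {R : Type*} [Ring R]

/-- `a` and `b` commute up to sign. -/
def CommSign (a b : R) : Prop := a * b = b * a ∨ a * b = -(b * a)

theorem CommSign.symm {a b : R} (h : CommSign a b) : CommSign b a := by
  rcases h with h | h
  · exact Or.inl h.symm
  · exact Or.inr (by rw [h, neg_neg])

theorem CommSign.of_commute {a b : R} (h : Commute a b) : CommSign a b := Or.inl h

theorem CommSign.mul_right {a b c : R} (h : CommSign a b) (h' : CommSign a c) :
    CommSign a (b * c) := by
  rcases h with h | h <;> rcases h' with h' | h'
  · left; rw [← mul_assoc, h, mul_assoc, h', mul_assoc]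
  · right; rw [← mul_assoc, h, mul_assoc, h', mul_neg, mul_assoc]
  · right; rw [← mul_assoc, h, neg_mul, mul_assoc, h', mul_assoc]
  · left; rw [← mul_assoc, h, neg_mul, mul_assoc, h', mul_neg, neg_neg, mul_assoc]

theorem CommSign.mul_left {a b c : R} (h : CommSign a c) (h' : CommSign b c) :
    CommSign (a * b) c := (h.symm.mul_right h'.symm).symm

theorem CommSign.one_right (a : R) : CommSign a 1 := Or.inl (by simp)

theorem CommSign.neg_one_right (a : R) : CommSign a (-1) := Or.inl (by simp)

theorem CommSign.list_prod_right {a : R} (l : List R) (h : ∀ x ∈ l, CommSign a x) :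
    CommSign a l.prod := by
  induction l with
  | nil => exact CommSign.one_right a
  | cons b l ih =>
    rw [List.prod_cons]
    exact (h b (by simp)).mul_right (ih fun x hx => h x (by simp [hx]))

theorem CommSign.smul_right [Algebra ℂ R] {a b : R} (h : CommSign a b) (c : ℂ) :
    CommSign a (c • b) := by
  rcases h with h | h
  · left; rw [mul_smul_comm, smul_mul_assoc, h]
  · right; rw [mul_smul_comm, smul_mul_assoc, h, smul_neg]

/-- `x` is `1` or `-1`. -/
def IsSign (x : R) : Prop := x = 1 ∨ x = -1

theorem IsSign.mul {x y : R} (hx : IsSign x) (hy : IsSign y) : IsSign (x * y) := by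
  rcases hx with rfl | rfl <;> rcases hy with rfl | rfl <;> simp [IsSign]

theorem IsSign.mul_mul_self {x y : R} (h : CommSign x y) (hx : IsSign (x * x))
    (hy : IsSign (y * y)) : IsSign (x * y * (x * y)) := by
  have e : x * y * (x * y) = x * (y * x) * y := by simp only [mul_assoc]
  rcases h.symm with h | h
  · rw [e, h, ← mul_assoc, mul_assoc (x * x)]; exact hx.mul hy
  · rw [e, h, mul_neg, neg_mul, ← mul_assoc, mul_assoc (x * x), ← neg_one_mul]
    exact IsSign.mul (Or.inr rfl) (hx.mul hy)

theorem CommSign.mul_pow {x y : R} (h : CommSign x y) (m : ℕ) :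
    (x * y) ^ m = x ^ m * y ^ m ∨ (x * y) ^ m = -(x ^ m * y ^ m) := by
  have hp : ∀ m, CommSign (y ^ m) x := by
    intro m
    induction m with
    | zero => rw [pow_zero]; exact (CommSign.one_right x).symm
    | succ m ih => rw [pow_succ]; exact ih.mul_left h.symm
  induction m with
  | zero => simp
  | succ m ih =>
    have key : x ^ m * y ^ m * (x * y) = x ^ (m + 1) * y ^ (m + 1) ∨
        x ^ m * y ^ m * (x * y) = -(x ^ (m + 1) * y ^ (m + 1)) := by
      have e : x ^ m * y ^ m * (x * y) = x ^ m * (y ^ m * x) * y := by simp only [mul_assoc]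
      have e' : x ^ (m + 1) * y ^ (m + 1) = x ^ m * (x * y ^ m) * y := by
        rw [pow_succ, pow_succ]; simp only [mul_assoc]
      rw [e, e']
      rcases hp m with h | h
      · left; rw [h]
      · right; rw [h, mul_neg, neg_mul]
    rw [pow_succ]
    rcases ih with h1 | h1 <;> rw [h1]
    · exact key
    · rw [neg_mul, neg_inj, neg_eq_iff_eq_neg]; exact key.symm

end CommSign

/-! ### Comparison with the basic spin representation -/

section Compare

variable {n : ℕ} {p : Fin n → Fin n}

theorem commSign_ξ_vol (hp : OddContent p) {k : Fin n} (hk : content p k ≠ 0) (i : Fin n) :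
    CommSign (ξ i) (vol p k) := by
  by_cases h : p i = k
  · exact Or.inl (vol_comm_of_mem (hp k hk) h)
  · exact Or.inr (vol_anti (hp k hk) h)

theorem commSign_vol {k : Fin n} {x : Cl n}
    (h : ∀ i, p i = k → CommSign x (ξ i)) : CommSign x (vol p k) := by
  refine CommSign.smul_right (CommSign.list_prod_right _ fun y hy => ?_) _
  obtain ⟨i, hi, rfl⟩ := List.mem_map.1 hy
  exact h i (mem_block.1 (by simpa using hi))

theorem commSign_vol_vol (hp : OddContent p) {k l : Fin n} (hk : content p k ≠ 0) :
    CommSign (vol p k) (vol p l) :=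
  commSign_vol fun i _ => (commSign_ξ_vol hp hk i).symm

theorem commSign_vol_unitVec (hp : OddContent p) {k c : Fin n} (hk : content p k ≠ 0) :
    CommSign (vol p k) (unitVec p c) := by
  by_cases h : k = c
  · subst h
    exact Or.inl (vol_commute_of_mem (hp k hk)).symm
  · refine (commSign_vol fun i hi => Or.inr (vec_anti ?_)).symm
    have : p i ≠ c := by rw [hi]; exact h
    simp [Pi.single_apply, this]

theorem commSign_assocBelow {x : Cl n} {k : Fin n}
    (h : ∀ c, content p c ≠ 0 → CommSign x (unitVec p c * vol p c)) :
    CommSign x (assocBelow p k) := by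
  refine CommSign.list_prod_right _ fun y hy => ?_
  obtain ⟨c, hc, rfl⟩ := List.mem_map.1 hy
  simp at hc
  exact h c hc.2

theorem commSign_vol_assocBelow (hp : OddContent p) {k l : Fin n} (hk : content p k ≠ 0) :
    CommSign (vol p k) (assocBelow p l) :=
  commSign_assocBelow fun _ _ => (commSign_vol_unitVec hp hk).mul_right (commSign_vol_vol hp hk)

/-- The discrepancy between the action of a generator in block `k` and its action in the basic spin
representation. -/
def twist (p : Fin n → Fin n) (k : Fin n) : Cl n := assocBelow p k * vol p k

theorem commSign_twist (hp : OddContent p) {k l : Fin n} (hk : content p k ≠ 0)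
    (hl : content p l ≠ 0) : CommSign (twist p k) (twist p l) :=
  CommSign.mul_left
    (CommSign.mul_right (CommSign.of_commute (assocBelow_commute hp k l))
      (commSign_vol_assocBelow hp hl).symm)
    (CommSign.mul_right (commSign_vol_assocBelow hp hk) (commSign_vol_vol hp hk))

theorem twist_sq (hp : OddContent p) {k : Fin n} (hk : content p k ≠ 0) :
    IsSign (twist p k * twist p k) :=
  IsSign.mul_mul_self (commSign_vol_assocBelow hp hk).symm (Or.inl (assocBelow_sq hp k))
    (Or.inl (vol_sq p k))

/-- The volume element of an odd block commutes with the generators of that block, so it can be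
moved to the left of ξ_j - ξ_{j+1} and collected with the associators. -/
theorem youngElt_eq_twist (hp : OddContent p) (j : youngIndex p) :
    youngElt p j = twist p (p (fstPos j)) * basicElt ⟨j, j.2.1⟩ := by
  have hk := hp _ (content_ne_zero (p := p) (i := fstPos j) rfl)
  have h2 : (ξ (fstPos j) - ξ (sndPos j)) * vol p (p (fstPos j)) =
      vol p (p (fstPos j)) * (ξ (fstPos j) - ξ (sndPos j)) := by
    rw [sub_mul, mul_sub, vol_comm_of_mem hk rfl, vol_comm_of_mem hk (fst_snd j).symm]
  rw [youngElt_eq, blockDiff, h2, twist, basicElt, mul_smul_comm, mul_assoc]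
  rfl

theorem commSign_basicElt_vol (hp : OddContent p) (j : youngIndex p) {k : Fin n}
    (hk : content p k ≠ 0) : CommSign (basicElt ⟨j, j.2.1⟩) (vol p k) := by
  refine CommSign.symm (CommSign.smul_right ?_ _)
  change CommSign (vol p k) (ξ (fstPos j) - ξ (sndPos j))
  by_cases h : p (fstPos j) = k
  · left
    rw [sub_mul, mul_sub, vol_comm_of_mem (hp k hk) h,
      vol_comm_of_mem (hp k hk) ((fst_snd j).symm.trans h)]
  · right
    rw [sub_mul, mul_sub, vol_anti (hp k hk) h,
      vol_anti (hp k hk) (fun h' => h ((fst_snd j).trans h'))]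
    abel

theorem commSign_basicElt_twist (hp : OddContent p) (j : youngIndex p) {k : Fin n}
    (hk : content p k ≠ 0) : CommSign (basicElt ⟨j, j.2.1⟩) (twist p k) := by
  refine CommSign.mul_right ?_ (commSign_basicElt_vol hp j hk)
  have hj : content p (p (fstPos j)) ≠ 0 := content_ne_zero rfl
  have h1 : CommSign (blockDiff p (fstPos j) (sndPos j)) (assocBelow p k) := by
    have := blockDiff_below hp (fst_snd j) k
    split_ifs at this
    · exact Or.inr this
    · exact Or.inl this
  -- Since the volume element has square 1, the basic element is recovered from `blockDiff`, whose
  -- behaviour towards the associators is known.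
  have h2 : basicElt ⟨j, j.2.1⟩ = (Complex.I / ((Real.sqrt 2 : ℝ) : ℂ)) •
      (blockDiff p (fstPos j) (sndPos j) * vol p (p (fstPos j))) := by
    rw [blockDiff, mul_assoc, vol_sq, mul_one]; rfl
  rw [h2]
  exact ((h1.mul_left (commSign_vol_assocBelow hp hj)).symm.smul_right _).symm

/-- The monoid generated by the discrepancies and `-1`. -/
def twistMonoid (p : Fin n → Fin n) : Submonoid (Cl n) :=
  Submonoid.closure ({x | ∃ k, content p k ≠ 0 ∧ x = twist p k} ∪ {-1})

theorem commSign_twistMonoid {x : Cl n}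
    (h : ∀ k, content p k ≠ 0 → CommSign x (twist p k)) {y : Cl n} (hy : y ∈ twistMonoid p) :
    CommSign x y := by
  induction hy using Submonoid.closure_induction with
  | mem y hy =>
    rcases hy with ⟨k, hk, rfl⟩ | rfl
    · exact h k hk
    · exact CommSign.neg_one_right x
  | one => exact CommSign.one_right x
  | mul y z _ _ hy hz => exact hy.mul_right hz

theorem twistMonoid_commSign (hp : OddContent p) {x y : Cl n} (hx : x ∈ twistMonoid p)
    (hy : y ∈ twistMonoid p) : CommSign x y :=
  commSign_twistMonoid (fun _ hk => (commSign_twistMonoid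
    (fun _ hl => commSign_twist hp hk hl) hx).symm) hy

theorem twistMonoid_sq (hp : OddContent p) {x : Cl n} (hx : x ∈ twistMonoid p) :
    IsSign (x * x) := by
  induction hx using Submonoid.closure_induction with
  | mem y hy =>
    rcases hy with ⟨k, hk, rfl⟩ | rfl
    · exact twist_sq hp hk
    · left; simp
  | one => left; simp
  | mul y z hy' hz' hy hz =>
    exact IsSign.mul_mul_self (twistMonoid_commSign hp hy' hz') hy hz

theorem basicSpin_incl_commSign (hp : OddContent p) (h : YoungCover p) {x : Cl n}
    (hx : x ∈ twistMonoid p) : CommSign (basicSpin n (YoungCover.incl p h) : Cl n) x := by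
  induction h using Cover.induction_on with
  | one => rw [map_one, map_one]; exact (CommSign.one_right x).symm
  | mul_s g j ih =>
    rw [map_mul, map_mul, Units.val_mul, incl_s, basicSpin_s]
    exact ih.mul_left (commSign_twistMonoid (fun k hk => commSign_basicElt_twist hp j hk) hx)
  | mul_z g ih =>
    rw [map_mul, map_mul, Units.val_mul, incl_z, basicSpin_z]
    exact ih.mul_left (CommSign.neg_one_right x).symm

/-- Each generator contributes its twist, which is pulled to the left through the basic spin factors
accumulated so far. This costs at most a sign, which is why -1 is included in the monoid. -/
theorem exists_twist (hp : OddContent p) (h : YoungCover p) : ∃ d ∈ twistMonoid p,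
    (youngSpin p hp h : Cl n) = d * basicSpin n (YoungCover.incl p h) := by
  have hneg : (-1 : Cl n) ∈ twistMonoid p := Submonoid.subset_closure (Or.inr rfl)
  induction h using Cover.induction_on with
  | one => exact ⟨1, one_mem _, by simp⟩
  | mul_s g j ih =>
    obtain ⟨d, hd, e⟩ := ih
    have hmem : twist p (p (fstPos j)) ∈ twistMonoid p :=
      Submonoid.subset_closure (Or.inl ⟨_, content_ne_zero rfl, rfl⟩)
    have e' : (youngSpin p hp (g * Cover.s j) : Cl n) =
        d * (basicSpin n (YoungCover.incl p g) * twist p (p (fstPos j))) *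
          basicElt ⟨j, j.2.1⟩ := by
      rw [map_mul, Units.val_mul, e, youngSpin_s, youngElt_eq_twist hp]
      simp only [mul_assoc]
    rw [e', map_mul, map_mul, Units.val_mul, incl_s, basicSpin_s]
    rcases basicSpin_incl_commSign hp g hmem with h | h
    · exact ⟨d * twist p (p (fstPos j)), mul_mem hd hmem, by rw [h]; simp only [mul_assoc]⟩
    · exact ⟨d * twist p (p (fstPos j)) * -1, mul_mem (mul_mem hd hmem) hneg, by
        rw [h]; simp only [mul_assoc, mul_neg, neg_mul, one_mul]⟩
  | mul_z g ih =>
    obtain ⟨d, hd, e⟩ := ih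
    refine ⟨d, hd, ?_⟩
    rw [map_mul, map_mul, map_mul, Units.val_mul, Units.val_mul, incl_z, basicSpin_z,
      youngSpin_z, e, mul_assoc]

theorem neg_one_ne_one : (-1 : Cl n) ≠ 1 := by
  intro h
  have := congrArg tr0 h
  rw [map_neg, tr0_one] at this
  norm_num at this

/-- Let y = d b be the comparison. As h^m is 1 or z, the powers y^m and b^m are the same sign. Since
d and b commute up to sign, d^m is a sign; as m is odd and d² is a sign, d itself is one. The case d
= -1 would give y^m = -b^m, again because m is odd. -/
theorem youngSpin_eq_basicSpin (hp : OddContent p) {h : YoungCover p} {m : ℕ} (hm : Odd m)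
    (hh : DoubleCover.proj n (YoungCover.incl p h) ^ m = 1) :
    (youngSpin p hp h : Cl n) = basicSpin n (YoungCover.incl p h) := by
  obtain ⟨d, hd, e⟩ := exists_twist hp h
  have hc := (basicSpin_incl_commSign hp h hd).symm
  have hhm : h ^ m = 1 ∨ h ^ m = Cover.z := by
    rw [← map_pow, ← map_pow] at hh
    rcases eq_one_or_z_of_proj hh with h1 | h1
    · left; exact incl_injective p (by rw [h1, map_one])
    · right; exact incl_injective p (by rw [h1, incl_z])
  have heq : ((youngSpin p hp h : Cl n)) ^ m = (basicSpin n (YoungCover.incl p h) : Cl n) ^ m ∧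
      IsSign ((basicSpin n (YoungCover.incl p h) : Cl n) ^ m) := by
    rw [← Units.val_pow_eq_pow_val, ← Units.val_pow_eq_pow_val, ← map_pow, ← map_pow, ← map_pow]
    rcases hhm with h1 | h1 <;> rw [h1]
    · simp [IsSign]
    · rw [youngSpin_z, incl_z, basicSpin_z]; simp [IsSign]
  set b : Cl n := ((basicSpin n (YoungCover.incl p h) : (Cl n)ˣ) : Cl n)
  have hbm : b ^ m ≠ -b ^ m := by
    rcases heq.2 with h1 | h1 <;> rw [h1]
    · exact neg_one_ne_one.symm
    · rw [neg_neg]; exact neg_one_ne_one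
  have hdm : IsSign d := by
    have hbb : b ^ m * b ^ m = 1 := by rcases heq.2 with h1 | h1 <;> rw [h1] <;> simp
    have h1 : IsSign (d ^ m) := by
      have h2 := heq.1
      rw [e] at h2
      rcases hc.mul_pow m with h3 | h3
      · rw [h3] at h2
        left
        have := congrArg (· * b ^ m) h2
        simpa only [mul_assoc, hbb, mul_one] using this
      · rw [h3] at h2
        right
        have := congrArg (· * b ^ m) h2
        simp only [neg_mul, mul_assoc, hbb, mul_one] at this
        rw [← this, neg_neg]
    obtain ⟨k, rfl⟩ := hm
    have h2 : IsSign ((d * d) ^ k) := by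
      rcases twistMonoid_sq hp hd with h | h <;> rw [h]
      · left; simp
      · exact neg_one_pow_eq_or _ k
    rw [pow_succ, pow_mul, pow_two] at h1
    rcases h2 with h2 | h2
    · rwa [h2, one_mul] at h1
    · rw [h2, neg_one_mul] at h1
      rcases h1 with h1 | h1
      · right; rw [← h1, neg_neg]
      · left; exact neg_injective h1
  rcases hdm with rfl | rfl
  · rw [e, one_mul]
  · exfalso
    have h2 := heq.1
    rw [e, neg_one_mul, hm.neg_pow] at h2
    exact hbm h2.symm

end Compare

/-! ### Traces of the class representatives -/

section ClassRep

variable {n : ℕ}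

/-- The generator `s_j`, or `1` if there is no such generator. -/
def gen (n j : ℕ) : DoubleCover n :=
  if h : j + 1 < n then Cover.s (J := {j | j + 1 < n}) ⟨j, h⟩ else 1

theorem cycleWord_cons (r m : ℕ) (l : List ℕ) : (cycleWord r (m :: l) : DoubleCover n) =
    ((List.range' r (m - 1)).map (gen n)).prod * cycleWord (r + m) l := rfl

/-- The factor 1/2 is the product of the scalar (𝐢/√2)² = -1/2 and the -1 of `tr0_diff_diff`. -/
theorem basicSpin_pair (r : ℕ) (hr : r + 2 < n) {y : Cl n} (hy : y ∈ supportedFrom n (r + 2)) :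
    (basicSpin n (gen n r) * (basicSpin n (gen n (r + 1)) * y) : Cl n) ∈ supportedFrom n r ∧
    tr0 (basicSpin n (gen n r) * (basicSpin n (gen n (r + 1)) * y) : Cl n) = 1 / 2 * tr0 y := by
  have h1 : r + 1 < n := by omega
  rw [gen, dif_pos h1, gen, dif_pos (show r + 1 + 1 < n from hr), basicSpin_s, basicSpin_s,
    basicElt, basicElt]
  simp only [smul_mul_assoc, mul_smul_comm, smul_smul, I_div_sq]
  constructor
  · refine Submodule.smul_mem _ _ ?_
    have hd : ∀ (i j : Fin n), r ≤ (i : ℕ) → r ≤ (j : ℕ) → ∀ y ∈ supportedFrom n r,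
        (ξ i - ξ j) * y ∈ supportedFrom n r := fun i j hi hj y hy => by
      rw [sub_mul]
      exact sub_mem (ξ_mul_mem_supportedFrom hi hy) (ξ_mul_mem_supportedFrom hj hy)
    refine hd ⟨r, _⟩ ⟨r + 1, _⟩ le_rfl (Nat.le_succ r) _
      (hd ⟨r + 1, _⟩ ⟨r + 1 + 1, hr⟩ (Nat.le_succ r) (Nat.le_add_right r 2) _ ?_)
    exact supportedFrom_anti (by omega) hy
  · have := tr0_diff_diff (i := ⟨r, by omega⟩) (j := ⟨r + 1, h1⟩) (k := ⟨r + 1 + 1, hr⟩)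
      rfl rfl hy
    rw [map_smul, this, smul_eq_mul]
    ring

theorem basicSpin_range (k r : ℕ) (hr : r + 2 * k < n) {y : Cl n}
    (hy : y ∈ supportedFrom n (r + 2 * k)) :
    ((basicSpin n ((List.range' r (2 * k)).map (gen n)).prod : Cl n) * y) ∈ supportedFrom n r ∧
    tr0 ((basicSpin n ((List.range' r (2 * k)).map (gen n)).prod : Cl n) * y) =
      (1 / 2) ^ k * tr0 y := by
  induction k generalizing r with
  | zero => simpa using hy
  | succ k ih =>
    obtain ⟨h1, h2⟩ := ih (r + 2) (by omega) (by convert! hy using 2; ring)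
    rw [show 2 * (k + 1) = 2 * k + 1 + 1 by ring, List.range'_succ, List.range'_succ,
      List.map_cons, List.map_cons, List.prod_cons, List.prod_cons, map_mul, map_mul,
      Units.val_mul, Units.val_mul, mul_assoc, mul_assoc]
    obtain ⟨h3, h4⟩ := basicSpin_pair r (by omega) h1
    exact ⟨h3, by rw [h4, h2, pow_succ]; ring⟩

/-- A cycle of length 2k + 1 is a product of k consecutive pairs and contributes 2^(-k), that is √2
to the power 1 - (2k + 1). The statement is multiplied out to avoid negative powers; the support
condition lets the cycles be peeled off from the left. -/
theorem basicSpin_cycleWord (l : List ℕ) (hl : ∀ m ∈ l, Odd m) (r : ℕ) (hr : r + l.sum ≤ n) :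
    (basicSpin n (cycleWord r l) : Cl n) ∈ supportedFrom n r ∧
    tr0 (basicSpin n (cycleWord r l) : Cl n) * ((Real.sqrt 2 : ℝ) : ℂ) ^ l.sum =
      ((Real.sqrt 2 : ℝ) : ℂ) ^ l.length := by
  induction l generalizing r with
  | nil => simpa [cycleWord, tr0_one] using one_mem_supportedFrom r
  | cons m l ih =>
    obtain ⟨k, rfl⟩ := hl m (by simp)
    rw [List.sum_cons] at hr
    obtain ⟨h1, h2⟩ := ih (fun m hm => hl m (by simp [hm])) (r + (2 * k + 1)) (by omega)
    have h3 := basicSpin_range k r (by omega) (supportedFrom_anti (by omega) h1)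
    rw [cycleWord_cons, Nat.add_sub_cancel, map_mul, Units.val_mul]
    refine ⟨h3.1, ?_⟩
    have hsq : ((Real.sqrt 2 : ℝ) : ℂ) ^ 2 = 2 := by
      rw [← Complex.ofReal_pow, Real.sq_sqrt (by norm_num)]; norm_num
    rw [h3.2, List.sum_cons, List.length_cons, pow_add, pow_succ, pow_mul, hsq, pow_succ, ← h2]
    have : ((1 : ℂ) / 2) ^ k * 2 ^ k = 1 := by rw [← mul_pow]; norm_num
    linear_combination (tr0 (basicSpin n (cycleWord (r + (2 * k + 1)) l) : Cl n) *
      ((Real.sqrt 2 : ℝ) : ℂ) ^ l.sum * ((Real.sqrt 2 : ℝ) : ℂ)) * this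

theorem tr0_basicSpin_posRep {l : n.Partition} (hl : ∀ m ∈ l.parts, Odd m) :
    tr0 (basicSpin n (posRep l) : Cl n) * ((Real.sqrt 2 : ℝ) : ℂ) ^ n =
      ((Real.sqrt 2 : ℝ) : ℂ) ^ l.parts.card := by
  have hs : (l.parts.sort (· ≥ ·)).sum = n := by
    rw [← Multiset.sum_coe, Multiset.sort_eq, l.parts_sum]
  have := (basicSpin_cycleWord (n := n) (l.parts.sort (· ≥ ·)) (by simpa using hl) 0
    (by omega)).2
  rwa [hs, Multiset.length_sort] at this

theorem toPerm_gen {j : ℕ} (h : j + 1 < n) :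
    Cover.toPerm _ (gen n j) = Equiv.swap j (j + 1) := by
  rw [gen, dif_pos h, Cover.toPerm_s]

theorem toPerm_range (m r : ℕ) (hr : r + m < n) :
    Cover.toPerm _ ((List.range' r m).map (gen n)).prod = (List.range' r (m + 1)).formPerm := by
  induction m generalizing r with
  | zero => simp
  | succ m ih =>
    rw [List.range'_succ, List.map_cons, List.prod_cons, map_mul, ih (r + 1) (by omega),
      toPerm_gen (by omega), List.range'_succ (n := m + 1), List.range'_succ,
      List.formPerm_cons_cons]

theorem toPerm_cycleWord_of_lt (l : List ℕ) (hl : ∀ m ∈ l, 0 < m) (r : ℕ) (hr : r + l.sum ≤ n)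
    {i : ℕ} (hi : i < r) : Cover.toPerm _ (cycleWord r l : DoubleCover n) i = i := by
  induction l generalizing r with
  | nil => simp [cycleWord]
  | cons m l ih =>
    have hm := hl m (by simp)
    rw [List.sum_cons] at hr
    rw [cycleWord_cons, map_mul, Equiv.Perm.mul_apply,
      ih (fun m hm => hl m (by simp [hm])) _ (by omega) (by omega),
      toPerm_range _ _ (by omega), List.formPerm_apply_of_notMem]
    simp; omega

/-- The word is a product of disjoint cycles. The product of their lengths is not the exact order in
general, but it is odd when all lengths are, which is all that is needed. -/
theorem toPerm_cycleWord_pow (l : List ℕ) (hl : ∀ m ∈ l, 0 < m) (r : ℕ) (hr : r + l.sum ≤ n) :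
    Cover.toPerm _ (cycleWord r l : DoubleCover n) ^ l.prod = 1 := by
  induction l generalizing r with
  | nil => simp [cycleWord]
  | cons m l ih =>
    have hm := hl m (by simp)
    rw [List.sum_cons] at hr
    have ih := ih (fun m hm => hl m (by simp [hm])) (r + m) (by omega)
    have h1 := toPerm_range (n := n) (m - 1) r (by omega)
    rw [Nat.sub_add_cancel hm] at h1
    have hd : Commute (List.range' r m).formPerm
        (Cover.toPerm _ (cycleWord (r + m) l : DoubleCover n)) := by
      refine Equiv.Perm.Disjoint.commute fun i => ?_
      by_cases hi : i < r + m
      · exact Or.inr (toPerm_cycleWord_of_lt l (fun m hm => hl m (by simp [hm])) _ (by omega) hi)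
      · exact Or.inl (List.formPerm_apply_of_notMem (by simp; omega))
    have h2 := List.formPerm_pow_length_eq_one_of_nodup _ (List.nodup_range' (s := r) (n := m))
    rw [List.length_range'] at h2
    rw [cycleWord_cons, map_mul, h1, List.prod_cons, hd.mul_pow, pow_mul, h2, one_pow, one_mul,
      mul_comm m, pow_mul, ih, one_pow]

theorem proj_eq_one_of_toPerm {g : DoubleCover n} (h : Cover.toPerm _ g = 1) :
    DoubleCover.proj n g = 1 := by
  ext i
  rw [val_proj, h]; rfl

theorem proj_posRep_pow (l : n.Partition) :
    DoubleCover.proj n (posRep l) ^ (l.parts.sort (· ≥ ·)).prod = 1 := by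
  have hs : (l.parts.sort (· ≥ ·)).sum = n := by
    rw [← Multiset.sum_coe, Multiset.sort_eq, l.parts_sum]
  rw [← map_pow]
  apply proj_eq_one_of_toPerm
  rw [map_pow]
  exact toPerm_cycleWord_pow _ (fun m hm => l.parts_pos (by simpa using hm)) 0 (by omega)

theorem odd_list_prod (l : List ℕ) (hl : ∀ m ∈ l, Odd m) : Odd l.prod := by
  induction l with
  | nil => simp
  | cons m l ih =>
    rw [List.prod_cons]
    exact (hl m (by simp)).mul (ih fun m hm => hl m (by simp [hm]))

/-- The element has odd order modulo z, so its action may be replaced by basic spin. That is defined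
on the whole double cover, where the conjugation is undone by the trace property. -/
theorem tr0_youngSpin_conj {p : Fin n → Fin n} (hp : OddContent p) {l : n.Partition}
    (hl : ∀ m ∈ l.parts, Odd m) {g : DoubleCover n} {h : YoungCover p}
    (hh : YoungCover.incl p h = g⁻¹ * posRep l * g) :
    tr0 (youngSpin p hp h : Cl n) = tr0 (basicSpin n (posRep l) : Cl n) := by
  have hodd := odd_list_prod (l.parts.sort (· ≥ ·)) (by simpa using hl)
  rw [youngSpin_eq_basicSpin hp hodd, hh, map_mul, map_mul, Units.val_mul, Units.val_mul,
    tr0_mul_comm, ← mul_assoc, ← Units.val_mul, ← map_mul, mul_inv_cancel, map_one,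
    Units.val_one, one_mul]
  rw [hh, map_mul, map_mul, map_inv]
  have := conj_pow (i := (l.parts.sort (· ≥ ·)).prod) (a := (DoubleCover.proj n g)⁻¹)
    (b := DoubleCover.proj n (posRep l))
  rw [inv_inv] at this
  rw [this, proj_posRep_pow]
  simp

variable (π : (Fin n → Fin n) → DoubleCover n)
  (hπ : ∀ p : Fin n → Fin n, Monotone (p ∘ DoubleCover.proj n (π p)))

/-- Each triple whose p is fixed contributes the same trace to the diagonal, and all others
contribute zero. -/
theorem character_posRep {l : n.Partition} (hl : ∀ m ∈ l.parts, Odd m) :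
    (transport (tensorBasis π hπ).repr.symm (inducedSumRep n)).character (posRep l) =
      (Nat.card {t : OShPf n // t.p ∘ DoubleCover.proj n (posRep l) = t.p}) *
        tr0 (basicSpin n (posRep l) : Cl n) := by
  classical
  rw [character_transport, Nat.card_eq_fintype_card, Fintype.card_subtype, ← nsmul_eq_mul,
    ← Finset.sum_const, Finset.sum_filter]
  refine Finset.sum_congr rfl fun t _ => ?_
  split_ifs with ht
  · obtain ⟨h, hh⟩ := (incl_exists_iff π hπ t (posRep l)).2 ht
    rw [dualVector_action π hπ t _ hh, tr0_youngSpin_conj _ hl hh]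
  · exact dualVector_action_of_ne π hπ t _ ht

end ClassRep

/-! ### Complete homogeneous functions in terms of power sums -/

section Homogeneous

variable {R : Type*} [CommRing R] [Algebra ℂ R]

/-- The order of the centralizer of a permutation with the given cycle lengths. -/
def zeeMultiset (s : Multiset ℕ) : ℕ := ∏ i ∈ s.toFinset, i ^ s.count i * (s.count i).factorial

theorem zeeMultiset_cons (i : ℕ) (s : Multiset ℕ) :
    zeeMultiset (i ::ₘ s) = i * (i ::ₘ s).count i * zeeMultiset s := by
  have h : zeeMultiset s =
      ∏ j ∈ (i ::ₘ s).toFinset, j ^ s.count j * (s.count j).factorial := by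
    refine Finset.prod_subset (by intro j; simp; tauto) fun j _ hj => ?_
    have : s.count j = 0 := Multiset.count_eq_zero.2 (by simpa using hj)
    simp [this]
  have hi : i ∈ (i ::ₘ s).toFinset := by simp
  rw [h, zeeMultiset, ← Finset.mul_prod_erase _ _ hi, ← Finset.mul_prod_erase _ _ hi, ← mul_assoc]
  congr 1
  · rw [Multiset.count_cons_self, pow_succ, Nat.factorial_succ]; ring
  · refine Finset.prod_congr rfl fun j hj => ?_
    rw [Multiset.count_cons_of_ne (Finset.ne_of_mem_erase hj)]

/-- The complete homogeneous function of degree `n`, the power sums being `a 1, a 2, …`. -/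
def hgen (a : ℕ → R) (n : ℕ) : R :=
  ∑ l : n.Partition, (zee l : ℂ)⁻¹ • (l.parts.map a).prod

theorem hgen_zero (a : ℕ → R) : hgen a 0 = 1 := by
  simp [hgen, zee]

/-- Newton's identity. Write n + 1 as the sum of i m_i over the distinct parts i of λ and remove one
part i: the bijection is with the partitions of the remainder, and i m_i / z_λ is the inverse of z
for the smaller partition. -/
theorem hgen_succ (a : ℕ → R) (n : ℕ) :
    ((n + 1 : ℕ) : ℂ) • hgen a (n + 1) =
      ∑ i ∈ Finset.range (n + 1), a (i + 1) * hgen a (n - i) := by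
  have h1 : ∀ l : (n + 1).Partition,
      ((n + 1 : ℕ) : ℂ) • ((zee l : ℂ)⁻¹ • (l.parts.map a).prod) =
      ∑ i ∈ Finset.range (n + 1), if i + 1 ∈ l.parts then
        (((i + 1 : ℕ) * l.parts.count (i + 1) : ℂ) * (zee l : ℂ)⁻¹) • (l.parts.map a).prod
        else 0 := by
    intro l
    have e : ((n + 1 : ℕ) : ℂ) = ∑ i ∈ Finset.range (n + 1), if i + 1 ∈ l.parts then
        ((i + 1 : ℕ) * l.parts.count (i + 1) : ℂ) else 0 := by
      conv_lhs => rw [← l.parts_sum]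
      rw [Finset.sum_multiset_count, ← Finset.sum_filter]
      push_cast
      symm
      refine Finset.sum_bij' (fun i _ => i + 1) (fun i _ => i - 1) ?_ ?_ ?_ ?_ ?_
      · intro i hi; simpa using (Finset.mem_filter.1 hi).2
      · intro i hi
        have hi : i ∈ l.parts := by simpa using hi
        have h1 := l.parts_pos hi
        have h2 := Nat.Partition.le_of_mem_parts hi
        rw [Finset.mem_filter, Finset.mem_range, Nat.sub_add_cancel h1]
        exact ⟨by omega, hi⟩
      · intro i _; simp
      · intro i hi
        have hi : i ∈ l.parts := by simpa using hi
        exact Nat.sub_add_cancel (l.parts_pos hi)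
      · intro i _; simp [mul_comm]
    rw [e, Finset.sum_smul]
    refine Finset.sum_congr rfl fun i _ => ?_
    split_ifs
    · rw [smul_smul]
    · rw [zero_smul]
  rw [hgen, Finset.smul_sum, Finset.sum_congr rfl fun l _ => h1 l, Finset.sum_comm]
  refine Finset.sum_congr rfl fun i hi => ?_
  rw [Finset.mem_range] at hi
  rw [← Finset.sum_filter, hgen, Finset.mul_sum]
  refine Finset.sum_bij'
    (fun (l : (n + 1).Partition) hl => (⟨l.parts.erase (i + 1),
      fun h => l.parts_pos (Multiset.mem_of_mem_erase h), by
        have h := Multiset.sum_erase (Finset.mem_filter.1 hl).2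
        rw [l.parts_sum] at h
        omega⟩ : (n - i).Partition))
    (fun (m : (n - i).Partition) _ => (⟨(i + 1) ::ₘ m.parts, fun h => by
        rcases Multiset.mem_cons.1 h with rfl | h
        · omega
        · exact m.parts_pos h, by
        rw [Multiset.sum_cons, m.parts_sum]; omega⟩ : (n + 1).Partition)) ?_ ?_ ?_ ?_ ?_
  · intro l _; simp
  · intro m _; simp
  · intro l hl
    ext1
    exact Multiset.cons_erase (Finset.mem_filter.1 hl).2
  · intro m _
    ext1
    exact Multiset.erase_cons_head _ _
  · intro l hl
    have hl := (Finset.mem_filter.1 hl).2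
    have hz : zee l = (i + 1) * l.parts.count (i + 1) * zeeMultiset (l.parts.erase (i + 1)) := by
      have := zeeMultiset_cons (i + 1) (l.parts.erase (i + 1))
      rw [Multiset.cons_erase hl] at this
      exact this
    have hp : (l.parts.map a).prod = a (i + 1) * ((l.parts.erase (i + 1)).map a).prod := by
      conv_lhs => rw [← Multiset.cons_erase hl]
      rw [Multiset.map_cons, Multiset.prod_cons]
    have hc : (l.parts.count (i + 1) : ℂ) ≠ 0 := by
      simpa using hl
    have hi : ((i : ℂ) + 1) ≠ 0 := by exact_mod_cast Nat.succ_ne_zero i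
    rw [hz, hp, mul_smul_comm]
    congr 1
    rw [show zee (⟨l.parts.erase (i + 1), _, _⟩ : (n - i).Partition) =
      zeeMultiset (l.parts.erase (i + 1)) from rfl]
    push_cast
    rw [mul_inv, ← mul_assoc, mul_inv_cancel₀ (mul_ne_zero hi hc), one_mul]

open PowerSeries

/-- The generating function of the complete homogeneous functions. -/
def hser (a : ℕ → R) : R⟦X⟧ := PowerSeries.mk (hgen a)

theorem constantCoeff_hser (a : ℕ → R) : constantCoeff (hser a) = 1 := by
  rw [← coeff_zero_eq_constantCoeff_apply, hser, coeff_mk, hgen_zero]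

/-- Newton's identities as the differential equation H' = P H; multiplicativity of H in the power
sums follows from it without exponentials. -/
theorem derivative_hser (a : ℕ → R) :
    d⁄dX R (hser a) = PowerSeries.mk (fun i => a (i + 1)) * hser a := by
  ext n
  rw [coeff_derivative, coeff_mul, Finset.Nat.sum_antidiagonal_eq_sum_range_succ_mk]
  simp only [hser, coeff_mk]
  rw [← hgen_succ, Algebra.smul_def, mul_comm]
  simp

/-- The equation determines (n + 1) times the next coefficient from the earlier ones, and n + 1 is
invertible over ℂ. -/
theorem eq_of_derivative {A F G : R⟦X⟧} (hF : d⁄dX R F = A * F) (hG : d⁄dX R G = A * G)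
    (h0 : constantCoeff F = constantCoeff G) : F = G := by
  ext n
  induction n using Nat.strong_induction_on with
  | _ n ih =>
    cases n with
    | zero => simpa using h0
    | succ n =>
      have e : ∀ H : R⟦X⟧, d⁄dX R H = A * H → ((n + 1 : ℕ) : ℂ) • coeff (n + 1) H =
          ∑ i ∈ Finset.HasAntidiagonal.antidiagonal n, coeff i.1 A * coeff i.2 H := by
        intro H hH
        rw [← coeff_mul, ← hH, coeff_derivative, Algebra.smul_def, mul_comm]
        simp
      have h1 : ((n + 1 : ℕ) : ℂ) • coeff (n + 1) F = ((n + 1 : ℕ) : ℂ) • coeff (n + 1) G := by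
        rw [e F hF, e G hG]
        refine Finset.sum_congr rfl fun i hi => ?_
        rw [ih i.2 (by have := Finset.HasAntidiagonal.mem_antidiagonal.1 hi; omega)]
      have hn : ((n + 1 : ℕ) : ℂ) ≠ 0 := by exact_mod_cast Nat.succ_ne_zero n
      have := congrArg (fun x => ((n + 1 : ℕ) : ℂ)⁻¹ • x) h1
      simpa only [smul_smul, inv_mul_cancel₀ hn, one_smul] using this

theorem hser_add (a b : ℕ → R) : hser (a + b) = hser a * hser b := by
  refine eq_of_derivative (derivative_hser _) ?_ (by simp [constantCoeff_hser])
  rw [Derivation.leibniz, derivative_hser, derivative_hser, smul_eq_mul, smul_eq_mul]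
  have : (PowerSeries.mk fun i => (a + b) (i + 1)) =
      PowerSeries.mk (fun i => a (i + 1)) + PowerSeries.mk fun i => b (i + 1) := by
    ext i; simp
  rw [this]
  ring

theorem hser_zero : hser (0 : ℕ → R) = 1 := by
  refine eq_of_derivative (derivative_hser _) ?_ (by simp [constantCoeff_hser])
  have : (PowerSeries.mk fun i => (0 : ℕ → R) (i + 1)) = 0 := by ext i; simp
  rw [this]
  simp

theorem hser_sum {ι : Type*} (s : Finset ι) (a : ι → ℕ → R) :
    hser (∑ j ∈ s, a j) = ∏ j ∈ s, hser (a j) := by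
  classical
  induction s using Finset.induction_on with
  | empty => simp [hser_zero]
  | insert j s hj ih => rw [Finset.sum_insert hj, Finset.prod_insert hj, hser_add, ih]

theorem hgen_pow_mul (a : ℕ → R) (y : R) (n : ℕ) :
    hgen (fun k => y ^ k * a k) n = y ^ n * hgen a n := by
  rw [hgen, hgen, Finset.mul_sum]
  refine Finset.sum_congr rfl fun l _ => ?_
  rw [Multiset.prod_map_mul, mul_smul_comm]
  congr 2
  conv_rhs => rw [← l.parts_sum]
  induction l.parts using Multiset.induction_on with
  | empty => simp
  | cons i s ih => simp [pow_add, ih]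

/-- By homogeneity, t ↦ -t replaces the power sums a_k by (-1)^k a_k, which is -a_k when only odd
ones are nonzero; the two series are then inverse to each other. -/
theorem hser_mul_evalNeg {a : ℕ → R} (ha : ∀ k, ¬ Odd k → a k = 0) :
    hser a * PowerSeries.mk (fun k => (-1) ^ k * hgen a k) = 1 := by
  have : PowerSeries.mk (fun k => (-1) ^ k * hgen a k) = hser fun k => (-1) ^ k * a k := by
    ext k; simp [hser, hgen_pow_mul]
  rw [this, ← hser_add, ← hser_zero]
  congr 1
  funext k
  by_cases hk : Odd k
  · simp [hk.neg_one_pow]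
  · simp [ha k hk]

theorem map_hgen {S : Type*} [CommRing S] [Algebra ℂ S] (f : R →ₐ[ℂ] S) (a : ℕ → R) (n : ℕ) :
    f (hgen a n) = hgen (fun k => f (a k)) n := by
  rw [hgen, hgen, map_sum]
  refine Finset.sum_congr rfl fun l _ => ?_
  rw [map_smul, map_multiset_prod, Multiset.map_map]
  rfl

/-- The series for a_k ∑ y_j^k is the product over j of the series for y_j^k a_k; this is its
coefficient of degree n. -/
theorem hgen_sum_pow {ι : Type*} [Fintype ι] [DecidableEq ι] (a : ℕ → R) (y : ι → R) (n : ℕ) :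
    hgen (fun k => a k * ∑ j, y j ^ k) n =
      ∑ α ∈ Finset.piAntidiag Finset.univ n, ∏ j, (y j ^ α j * hgen a (α j)) := by
  have h : (fun k => a k * ∑ j, y j ^ k) = ∑ j, fun k => y j ^ k * a k := by
    funext k
    rw [Finset.sum_apply, Finset.mul_sum]
    exact Finset.sum_congr rfl fun j _ => mul_comm _ _
  have h2 := congrArg (coeff n) (hser_sum Finset.univ fun j k => y j ^ k * a k)
  rw [← h, hser, coeff_mk, coeff_prod, Finset.finsuppAntidiag] at h2
  rw [h2, Finset.sum_map]
  symm
  refine Finset.sum_bij (fun α hα => ⟨α, hα⟩) (by simp) (by simp) (by simp) ?_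
  intro α _
  simp [hser, hgen_pow_mul]

end Homogeneous

/-! ### Functions fixed by a class representative -/

section Fixed

variable {n : ℕ}

/-- The positions `j` and `j + 1` belong to the same of the consecutive intervals of lengths `l`
starting at `r`. -/
def IsInterior (r : ℕ) (l : List ℕ) (j : ℕ) : Prop :=
  ∃ i, i < l.length ∧ r + (l.take i).sum ≤ j ∧ j + 1 < r + (l.take (i + 1)).sum

theorem isInterior_cons {r m : ℕ} {l : List ℕ} {j : ℕ} : IsInterior r (m :: l) j ↔
    (r ≤ j ∧ j + 1 < r + m) ∨ IsInterior (r + m) l j := by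
  constructor
  · rintro ⟨i, hi, h1, h2⟩
    cases i with
    | zero => left; simpa using And.intro h1 h2
    | succ i =>
      right
      simp only [List.length_cons, List.take_succ_cons, List.sum_cons] at hi h1 h2
      exact ⟨i, by omega, by omega, by omega⟩
  · rintro (⟨h1, h2⟩ | ⟨i, hi, h1, h2⟩)
    · exact ⟨0, by simp, by simpa using h1, by simpa using h2⟩
    · refine ⟨i + 1, by simpa using hi, ?_, ?_⟩
      · simp only [List.take_succ_cons, List.sum_cons]; omega
      · simp only [List.take_succ_cons, List.sum_cons]; omega

theorem isInterior_le {r : ℕ} {l : List ℕ} {j : ℕ} (h : IsInterior r l j) : r ≤ j := by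
  obtain ⟨i, _, h1, _⟩ := h; omega

theorem toPerm_cycleWord_of_isInterior (l : List ℕ) (hl : ∀ m ∈ l, 0 < m) (r : ℕ)
    (hr : r + l.sum ≤ n) {j : ℕ} (hj : IsInterior r l j) :
    Cover.toPerm _ (cycleWord r l : DoubleCover n) j = j + 1 := by
  induction l generalizing r with
  | nil => obtain ⟨i, hi, _⟩ := hj; simp at hi
  | cons m l ih =>
    have hm := hl m (by simp)
    rw [List.sum_cons] at hr
    have h1 := toPerm_range (n := n) (m - 1) r (by omega)
    rw [Nat.sub_add_cancel hm] at h1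
    rw [cycleWord_cons, map_mul, Equiv.Perm.mul_apply, h1]
    rcases isInterior_cons.1 hj with ⟨h2, h3⟩ | h
    · rw [toPerm_cycleWord_of_lt l (fun m hm => hl m (by simp [hm])) _ (by omega) (by omega)]
      have := List.formPerm_apply_lt_getElem (List.range' r m) List.nodup_range' (j - r)
        (by simp; omega)
      simp only [List.getElem_range', one_mul] at this
      rw [show r + (j - r) = j by omega] at this
      rw [this]; omega
    · rw [ih (fun m hm => hl m (by simp [hm])) _ (by omega) h, List.formPerm_apply_of_notMem]
      have := isInterior_le h
      simp; omega

theorem comp_proj_gen {X : Type*} {p : Fin n → X} {j : ℕ}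
    (h : ∀ hj : j + 1 < n, p ⟨j, by omega⟩ = p ⟨j + 1, hj⟩) :
    p ∘ DoubleCover.proj n (gen n j) = p := by
  by_cases hj : j + 1 < n
  · rw [gen, dif_pos hj, proj_s]
    funext i
    simp only [Function.comp, Equiv.swap_apply_def]
    split_ifs with h1 h2
    · rw [h1]; exact (h hj).symm
    · rw [h2]; exact h hj
    · rfl
  · rw [gen, dif_neg hj]; simp

theorem comp_proj_cycleWord {X : Type*} {p : Fin n → X} (l : List ℕ) (r : ℕ)
    (h : ∀ j (hj : j + 1 < n), IsInterior r l j → p ⟨j, by omega⟩ = p ⟨j + 1, hj⟩) :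
    p ∘ DoubleCover.proj n (cycleWord r l) = p := by
  induction l generalizing r with
  | nil => simp [cycleWord]
  | cons m l ih =>
    have h1 : ∀ l' : List ℕ, (∀ j ∈ l', r ≤ j ∧ j + 1 < r + m) →
        p ∘ DoubleCover.proj n ((l'.map (gen n)).prod) = p := by
      intro l' hl'
      induction l' with
      | nil => simp
      | cons j l' ih' =>
        rw [List.map_cons, List.prod_cons, map_mul, Equiv.Perm.coe_mul, ← Function.comp_assoc,
          comp_proj_gen, ih' fun i hi => hl' i (by simp [hi])]
        exact fun hj => h j hj (isInterior_cons.2 (Or.inl (hl' j (by simp))))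
    rw [cycleWord_cons, map_mul, Equiv.Perm.coe_mul, ← Function.comp_assoc, h1, ih]
    · exact fun j hj hi => h j hj (isInterior_cons.2 (Or.inr hi))
    · intro j hj
      rw [List.mem_range'_1] at hj
      omega

/-- The composition whose blocks are the parts of a partition in weakly decreasing order. -/
def sortedComposition (l : n.Partition) : Composition n where
  blocks := l.parts.sort (· ≥ ·)
  blocks_pos := fun h => l.parts_pos (by simpa using h)
  blocks_sum := by rw [← Multiset.sum_coe, Multiset.sort_eq, l.parts_sum]

theorem isInterior_iff_index (c : Composition n) {j : ℕ} (hj : j + 1 < n) :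
    IsInterior 0 c.blocks j ↔ c.index ⟨j, by omega⟩ = c.index ⟨j + 1, hj⟩ := by
  constructor
  · rintro ⟨i, hi, h1, h2⟩
    rw [zero_add] at h1 h2
    change c.sizeUpTo i ≤ j at h1
    change j + 1 < c.sizeUpTo (i + 1) at h2
    have key : ∀ (x : Fin n), c.sizeUpTo i ≤ x → (x : ℕ) < c.sizeUpTo (i + 1) →
        c.index x = ⟨i, hi⟩ := by
      intro x hx hx'
      symm
      rw [← c.mem_range_embedding_iff', c.mem_range_embedding_iff]
      exact ⟨hx, hx'⟩
    rw [key _ (by simpa using h1) (by simp; omega), key _ (by simp; omega) (by simpa using h2)]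
  · intro h
    refine ⟨c.index ⟨j, by omega⟩, (c.index ⟨j, by omega⟩).2, ?_, ?_⟩
    · rw [zero_add]; exact c.sizeUpTo_index_le ⟨j, by omega⟩
    · rw [zero_add, h]; exact c.lt_sizeUpTo_index_succ ⟨j + 1, hj⟩

theorem monotone_index (c : Composition n) {x y : Fin n} (h : x ≤ y) : c.index x ≤ c.index y := by
  by_contra h'
  rw [not_le, Fin.lt_def] at h'
  have h1 := c.monotone_sizeUpTo (show (c.index y : ℕ) + 1 ≤ c.index x from h')
  have h2 := c.sizeUpTo_index_le x
  have h3 := c.lt_sizeUpTo_index_succ y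
  rw [Fin.val_succ] at h3
  rw [Fin.le_def] at h
  omega

/-- The permutation sends every position that is not last in its interval to the next one, so
invariance propagates equality along the interval. Conversely, a function constant on the intervals
is invariant under each generator in the word. -/
theorem comp_posRep_iff {X : Type*} (l : n.Partition) (p : Fin n → X) :
    p ∘ DoubleCover.proj n (posRep l) = p ↔
      ∃ g : Fin (sortedComposition l).length → X, p = g ∘ (sortedComposition l).index := by
  set c := sortedComposition l
  have hs : 0 + c.blocks.sum ≤ n := by rw [c.blocks_sum, zero_add]
  constructor
  · intro hp
    have hstep : ∀ j (hj : j + 1 < n), IsInterior 0 c.blocks j →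
        p ⟨j, by omega⟩ = p ⟨j + 1, hj⟩ := by
      intro j hj hi
      have h1 := toPerm_cycleWord_of_isInterior (n := n) c.blocks (fun m hm => c.blocks_pos hm) 0
        hs hi
      have h2 := val_proj (n := n) (posRep l) ⟨j, by omega⟩
      rw [show posRep l = cycleWord 0 c.blocks from rfl] at h2 hp
      simp only [h1] at h2
      have h3 := congrFun hp ⟨j, by omega⟩
      rw [← h3]
      exact congrArg p (Fin.ext h2)
    have hup : ∀ d (x y : Fin n), (y : ℕ) = x + d → c.index x = c.index y → p x = p y := by
      intro d
      induction d with
      | zero => intro x y h _; exact congrArg p (Fin.ext (by omega))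
      | succ d ih =>
        intro x y h hxy
        let y' : Fin n := ⟨x + d, by omega⟩
        have h1 : c.index x = c.index y' := le_antisymm
          (monotone_index c (by simp [y', Fin.le_def]))
          (hxy ▸ monotone_index c (by simp [y', Fin.le_def]; omega))
        rw [ih x y' rfl h1]
        have hj : (x : ℕ) + d + 1 < n := by omega
        obtain rfl : y = ⟨x + d + 1, hj⟩ := Fin.ext (by simp; omega)
        refine hstep _ hj ((isInterior_iff_index c hj).2 ?_)
        rw [← hxy]; exact h1.symm
    refine ⟨fun i => p (c.embedding i ⟨0, c.one_le_blocksFun i⟩), funext fun x => ?_⟩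
    rw [Function.comp]
    have hx : c.index x = c.index (c.embedding (c.index x) ⟨0, c.one_le_blocksFun _⟩) := by
      rw [c.index_embedding]
    rcases le_total x (c.embedding (c.index x) ⟨0, c.one_le_blocksFun _⟩) with h | h
    · exact hup _ _ _ (Nat.add_sub_of_le h).symm hx
    · exact (hup _ _ _ (Nat.add_sub_of_le h).symm hx.symm).symm
  · rintro ⟨g, rfl⟩
    refine comp_proj_cycleWord _ 0 fun j hj hi => ?_
    rw [Function.comp, Function.comp, (isInterior_iff_index c hj).1 hi]

-- Expanding the product chooses one index for each part, which is the same as a function constant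
-- on the intervals.
open Classical in
theorem prod_sum_pow_parts {S ι : Type*} [CommSemiring S] [Fintype ι] (l : n.Partition)
    (y : ι → S) : (l.parts.map fun m => ∑ j, y j ^ m).prod =
      ∑ p : Fin n → ι with p ∘ DoubleCover.proj n (posRep l) = p, ∏ i, y (p i) := by
  set c := sortedComposition l with hc
  have h1 : (l.parts.map fun m => ∑ j, y j ^ m).prod =
      ∏ i : Fin c.length, ∑ j, y j ^ c.blocksFun i := by
    have : (l.parts : Multiset ℕ) = (c.blocks : Multiset ℕ) := by
      simp [hc, sortedComposition]
    rw [this, Multiset.map_coe, Multiset.prod_coe, ← c.ofFn_blocksFun, List.map_ofFn,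
      List.prod_ofFn]
    rfl
  rw [h1, Finset.prod_univ_sum, Fintype.piFinset_univ]
  refine Finset.sum_bij (fun g _ => g ∘ c.index) ?_ ?_ ?_ ?_
  · intro g _
    rw [Finset.mem_filter, comp_posRep_iff]
    exact ⟨Finset.mem_univ _, g, rfl⟩
  · intro g _ g' _ h
    funext i
    have := congrFun h (c.embedding i ⟨0, c.one_le_blocksFun i⟩)
    simpa [c.index_embedding] using this
  · intro p hp
    rw [Finset.mem_filter, comp_posRep_iff] at hp
    obtain ⟨_, g, rfl⟩ := hp
    exact ⟨g, Finset.mem_univ _, rfl⟩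
  · intro g _
    rw [← c.blocksFinEquiv.prod_comp, Fintype.prod_sigma]
    refine Finset.prod_congr rfl fun i _ => ?_
    have : ∀ x : Fin (c.blocksFun i), y ((g ∘ c.index) (c.blocksFinEquiv ⟨i, x⟩)) = y (g i) := by
      intro x
      change y (g (c.index (c.embedding i x))) = _
      rw [c.index_embedding]
    rw [Finset.prod_congr rfl fun x _ => this x]
    simp

/-- A monomial with the given exponents. -/
theorem prod_X_eq_monomial {R : Type*} [CommRing R] (α : Fin n → ℕ) :
    ∏ j, (MvPolynomial.X j ^ α j : MvPolynomial (Fin n) R) =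
      MvPolynomial.monomial (Finsupp.equivFunOnFinite.symm α) 1 := by
  rw [MvPolynomial.monomial_eq, Finsupp.prod_fintype _ _ (by simp)]
  simp

theorem prod_comp_content {S : Type*} [CommMonoid S] (p : Fin n → Fin n) (y : Fin n → S) :
    ∏ i, y (p i) = ∏ k, y k ^ content p k := by
  rw [← Finset.prod_fiberwise_of_maps_to (g := p) (t := Finset.univ) (by simp)]
  refine Finset.prod_congr rfl fun k _ => ?_
  rw [Finset.prod_congr rfl fun i hi => by rw [(Finset.mem_filter.1 hi).2], Finset.prod_const]
  rfl

theorem sum_content (p : Fin n → Fin n) : ∑ k, content p k = n := by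
  have := (Finset.card_eq_sum_card_fiberwise (f := p) (s := Finset.univ) (t := Finset.univ)
    (by simp)).symm
  simpa [content, block] using this

/-- The product of complete homogeneous functions counts fixed functions of given content. -/
theorem prod_hgen {R : Type*} [CommRing R] [Algebra ℂ R] (a : ℕ → R) (α : Fin n → ℕ)
    (hα : ∑ k, α k = n) : ∏ k, hgen a (α k) = ∑ l : n.Partition, (zee l : ℂ)⁻¹ •
      ((l.parts.map a).prod * (Nat.card {p : Fin n → Fin n //
        p ∘ DoubleCover.proj n (posRep l) = p ∧ content p = α} : R)) := by
  classical
  let ι : R →ₐ[ℂ] MvPolynomial (Fin n) R := IsScalarTower.toAlgHom ℂ R (MvPolynomial (Fin n) R)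
  have hι : ∀ r, ι r = MvPolynomial.C r := fun r => rfl
  -- The complete homogeneous function with power sums a_k ∑ x_j^k is expanded in two ways: as a sum
  -- of monomials in x with complete homogeneous coefficients, and by partitions. The coefficients
  -- of x^α are compared.
  have key := hgen_sum_pow (fun k => ι (a k)) (fun j => (MvPolynomial.X j : MvPolynomial (Fin n) R))
    n
  have h1 : ∀ β : Fin n → ℕ, ∏ j, ((MvPolynomial.X j : MvPolynomial (Fin n) R) ^ β j *
      hgen (fun k => ι (a k)) (β j)) =
      MvPolynomial.monomial (Finsupp.equivFunOnFinite.symm β) (∏ j, hgen a (β j)) := by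
    intro β
    simp_rw [← map_hgen ι]
    rw [Finset.prod_mul_distrib, prod_X_eq_monomial, ← map_prod, hι, mul_comm,
      MvPolynomial.C_mul_monomial, mul_one]
  rw [Finset.sum_congr rfl fun β _ => h1 β, hgen] at key
  have key2 := congrArg (MvPolynomial.coeff (Finsupp.equivFunOnFinite.symm α)) key
  rw [MvPolynomial.coeff_sum, MvPolynomial.coeff_sum, Finset.sum_eq_single α] at key2
  · rw [MvPolynomial.coeff_monomial, if_pos rfl] at key2
    rw [← key2]
    refine Finset.sum_congr rfl fun l _ => ?_
    rw [Multiset.prod_map_mul, prod_sum_pow_parts, MvPolynomial.coeff_smul]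
    congr 1
    have h2 : (l.parts.map fun k => ι (a k)).prod = MvPolynomial.C (l.parts.map a).prod := by
      rw [← hι, map_multiset_prod, Multiset.map_map]; rfl
    rw [h2, MvPolynomial.coeff_C_mul]
    congr 1
    rw [MvPolynomial.coeff_sum, Finset.sum_congr rfl fun p _ => by
      rw [prod_comp_content p, prod_X_eq_monomial, MvPolynomial.coeff_monomial],
      Finset.sum_boole, Finset.filter_filter, Nat.card_eq_fintype_card, Fintype.card_subtype]
    simp only [Equiv.apply_eq_iff_eq]
  · intro β _ hβ
    rw [MvPolynomial.coeff_monomial, if_neg]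
    simpa using hβ
  · intro h
    exact absurd (Finset.mem_piAntidiag.2 ⟨hα, by simp⟩) h

end Fixed

/-! ### Weighted lattice paths -/

section Paths

/-- Starting at height `h`, the path with steps `b - 1` stays nonnegative and ends at `0`. -/
def IsPath : ℕ → List ℕ → Prop
  | h, [] => h = 0
  | h, b :: l => h + b ≠ 0 ∧ IsPath (h + b - 1) l

/-- The weight of opening an arc below `d` open arcs. -/
def openWeight (d : ℕ) : ℂ := if d = 0 then 1 else 1 / 2

/-- The weighted number of ways to extend `d` open arcs to a noncrossing matching, no open arc
passing over a vanishing entry. -/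
def stackWeight : ℕ → List ℕ → ℂ
  | d, [] => if d = 0 then 1 else 0
  | d, b :: l => if b = 0 then (if d = 0 then stackWeight 0 l else 0) else
      -- The entry stays unmatched, opens an arc or closes the last one. Weights are relative to two
      -- free signs: a closing end has its sign forced, and so has an opening end under an open arc.
      stackWeight d l + openWeight d * stackWeight (d + 1) l +
        if d = 0 then 0 else 1 / 2 * stackWeight (d - 1) l

variable {R : Type*} [CommRing R] [Algebra ℂ R] (f : ℕ → R)

open Classical in
/-- The weight of a path. -/
def pathWeight (h : ℕ) (l : List ℕ) : R := if IsPath h l then (l.map f).prod else 0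

open Classical in
/-- The weight of a path all of whose nonzero entries are odd, decorated with matchings. -/
def oddPathWeight (h d : ℕ) (l : List ℕ) : R :=
  if IsPath h l ∧ ∀ b ∈ l, b ≠ 0 → Odd b then stackWeight d l • (l.map f).prod else 0

omit [Algebra ℂ R] in
theorem pathWeight_cons (h b : ℕ) (l : List ℕ) : pathWeight f h (b :: l) =
    if h + b = 0 then 0 else f b * pathWeight f (h + b - 1) l := by
  unfold pathWeight
  by_cases h1 : h + b = 0
  · rw [if_pos h1, if_neg]; exact fun h2 => h2.1 h1
  · rw [if_neg h1]
    by_cases h2 : IsPath (h + b - 1) l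
    · rw [if_pos ⟨h1, h2⟩, if_pos h2]; simp
    · rw [if_neg h2, if_neg (fun h3 => h2 h3.2), mul_zero]

/-- The entries allowed in an odd path, with their weights. -/
def oddCoef (b : ℕ) : R := if Odd b then f b else 0

/-- The four summands are a vanishing entry, possible only without open arcs, and an odd entry that
is unmatched, opening or closing. Each has the shape of a series coefficient times the weight of the
tail, the series being 1 or the odd part, so that `sum_pathCoeff` applies to each. -/
theorem oddPathWeight_cons (hf : f 0 = 1) (h d b : ℕ) (l : List ℕ) :
    oddPathWeight f h d (b :: l) =
      (if d = 0 then
        (if h + b = 0 then 0 else (if b = 0 then 1 else 0) * oddPathWeight f (h + b - 1) 0 l)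
        else 0) +
      (if h + b = 0 then 0 else oddCoef f b * oddPathWeight f (h + b - 1) d l) +
      openWeight d • (if h + b = 0 then 0 else
        oddCoef f b * oddPathWeight f (h + b - 1) (d + 1) l) +
      (if d = 0 then 0 else (1 / 2 : ℂ) • (if h + b = 0 then 0 else
        oddCoef f b * oddPathWeight f (h + b - 1) (d - 1) l)) := by
  unfold oddPathWeight
  by_cases h1 : h + b = 0
  · rw [if_neg fun h2 => h2.1.1 h1]; simp [h1]
  simp only [h1, if_false]
  by_cases h2 : IsPath (h + b - 1) l ∧ ∀ b ∈ l, b ≠ 0 → Odd b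
  · by_cases hb : b = 0
    · subst hb
      rw [if_pos ⟨⟨h1, h2.1⟩, by simpa using h2.2⟩]
      simp only [if_pos h2, oddCoef, stackWeight]
      by_cases hd : d = 0
      · simp [hd, hf]
      · simp [hd]
    · by_cases hodd : Odd b
      · rw [if_pos ⟨⟨h1, h2.1⟩, by simpa [hb, hodd] using h2.2⟩]
        simp only [if_pos h2, oddCoef, stackWeight, if_neg hb, if_pos hodd, List.map_cons,
          List.prod_cons, mul_smul_comm, smul_smul, zero_mul]
        by_cases hd : d = 0
        · simp [hd, add_smul]
        · simp [hd, add_smul]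
      · rw [if_neg fun h3 => hodd (h3.2 b (by simp) hb)]
        simp [oddCoef, hodd, hb]
  · have h3 : ¬ (IsPath h (b :: l) ∧ ∀ b' ∈ b :: l, b' ≠ 0 → Odd b') := fun h3 =>
      h2 ⟨h3.1.2, fun x hx => h3.2 x (by simp [hx])⟩
    simp only [if_neg h2, if_neg h3]
    simp

theorem sum_ofFn_succ {S : Type*} [AddCommMonoid S] (N n : ℕ) (F : List ℕ → S) :
    ∑ α : Fin (n + 1) → Fin (N + 1), F (List.ofFn fun i => (α i : ℕ)) =
      ∑ b ∈ Finset.range (N + 1), ∑ α : Fin n → Fin (N + 1),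
        F (b :: List.ofFn fun i => (α i : ℕ)) := by
  rw [Finset.sum_range, ← (Fin.consEquiv fun _ : Fin (n + 1) => Fin (N + 1)).sum_comp,
    Fintype.sum_prod_type]
  refine Finset.sum_congr rfl fun b _ => Finset.sum_congr rfl fun α _ => ?_
  simp [Fin.consEquiv, List.ofFn_succ]

end Paths

/-! ### Evaluation of the path sums -/

section Evaluate

open PowerSeries

variable {R : Type*} [CommRing R] [Algebra ℂ R]

theorem smul_injective_of_ne_zero {c : ℂ} (hc : c ≠ 0) {x y : R} (h : c • x = c • y) : x = y := by
  have := congrArg (fun x => c⁻¹ • x) h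
  simpa only [smul_smul, inv_mul_cancel₀ hc, one_smul] using this

/-- With F = q^(n+1) the series is F - t F'/(n+1), and t F' multiplies the coefficient of degree n +
1 by exactly n + 1. -/
theorem coeff_pow_mul_sub (q : R⟦X⟧) (n : ℕ) :
    coeff (n + 1) (q ^ n * (q - X * d⁄dX R q)) = 0 := by
  have h1 : d⁄dX R (q ^ (n + 1)) = ((n + 1 : ℕ) : ℂ) • (q ^ n * d⁄dX R q) := by
    rw [Derivation.leibniz_pow, Nat.add_sub_cancel, smul_eq_mul, ← Nat.cast_smul_eq_nsmul ℂ]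
  have h2 := congrArg (coeff n) h1
  rw [coeff_derivative] at h2
  have hn : ((n + 1 : ℕ) : ℂ) ≠ 0 := by exact_mod_cast Nat.succ_ne_zero n
  have h3 : q ^ n * (q - X * d⁄dX R q) = q ^ (n + 1) - X * (q ^ n * d⁄dX R q) := by ring
  rw [h3, map_sub, coeff_succ_X_mul]
  refine smul_injective_of_ne_zero hn ?_
  rw [smul_zero, smul_sub, sub_eq_zero]
  have h4 : coeff n (((n + 1 : ℕ) : ℂ) • (q ^ n * d⁄dX R q)) =
      ((n + 1 : ℕ) : ℂ) • coeff n (q ^ n * d⁄dX R q) := rfl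
  rw [← h4, ← h2, Algebra.smul_def, mul_comm]
  simp

/-- The coefficient giving the number of paths of length `n` from height `h`. -/
def pathCoeff (q : R⟦X⟧) (n h : ℕ) (Φ : R⟦X⟧) : R :=
  if h ≤ n then coeff (n - h) (q ^ n * (q - X * d⁄dX R q) * Φ) else 0

-- The sum over the first step is a convolution, hence a coefficient of a product. The one term that
-- the path condition removes is h = b = 0, and `h0` says that its value in the convolution is zero
-- anyway.
omit [Algebra ℂ R] in
theorem sum_pathCoeff (q : R⟦X⟧) (N n h : ℕ) (hN : n + 1 ≤ N) (g Φ : R⟦X⟧)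
    (h0 : h = 0 → coeff 0 g * coeff (n + 1) (q ^ n * (q - X * d⁄dX R q) * Φ) = 0) :
    ∑ b ∈ Finset.range (N + 1),
      (if h + b = 0 then 0 else coeff b g * pathCoeff q n (h + b - 1) Φ) =
    if h ≤ n + 1 then coeff (n + 1 - h) (q ^ n * (q - X * d⁄dX R q) * Φ * g) else 0 := by
  set Ψ := q ^ n * (q - X * d⁄dX R q) * Φ with hΨ
  have h1 : ∀ b, (if h + b = 0 then 0 else coeff b g * pathCoeff q n (h + b - 1) Φ) =
      if h + b ≤ n + 1 then coeff b g * coeff (n + 1 - h - b) Ψ else 0 := by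
    intro b
    by_cases hb : h + b = 0
    · obtain ⟨rfl, rfl⟩ : h = 0 ∧ b = 0 := by omega
      rw [if_pos hb, if_pos (by omega)]
      exact (h0 rfl).symm
    · rw [if_neg hb, pathCoeff]
      by_cases hb' : h + b ≤ n + 1
      · rw [if_pos hb', if_pos (by omega), show n - (h + b - 1) = n + 1 - h - b by omega]
      · rw [if_neg hb', if_neg (by omega), mul_zero]
  rw [Finset.sum_congr rfl fun b _ => h1 b]
  split_ifs with hh
  · rw [mul_comm Ψ, coeff_mul, Finset.Nat.sum_antidiagonal_eq_sum_range_succ_mk, ← Finset.sum_filter]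
    refine Finset.sum_congr ?_ fun _ _ => rfl
    ext b
    simp only [Finset.mem_filter, Finset.mem_range]
    omega
  · exact Finset.sum_eq_zero fun b _ => if_neg (by omega)

variable {a : ℕ → R} (ha : ∀ k, ¬ Odd k → a k = 0)

/-- Induction on the first step. The forbidden step from height 0 is harmless because the
coefficient of degree n + 1 of q^n (q - t q') vanishes. -/
theorem sum_pathWeight (q : R⟦X⟧) (hq : coeff 0 q = 1) (N n h : ℕ) (hN : n ≤ N) :
    ∑ α : Fin n → Fin (N + 1), pathWeight (fun k => coeff k q) h (List.ofFn fun i => (α i : ℕ)) =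
      pathCoeff q n h 1 := by
  induction n generalizing h with
  | zero =>
    rw [Fintype.sum_unique, pathWeight, pathCoeff]
    rcases Nat.eq_zero_or_pos h with rfl | hh
    · simp [IsPath] at hq ⊢
      simp [hq]
    · simp [IsPath, hh.ne']
  | succ n ih =>
    rw [sum_ofFn_succ]
    have h1 : ∀ b, ∑ α : Fin n → Fin (N + 1), pathWeight (fun k => coeff k q) h
        (b :: List.ofFn fun i => (α i : ℕ)) =
        if h + b = 0 then 0 else coeff b q * pathCoeff q n (h + b - 1) 1 := by
      intro b
      simp only [pathWeight_cons]
      split_ifs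
      · simp
      · rw [← Finset.mul_sum, ih _ (by omega)]
    rw [Finset.sum_congr rfl fun b _ => h1 b, sum_pathCoeff q N n h hN, pathCoeff]
    · congr 2
      ring
    · intro _
      rw [mul_one, coeff_pow_mul_sub, mul_zero]

/-- Each open arc is accounted for by a factor ρ. The first-step recursion asks for q = 1 + o + oρ
without open arcs and for qρ = oρ + oρ²/2 + o/2 with some; these are `h1` and `h2`. -/
theorem sum_oddPathWeight (q o ρ : R⟦X⟧) (hq : coeff 0 q = 1) (ho : ∀ k, coeff k o =
      oddCoef (fun k => coeff k q) k) (hρ : coeff 0 ρ = 0) (h1 : q = 1 + o * (1 + ρ))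
    (h2 : 2 * (q * ρ) = o * (1 + ρ) ^ 2) (N n h d : ℕ) (hN : n ≤ N) :
    ∑ α : Fin n → Fin (N + 1),
        oddPathWeight (fun k => coeff k q) h d (List.ofFn fun i => (α i : ℕ)) =
      pathCoeff q n h (ρ ^ d) := by
  induction n generalizing h d with
  | zero =>
    rw [Fintype.sum_unique, oddPathWeight, pathCoeff]
    rcases Nat.eq_zero_or_pos h with rfl | hh
    · simp only [coeff_zero_eq_constantCoeff] at hq hρ
      rcases Nat.eq_zero_or_pos d with rfl | hd
      · simp [IsPath, stackWeight, hq]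
      · simp [IsPath, stackWeight, hq, hρ, hd.ne']
    · simp [IsPath, hh.ne']
  | succ n ih =>
    rw [sum_ofFn_succ]
    set K := fun (b : ℕ) (g : R⟦X⟧) (d : ℕ) =>
      (if h + b = 0 then 0 else coeff b g * pathCoeff q n (h + b - 1) (ρ ^ d)) with hK
    have hb : ∀ b, ∑ α : Fin n → Fin (N + 1), oddPathWeight (fun k => coeff k q) h d
        (b :: List.ofFn fun i => (α i : ℕ)) =
        (if d = 0 then K b 1 0 else 0) + K b o d + openWeight d • K b o (d + 1) +
          if d = 0 then 0 else (1 / 2 : ℂ) • K b o (d - 1) := by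
      intro b
      simp only [oddPathWeight_cons (fun k => coeff k q) hq, ← ho, hK]
      rw [Finset.sum_add_distrib, Finset.sum_add_distrib, Finset.sum_add_distrib]
      by_cases hb : h + b = 0
      · simp [hb]
      · simp only [hb, if_false]
        have e : (if b = 0 then (1 : R) else 0) = coeff b (1 : R⟦X⟧) := by rw [coeff_one]
        by_cases hd : d = 0
        · subst hd
          simp only [if_true, ← Finset.mul_sum, ← Finset.smul_sum, e]
          rw [ih _ _ (by omega), ih _ _ (by omega)]
          simp
        · simp only [hd, if_false, ← Finset.mul_sum, ← Finset.smul_sum]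
          rw [ih _ _ (by omega), ih _ _ (by omega), ih _ _ (by omega)]
          simp
    rw [Finset.sum_congr rfl fun b _ => hb b]
    have ho0 : coeff 0 o = 0 := by rw [ho, oddCoef, if_neg (by simp)]
    have hKo : ∀ d, ∑ b ∈ Finset.range (N + 1), K b o d =
        if h ≤ n + 1 then coeff (n + 1 - h) (q ^ n * (q - X * d⁄dX R q) * ρ ^ d * o) else 0 :=
      fun d => sum_pathCoeff q N n h hN o (ρ ^ d) fun _ => by rw [ho0, zero_mul]
    have hK1 : ∑ b ∈ Finset.range (N + 1), K b 1 0 =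
        if h ≤ n + 1 then coeff (n + 1 - h) (q ^ n * (q - X * d⁄dX R q)) else 0 := by
      rw [sum_pathCoeff q N n h hN 1 (ρ ^ 0) fun _ => by
        rw [pow_zero, mul_one, coeff_pow_mul_sub, mul_zero], pow_zero, mul_one, mul_one]
    rw [pathCoeff]
    by_cases hd : d = 0
    · subst hd
      simp only [if_true, Finset.sum_add_distrib, hKo, hK1, openWeight,
        one_smul, add_zero]
      split_ifs
      · rw [← map_add, ← map_add]
        congr 1
        linear_combination (-(q ^ n * (q - X * d⁄dX R q))) * h1
      · simp
    · obtain ⟨d, rfl⟩ : ∃ e, d = e + 1 := ⟨d - 1, by omega⟩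
      simp only [hd, if_false, Finset.sum_add_distrib, ← Finset.smul_sum, hKo, openWeight,
        zero_add, Nat.add_sub_cancel]
      split_ifs
      · refine smul_injective_of_ne_zero (two_ne_zero : (2 : ℂ) ≠ 0) ?_
        rw [smul_add, smul_add, smul_smul, smul_smul]
        norm_num only [one_smul]
        rw [two_smul, two_smul, ← map_add, ← map_add, ← map_add, ← map_add]
        congr 1
        linear_combination (-(q ^ n * (q - X * d⁄dX R q)) * ρ ^ d) * h2
      · simp

-- With e and o the even and odd parts of q, the series ρ = o/(1+e) satisfies both identities
-- required for odd paths; the two path sums are then the same coefficient.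
include ha in
theorem sum_pathWeight_eq_sum_oddPathWeight (n : ℕ) :
    ∑ α : Fin n → Fin (n + 1), pathWeight (hgen a) 0 (List.ofFn fun i => (α i : ℕ)) =
      ∑ α : Fin n → Fin (n + 1), oddPathWeight (hgen a) 0 0 (List.ofFn fun i => (α i : ℕ)) := by
  set q := hser a with hq
  set qn : R⟦X⟧ := PowerSeries.mk (fun k => (-1) ^ k * hgen a k) with hqn
  have hqq : q * qn = 1 := hser_mul_evalNeg ha
  have hcq : ∀ k, coeff k q = hgen a k := fun k => by rw [hq, hser, coeff_mk]
  have hcq' : (fun k => coeff k q) = hgen a := funext hcq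
  have hcn : ∀ k, coeff k qn = (-1) ^ k * hgen a k := fun k => by rw [hqn, coeff_mk]
  let half : R⟦X⟧ := C (algebraMap ℂ R (1 / 2))
  have hh : 2 * half = 1 := by
    rw [show (2 : R⟦X⟧) = C (algebraMap ℂ R 2) by simp [map_ofNat], ← map_mul, ← map_mul]
    norm_num
  have hch : ∀ k (F : R⟦X⟧), coeff k (half * F) = (1 / 2 : ℂ) • coeff k F := fun k F => by
    rw [coeff_C_mul, Algebra.smul_def]
  set o : R⟦X⟧ := half * (q - qn) with ho
  set e : R⟦X⟧ := half * (q + qn) with he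
  -- The constant coefficient is 2, a unit in a ℂ-algebra.
  have hu : IsUnit (1 + e) := by
    rw [isUnit_iff_constantCoeff, map_add, map_one, ← coeff_zero_eq_constantCoeff_apply, hch,
      map_add, hcq, hcn, hgen_zero, pow_zero, mul_one, smul_add, ← add_smul]
    norm_num
    rw [show (2 : R) = algebraMap ℂ R 2 by simp [map_ofNat]]
    exact (IsUnit.mk0 (2 : ℂ) two_ne_zero).map _
  obtain ⟨u, hu⟩ := hu
  let v : R⟦X⟧ := ↑u⁻¹
  have hv : (1 + e) * v = 1 := by rw [← hu]; exact u.mul_inv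
  have hodd : ∀ k, coeff k o = oddCoef (fun k => coeff k q) k := by
    intro k
    rw [ho, hch, map_sub, hcq, hcn, oddCoef, hcq]
    split_ifs with hk
    · rw [hk.neg_one_pow, neg_one_mul, sub_neg_eq_add, smul_add, ← add_smul]
      norm_num
    · rw [(Nat.not_odd_iff_even.1 hk).neg_one_pow, one_mul, sub_self, smul_zero]
  have heo : e + o = q := by linear_combination (norm := skip) q * hh; rw [he, ho]; ring
  have heo' : e - o = qn := by linear_combination (norm := skip) qn * hh; rw [he, ho]; ring
  have hsq : e ^ 2 - o ^ 2 = 1 := by rw [← hqq, ← heo, ← heo']; ring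
  -- From o² = (e - 1)(e + 1) it follows that oρ = e - 1.
  have h1 : q = 1 + o * (1 + o * v) := by
    linear_combination (-1 : R⟦X⟧) * heo + (1 - e) * hv + v * hsq
  have hρ1 : (1 + o * v) * (1 + e) = 1 + q := by linear_combination o * hv + heo
  have h2 : 2 * (q * (o * v)) = o * (1 + o * v) ^ 2 := by
    have h3 : o * (1 + o * v) = q - 1 := by linear_combination -h1
    have h4 : 2 * (q * o) = (q - 1) * (1 + q) := by
      have : 2 * o = q - qn := by linear_combination (q - qn) * hh
      linear_combination q * this - hqq
    -- That is, 1 + ρ = (1 + q)/(1 + e); combined with o(1 + ρ) = q - 1 and 2qo = q² - 1 it gives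
    -- the second identity.
    have h5 : 1 + o * v = v * (1 + q) := by
      linear_combination v * hρ1 - (1 + o * v) * hv
    calc 2 * (q * (o * v)) = v * (2 * (q * o)) := by ring
      _ = (q - 1) * (v * (1 + q)) := by rw [h4]; ring
      _ = o * (1 + o * v) ^ 2 := by rw [← h5, ← h3]; ring
  have hρ : coeff 0 (o * v) = 0 := by
    rw [coeff_zero_eq_constantCoeff_apply, map_mul, ← coeff_zero_eq_constantCoeff_apply, hodd,
      oddCoef, if_neg (by simp), zero_mul]
  have hq0 : coeff 0 q = 1 := by rw [hcq, hgen_zero]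
  have hA := sum_pathWeight q hq0 n n 0 le_rfl
  have hB := sum_oddPathWeight q o (o * v) hq0 hodd hρ h1 h2 n n 0 0 le_rfl
  rw [hcq'] at hA hB
  rw [hA, hB, pow_zero]

end Evaluate

/-! ### Counting signs and matchings -/

section Completions

variable {n : ℕ}

/-- Signs `s` on the set `O` and a noncrossing matching `τ` of `O` satisfying the conditions
imposed on odd shifted parking functions. -/
structure IsAdmissible (O : Set (Fin n)) (s : Fin n → ℤˣ) (τ : Finset (Fin n × Fin n)) :
    Prop where
  -- Signs off `O` are normalised, so that only signs on `O` are counted.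
  support : ∀ k, k ∉ O → s k = 1
  lt : ∀ a b, (a, b) ∈ τ → a < b
  left_mem : ∀ a b, (a, b) ∈ τ → a ∈ O
  right_mem : ∀ a b, (a, b) ∈ τ → b ∈ O
  left_inj : ∀ a b c, (a, b) ∈ τ → (a, c) ∈ τ → b = c
  right_inj : ∀ a b c, (a, c) ∈ τ → (b, c) ∈ τ → a = b
  left_ne_right : ∀ a b c, (a, b) ∈ τ → (b, c) ∉ τ
  noncrossing : ∀ a b c d, (a, c) ∈ τ → (b, d) ∈ τ → a < b → b < c → ¬ c < d
  arc_sign : ∀ a b, (a, b) ∈ τ → s a = -s b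
  arc_cover : ∀ a b c, (a, c) ∈ τ → a < b → b < c → b ∈ O
  arc_nested : ∀ a b c d, (a, d) ∈ τ → (b, c) ∈ τ → a < b → c < d → s a = s b

/-- The initial part, below `k`, of signs and a matching, with `L` the set of the left ends of the
arcs which end at `k` or later; all of these have sign `g`. -/
structure IsInitialPart (O : Set (Fin n)) (k : ℕ) (s : Fin n → ℤˣ) (τ : Finset (Fin n × Fin n))
    (L : Finset (Fin n)) (g : ℤˣ) : Prop extends IsAdmissible O s τ where
  late : ∀ j : Fin n, k ≤ j → s j = 1
  arc_lt : ∀ a b, (a, b) ∈ τ → (b : ℕ) < k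
  open_lt : ∀ l ∈ L, (l : ℕ) < k
  open_mem : ∀ l ∈ L, l ∈ O
  open_ne_left : ∀ l ∈ L, ∀ b, (l, b) ∉ τ
  open_ne_right : ∀ l ∈ L, ∀ a, (a, l) ∉ τ
  open_noncrossing : ∀ l ∈ L, ∀ a b, (a, b) ∈ τ → a < l → ¬ l < b
  open_sign : ∀ l ∈ L, s l = g
  open_cover : ∀ l ∈ L, ∀ j, l < j → (j : ℕ) < k → j ∈ O
  open_nested : ∀ l ∈ L, ∀ b c, (b, c) ∈ τ → l < b → s b = g

/-- `(s', τ')` extends the initial part `(s, τ, L)`. -/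
structure Extends (O : Set (Fin n)) (k : ℕ) (s : Fin n → ℤˣ) (τ : Finset (Fin n × Fin n))
    (L : Finset (Fin n)) (x : (Fin n → ℤˣ) × Finset (Fin n × Fin n)) : Prop where
  adm : IsAdmissible O x.1 x.2
  sign_eq : ∀ j : Fin n, (j : ℕ) < k → x.1 j = s j
  arc_iff : ∀ a b : Fin n, (b : ℕ) < k → ((a, b) ∈ x.2 ↔ (a, b) ∈ τ)
  open_iff : ∀ a, a ∈ L ↔ (a : ℕ) < k ∧ ∃ b : Fin n, k ≤ b ∧ (a, b) ∈ x.2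

open Classical in
/-- The extensions of an initial part. -/
def extensions (O : Set (Fin n)) (k : ℕ) (s : Fin n → ℤˣ) (τ : Finset (Fin n × Fin n))
    (L : Finset (Fin n)) : Finset ((Fin n → ℤˣ) × Finset (Fin n × Fin n)) :=
  Finset.univ.filter (Extends O k s τ L)

variable {O : Set (Fin n)} {s : Fin n → ℤˣ} {τ : Finset (Fin n × Fin n)} {L : Finset (Fin n)}
  {g : ℤˣ} {x : (Fin n → ℤˣ) × Finset (Fin n × Fin n)}

theorem mem_extensions {k : ℕ} : x ∈ extensions O k s τ L ↔ Extends O k s τ L x := by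
  simp [extensions]

/-- At the end, an initial part without open arcs is complete. -/
theorem extensions_end (h : IsInitialPart O n s τ L g) :
    extensions O n s τ L = if L = ∅ then {(s, τ)} else ∅ := by
  ext ⟨s', τ'⟩
  rw [mem_extensions]
  split_ifs with hL
  · subst hL
    rw [Finset.mem_singleton]
    constructor
    · rintro ⟨-, h1, h2, -⟩
      refine Prod.ext (funext fun j => h1 j j.2) (Finset.ext fun ⟨a, b⟩ => h2 a b b.2)
    · intro h'
      simp only [Prod.mk.injEq] at h'
      obtain ⟨rfl, rfl⟩ := h'
      exact ⟨h.toIsAdmissible, fun _ _ => rfl, fun _ _ _ => Iff.rfl, fun a => by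
        simp only [Finset.notMem_empty, false_iff, not_and, not_exists]
        intro _ b hb
        exact absurd b.2 (by omega)⟩
  · simp only [Finset.notMem_empty, iff_false]
    rintro ⟨-, -, -, h3⟩
    obtain ⟨l, hl⟩ := Finset.nonempty_iff_ne_empty.2 hL
    obtain ⟨_, b, hb, _⟩ := (h3 l).1 hl
    exact absurd b.2 (by omega)

/-- No arc passes over a missing integer. -/
theorem extensions_skip_of_nonempty (K : Fin n) (hK : K ∉ O) (hL : L.Nonempty) :
    extensions O K s τ L = ∅ := by
  ext x
  simp only [mem_extensions, Finset.notMem_empty, iff_false]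
  intro h
  obtain ⟨l, hl⟩ := hL
  obtain ⟨h1, b, h2, h3⟩ := (h.open_iff l).1 hl
  rcases h2.lt_or_eq with h2 | h2
  · exact hK (h.adm.arc_cover l K b h3 h1 h2)
  · exact hK (Fin.ext h2 ▸ h.adm.right_mem _ _ h3)

theorem extensions_skip (K : Fin n) (hK : K ∉ O) (h : IsInitialPart O K s τ ∅ g) :
    extensions O K s τ ∅ = extensions O (K + 1) s τ ∅ := by
  ext x
  rw [mem_extensions, mem_extensions]
  have hl := h.late
  have hn := h.arc_lt
  constructor
  · intro ⟨h0, h1, h2, h3⟩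
    have := h0.support
    have := h0.left_mem
    have := h0.right_mem
    have := h0.lt
    refine ⟨h0, fun j hj => ?_, fun a b hb => ?_, fun a => ?_⟩
    · rcases Nat.lt_succ_iff_lt_or_eq.1 hj with hj | hj
      · exact h1 j hj
      · rw [Fin.ext hj, h0.support K hK, hl K le_rfl]
    · rcases Nat.lt_succ_iff_lt_or_eq.1 hb with hb | hb
      · exact h2 a b hb
      · obtain rfl := Fin.ext hb
        exact ⟨fun h => absurd (h0.right_mem _ _ h) hK, fun h => absurd (hn _ _ h) (lt_irrefl _)⟩
    · simp only [Finset.notMem_empty, false_iff, not_and, not_exists]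
      intro ha b hb hab
      rcases Nat.lt_succ_iff_lt_or_eq.1 ha with ha | ha
      · exact absurd ((h3 a).2 ⟨ha, b, by omega, hab⟩) (Finset.notMem_empty _)
      · exact hK (Fin.ext ha ▸ h0.left_mem _ _ hab)
  · intro ⟨h0, h1, h2, h3⟩
    refine ⟨h0, fun j hj => h1 j (by omega), fun a b hb => h2 a b (by omega), fun a => ?_⟩
    simp only [Finset.notMem_empty, false_iff, not_and, not_exists]
    intro ha b hb hab
    rcases hb.lt_or_eq with hb | hb
    · exact absurd ((h3 a).2 ⟨by omega, b, by omega, hab⟩) (Finset.notMem_empty _)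
    · exact hK (Fin.ext hb ▸ h0.right_mem _ _ hab)

theorem IsInitialPart.skip {K : Fin n} (h : IsInitialPart O K s τ ∅ g) :
    IsInitialPart O (K + 1) s τ ∅ g where
  toIsAdmissible := h.toIsAdmissible
  late j hj := h.late j (by omega)
  arc_lt a b hab := (h.arc_lt a b hab).trans (Nat.lt_succ_self _)
  open_lt := by simp
  open_mem := by simp
  open_ne_left := by simp
  open_ne_right := by simp
  open_noncrossing := by simp
  open_sign := by simp
  open_cover := by simp
  open_nested := by simp

/-- Leave `K` unmatched. -/
theorem IsInitialPart.unmatched {K : Fin n} (hK : K ∈ O) (h : IsInitialPart O K s τ L g) (ε : ℤˣ) :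
    IsInitialPart O (K + 1) (Function.update s K ε) τ L g := by
  obtain ⟨⟨a1, a2, a3, a4, a5, a6, a7, a8, a9, a10, a11⟩, b1, b2, b3, b4, b5, b6, b7, b8, b9, b10⟩ := h
  have e : ∀ j : Fin n, (j : ℕ) < K → Function.update s K ε j = s j := fun j hj =>
    Function.update_of_ne (by rintro rfl; exact lt_irrefl _ hj) _ _
  have hl : ∀ a b, (a, b) ∈ τ → (a : ℕ) < K := fun a b hab => lt_trans (a2 a b hab) (b2 a b hab)
  refine ⟨⟨?_, a2, a3, a4, a5, a6, a7, a8, ?_, a10, ?_⟩, ?_, ?_, ?_, b4, b5, b6, b7, ?_, ?_, ?_⟩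
  · intro k hk
    rw [Function.update_of_ne (by rintro rfl; exact hk hK)]
    exact a1 k hk
  · intro a b hab
    rw [e _ (hl _ _ hab), e _ (b2 _ _ hab)]
    exact a9 a b hab
  · intro a b c d h1 h2
    rw [e _ (hl _ _ h1), e _ (hl _ _ h2)]
    exact a11 a b c d h1 h2
  · intro j hj
    rw [Function.update_of_ne (by rintro rfl; omega)]
    exact b1 j (by omega)
  · intro a b hab; have := b2 a b hab; omega
  · intro l hl; have := b3 l hl; omega
  · intro l hl; rw [e _ (b3 _ hl)]; exact b8 l hl
  · intro l hl j h1 h2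
    rcases Nat.lt_succ_iff_lt_or_eq.1 h2 with h2 | h2
    · exact b9 l hl j h1 h2
    · exact Fin.ext h2 ▸ hK
  · intro l hl' b c hbc h1
    rw [e _ (hl _ _ hbc)]
    exact b10 l hl' b c hbc h1

/-- Open an arc at `K`. -/
theorem IsInitialPart.open {K : Fin n} (hK : K ∈ O) (h : IsInitialPart O K s τ L g) (ε : ℤˣ)
    (hε : L.Nonempty → ε = g) :
    IsInitialPart O (K + 1) (Function.update s K ε) τ (insert K L) ε := by
  have h' := h.unmatched hK ε
  have hl : ∀ a b, (a, b) ∈ τ → (a : ℕ) < K ∧ (b : ℕ) < K := fun a b hab =>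
    ⟨lt_trans (h.lt a b hab) (h.arc_lt a b hab), h.arc_lt a b hab⟩
  have hne : ∀ l ∈ L, ε = g := fun l hl => hε ⟨l, hl⟩
  refine ⟨h'.toIsAdmissible, h'.late, h'.arc_lt, ?_, ?_, ?_, ?_, ?_, ?_, ?_, ?_⟩ <;>
    simp only [Finset.mem_insert, forall_eq_or_imp]
  · exact ⟨Nat.lt_succ_self _, h'.open_lt⟩
  · exact ⟨hK, h'.open_mem⟩
  · exact ⟨fun b hb => absurd (hl _ _ hb).1 (lt_irrefl _), h'.open_ne_left⟩
  · exact ⟨fun b hb => absurd (hl _ _ hb).2 (lt_irrefl _), h'.open_ne_right⟩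
  · refine ⟨fun a b hab _ hb => ?_, h'.open_noncrossing⟩
    have := (hl _ _ hab).2
    rw [Fin.lt_def] at hb
    omega
  · refine ⟨Function.update_self .., fun l hl => ?_⟩
    rw [hne l hl]
    have := h'.open_sign l hl
    rwa [hne l hl] at this
  · refine ⟨fun j h1 h2 => ?_, h'.open_cover⟩
    rw [Fin.lt_def] at h1; omega
  · refine ⟨fun b c hbc hb => ?_, fun l hl b c hbc hb => ?_⟩
    · have := (hl _ _ hbc).1
      rw [Fin.lt_def] at hb
      omega
    · rw [hne l hl]
      have := h'.open_nested l hl b c hbc hb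
      rwa [hne l hl] at this

/-- Close at `K` the arc which was opened last. -/
theorem IsInitialPart.close {K a : Fin n} (hK : K ∈ O) (h : IsInitialPart O K s τ L g)
    (ha : a ∈ L) (hmax : ∀ l ∈ L, l ≤ a) :
    IsInitialPart O (K + 1) (Function.update s K (-g)) (insert (a, K) τ) (L.erase a) g := by
  have h' := h.unmatched hK (-g)
  have hlt : ∀ a b, (a, b) ∈ τ → a < K ∧ b < K := fun a b hab =>
    ⟨lt_trans (h.lt a b hab) (h.arc_lt a b hab), h.arc_lt a b hab⟩
  have haK : a < K := h.open_lt a ha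
  have hKl : ∀ b, (K, b) ∉ τ := fun b hb => absurd (hlt _ _ hb).1 (lt_irrefl _)
  have hKr : ∀ b, (b, K) ∉ τ := fun b hb => absurd (hlt _ _ hb).2 (lt_irrefl _)
  have hal := h.open_ne_left a ha
  have har := h.open_ne_right a ha
  have hsK : Function.update s K (-g) K = -g := Function.update_self ..
  have hsa : Function.update s K (-g) a = g := h'.open_sign a ha
  have hm : ∀ l ∈ L, l ≠ a → l < a := fun l hl hne => lt_of_le_of_ne (hmax l hl) hne
  obtain ⟨⟨a1, a2, a3, a4, a5, a6, a7, a8, a9, a10, a11⟩, b1, b2, b3, b4, b5, b6, b7, b8, b9, b10⟩ :=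
    h'
  generalize Function.update s K (-g) = s' at *
  have hτ : ∀ x y, (x, y) ∈ insert (a, K) τ ↔ (x = a ∧ y = K) ∨ (x, y) ∈ τ := by
    intro x y; simp
  refine ⟨⟨a1, ?_, ?_, ?_, ?_, ?_, ?_, ?_, ?_, ?_, ?_⟩, b1, ?_, ?_, ?_, ?_, ?_, ?_, ?_, ?_, ?_⟩ <;>
    simp only [hτ, Finset.mem_erase]
  · rintro x y (⟨rfl, rfl⟩ | h1)
    exacts [haK, a2 _ _ h1]
  · rintro x y (⟨rfl, rfl⟩ | h1)
    exacts [b4 _ ha, a3 _ _ h1]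
  · rintro x y (⟨rfl, rfl⟩ | h1)
    exacts [hK, a4 _ _ h1]
  · rintro x y z (⟨rfl, rfl⟩ | h1) (⟨h2, rfl⟩ | h2)
    exacts [rfl, absurd h2 (hal _), absurd (h2 ▸ h1) (hal _), a5 _ _ _ h1 h2]
  · rintro x y z (⟨rfl, rfl⟩ | h1) (⟨rfl, h2⟩ | h2)
    exacts [rfl, absurd h2 (hKr _), absurd (h2 ▸ h1) (hKr _), a6 _ _ _ h1 h2]
  · rintro x y z (⟨rfl, rfl⟩ | h1) (⟨h2, h3⟩ | h2)
    exacts [haK.ne' h2, hKl _ h2, har _ (h2 ▸ h1), a7 _ _ _ h1 h2]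
  · rintro x y z w (⟨rfl, rfl⟩ | h1) (⟨rfl, rfl⟩ | h2) h3 h4 h5
    · exact lt_irrefl _ h3
    · exact lt_asymm h5 (hlt _ _ h2).2
    · exact b7 _ ha _ _ h1 h3 h4
    · exact a8 _ _ _ _ h1 h2 h3 h4 h5
  · rintro x y (⟨rfl, rfl⟩ | h1)
    · rw [hsK, hsa, neg_neg]
    · exact a9 _ _ h1
  · rintro x y z (⟨rfl, rfl⟩ | h1) h3 h4
    · exact b9 _ ha y h3 (by rw [Fin.lt_def] at h4; omega)
    · exact a10 _ _ _ h1 h3 h4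
  · rintro x y z w (⟨rfl, rfl⟩ | h1) (⟨rfl, rfl⟩ | h2) h3 h4
    · exact absurd h3 (lt_irrefl _)
    · rw [hsa, b10 _ ha _ _ h2 h3]
    · exact absurd h4 (lt_asymm (hlt _ _ h1).2)
    · exact a11 _ _ _ _ h1 h2 h3 h4
  · rintro x y (⟨rfl, rfl⟩ | h1)
    exacts [Nat.lt_succ_self _, b2 _ _ h1]
  · exact fun l hl => b3 l hl.2
  · exact fun l hl => b4 l hl.2
  · rintro l hl b (⟨rfl, rfl⟩ | h1)
    exacts [hl.1 rfl, b5 l hl.2 b h1]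
  · rintro l hl b (⟨rfl, rfl⟩ | h1)
    exacts [absurd (hm _ hl.2 hl.1) (lt_asymm haK), b6 l hl.2 b h1]
  · rintro l hl x y (⟨rfl, rfl⟩ | h1) h3 h4
    exacts [lt_asymm h3 (hm _ hl.2 hl.1), b7 l hl.2 _ _ h1 h3 h4]
  · exact fun l hl => b8 l hl.2
  · exact fun l hl => b9 l hl.2
  · rintro l hl x y (⟨rfl, rfl⟩ | h1) h3
    exacts [hsa, b10 l hl.2 _ _ h1 h3]

theorem extends_succ_sign {K : Fin n} {ε : ℤˣ} {τ' L'}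
    (h : Extends O (K + 1) (Function.update s K ε) τ' L' x) : x.1 K = ε := by
  rw [h.sign_eq K (Nat.lt_succ_self _), Function.update_self]

theorem sign_eq_update {K : Fin n} (h : ∀ j : Fin n, (j : ℕ) < K → x.1 j = s j) (j : Fin n)
    (hj : (j : ℕ) < K + 1) : x.1 j = Function.update s K (x.1 K) j := by
  rcases Nat.lt_succ_iff_lt_or_eq.1 hj with hj | hj
  · rw [Function.update_of_ne (by rintro rfl; exact lt_irrefl _ hj), h j hj]
  · obtain rfl := Fin.ext hj
    rw [Function.update_self]

theorem sign_eq_of_update {K : Fin n} {ε : ℤˣ}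
    (h : ∀ j : Fin n, (j : ℕ) < K + 1 → x.1 j = Function.update s K ε j) (j : Fin n)
    (hj : (j : ℕ) < K) : x.1 j = s j := by
  rw [h j (by omega), Function.update_of_ne (by rintro rfl; exact lt_irrefl _ hj)]

theorem extends_unmatched_iff {K : Fin n} (h : IsInitialPart O K s τ L g) (ε : ℤˣ) :
    Extends O (K + 1) (Function.update s K ε) τ L x ↔
      Extends O K s τ L x ∧ x.1 K = ε ∧ (∀ b, (K, b) ∉ x.2) ∧ ∀ a, (a, K) ∉ x.2 := by
  have hK : ∀ a, (a, K) ∉ τ := fun a ha => lt_irrefl _ (h.arc_lt _ _ ha)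
  have hKL : K ∉ L := fun hK => lt_irrefl _ (h.open_lt _ hK)
  constructor
  · intro hx
    have h1 : ∀ a, (a, K) ∉ x.2 := fun a ha => hK a ((hx.arc_iff a K (Nat.lt_succ_self _)).1 ha)
    have h2 : ∀ b, (K, b) ∉ x.2 := fun b hb => hKL ((hx.open_iff K).2
      ⟨Nat.lt_succ_self _, b, hx.adm.lt _ _ hb, hb⟩)
    refine ⟨⟨hx.adm, sign_eq_of_update hx.sign_eq, fun a b hb => hx.arc_iff a b (by omega),
      fun a => ?_⟩, extends_succ_sign hx, h2, h1⟩
    rw [hx.open_iff]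
    constructor
    · rintro ⟨h3, b, h4, h5⟩
      refine ⟨lt_of_le_of_ne (by omega) fun h6 => h2 b ?_, b, by omega, h5⟩
      rwa [← Fin.ext h6]
    · rintro ⟨h3, b, h4, h5⟩
      refine ⟨by omega, b, lt_of_le_of_ne h4 fun h6 => h1 a ?_, h5⟩
      rwa [Fin.ext h6]
  · rintro ⟨hx, rfl, h2, h1⟩
    refine ⟨hx.adm, sign_eq_update hx.sign_eq, fun a b hb => ?_, fun a => ?_⟩
    · rcases Nat.lt_succ_iff_lt_or_eq.1 hb with hb | hb
      · exact hx.arc_iff a b hb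
      · obtain rfl := Fin.ext hb
        exact iff_of_false (h1 a) (hK a)
    · rw [hx.open_iff]
      constructor
      · rintro ⟨h3, b, h4, h5⟩
        refine ⟨by omega, b, lt_of_le_of_ne h4 fun h6 => h1 a ?_, h5⟩
        rwa [Fin.ext h6]
      · rintro ⟨h3, b, h4, h5⟩
        refine ⟨lt_of_le_of_ne (by omega) fun h6 => h2 b ?_, b, by omega, h5⟩
        rwa [← Fin.ext h6]

theorem extends_open_iff {K : Fin n} (h : IsInitialPart O K s τ L g) (ε : ℤˣ) :
    Extends O (K + 1) (Function.update s K ε) τ (insert K L) x ↔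
      Extends O K s τ L x ∧ x.1 K = ε ∧ ∃ b, (K, b) ∈ x.2 := by
  have hK : ∀ a, (a, K) ∉ τ := fun a ha => lt_irrefl _ (h.arc_lt _ _ ha)
  have hKL : K ∉ L := fun hK => lt_irrefl _ (h.open_lt _ hK)
  constructor
  · intro hx
    have h1 : ∀ a, (a, K) ∉ x.2 := fun a ha => hK a ((hx.arc_iff a K (Nat.lt_succ_self _)).1 ha)
    obtain ⟨_, b, _, hb⟩ := (hx.open_iff K).1 (Finset.mem_insert_self _ _)
    refine ⟨⟨hx.adm, sign_eq_of_update hx.sign_eq, fun a b hb => hx.arc_iff a b (by omega),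
      fun a => ?_⟩, extends_succ_sign hx, b, hb⟩
    have h0 := hx.open_iff a
    rw [Finset.mem_insert] at h0
    constructor
    · intro ha
      obtain ⟨_, c, h4, h5⟩ := h0.1 (Or.inr ha)
      exact ⟨h.open_lt a ha, c, by omega, h5⟩
    · rintro ⟨h3, c, h4, h5⟩
      refine (h0.2 ⟨by omega, c, lt_of_le_of_ne h4 fun h6 => h1 a ?_, h5⟩).resolve_left ?_
      · rwa [Fin.ext h6]
      · rintro rfl; exact lt_irrefl _ h3
  · rintro ⟨hx, rfl, b, hb⟩
    have h1 : ∀ a, (a, K) ∉ x.2 := fun a ha => hx.adm.left_ne_right _ _ _ ha hb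
    refine ⟨hx.adm, sign_eq_update hx.sign_eq, fun a b hb => ?_, fun a => ?_⟩
    · rcases Nat.lt_succ_iff_lt_or_eq.1 hb with hb | hb
      · exact hx.arc_iff a b hb
      · obtain rfl := Fin.ext hb
        exact iff_of_false (h1 a) (hK a)
    · rw [Finset.mem_insert, hx.open_iff]
      constructor
      · rintro (rfl | ⟨h3, c, h4, h5⟩)
        · exact ⟨Nat.lt_succ_self _, b, hx.adm.lt _ _ hb, hb⟩
        · refine ⟨by omega, c, lt_of_le_of_ne h4 fun h6 => h1 a ?_, h5⟩
          rwa [Fin.ext h6]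
      · rintro ⟨h3, c, h4, h5⟩
        rcases Nat.lt_succ_iff_lt_or_eq.1 h3 with h3 | h3
        · exact Or.inr ⟨h3, c, by omega, h5⟩
        · exact Or.inl (Fin.ext h3)

/-- The noncrossing condition leaves only the last opened arc to be closed at `K`, and the sign of
its right end is then forced. -/
theorem extends_close_iff {K a : Fin n} (h : IsInitialPart O K s τ L g) (ha : a ∈ L)
    (hmax : ∀ l ∈ L, l ≤ a) :
    Extends O (K + 1) (Function.update s K (-g)) (insert (a, K) τ) (L.erase a) x ↔
      Extends O K s τ L x ∧ ∃ a, (a, K) ∈ x.2 := by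
  have hK : ∀ a, (a, K) ∉ τ := fun a ha => lt_irrefl _ (h.arc_lt _ _ ha)
  have haK : a < K := h.open_lt a ha
  have hτ : ∀ x y, (x, y) ∈ insert (a, K) τ ↔ (x = a ∧ y = K) ∨ (x, y) ∈ τ := by
    intro x y; simp
  constructor
  · intro hx
    have h1 : (a, K) ∈ x.2 := (hx.arc_iff a K (Nat.lt_succ_self _)).2 (Finset.mem_insert_self _ _)
    refine ⟨⟨hx.adm, sign_eq_of_update hx.sign_eq, fun c b hb => ?_, fun c => ?_⟩, a, h1⟩
    · rw [hx.arc_iff c b (by omega), hτ]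
      refine or_iff_right ?_
      rintro ⟨-, rfl⟩; exact lt_irrefl _ hb
    · have h0 := hx.open_iff c
      rw [Finset.mem_erase] at h0
      constructor
      · intro hc
        by_cases hca : c = a
        · subst hca; exact ⟨haK, K, le_rfl, h1⟩
        · obtain ⟨_, b, h4, h5⟩ := h0.1 ⟨hca, hc⟩
          exact ⟨h.open_lt c hc, b, by omega, h5⟩
      · rintro ⟨h3, b, h4, h5⟩
        rcases h4.lt_or_eq with h4 | h4
        · exact (h0.2 ⟨by omega, b, h4, h5⟩).2
        · obtain rfl := Fin.ext h4
          rwa [hx.adm.right_inj _ _ _ h5 h1]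
  · rintro ⟨hx, a', ha'⟩
    -- If the arc ending at `K` began before `a`, the arc open at `a` would have to end beyond `K`
    -- and cross it.
    have h1 : a' = a := by
      have h2 : a' ∈ L := (hx.open_iff a').2 ⟨hx.adm.lt _ _ ha', K, le_rfl, ha'⟩
      refine le_antisymm (hmax _ h2) ?_
      by_contra h3
      rw [not_le] at h3
      obtain ⟨_, b, h4, h5⟩ := (hx.open_iff a).1 ha
      rcases h4.lt_or_eq with h4 | h4
      · exact hx.adm.noncrossing _ _ _ _ ha' h5 h3 haK h4
      · obtain rfl := Fin.ext h4
        exact h3.ne (hx.adm.right_inj _ _ _ ha' h5)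
    subst h1
    have h2 : x.1 K = -g := by
      have := hx.adm.arc_sign _ _ ha'
      rw [hx.sign_eq _ haK, h.open_sign _ ha] at this
      rw [this, neg_neg]
    have h3 : ∀ b, (K, b) ∉ x.2 := fun b => hx.adm.left_ne_right _ _ _ ha'
    refine ⟨hx.adm, h2 ▸ sign_eq_update hx.sign_eq, fun c b hb => ?_, fun c => ?_⟩
    · rw [hτ]
      rcases Nat.lt_succ_iff_lt_or_eq.1 hb with hb | hb
      · rw [hx.arc_iff c b hb]
        refine (or_iff_right ?_).symm
        rintro ⟨-, rfl⟩; exact lt_irrefl _ hb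
      · obtain rfl := Fin.ext hb
        constructor
        · intro hc; exact Or.inl ⟨hx.adm.right_inj _ _ _ hc ha', rfl⟩
        · rintro (⟨rfl, -⟩ | hc)
          exacts [ha', absurd hc (hK c)]
    · rw [Finset.mem_erase, hx.open_iff]
      constructor
      · rintro ⟨hne, h4, b, h5, h6⟩
        refine ⟨by omega, b, lt_of_le_of_ne h5 fun h7 => hne ?_, h6⟩
        obtain rfl := Fin.ext h7
        exact hx.adm.right_inj _ _ _ h6 ha'
      · rintro ⟨h4, b, h5, h6⟩
        refine ⟨?_, lt_of_le_of_ne (by omega) fun h7 => h3 b (Fin.ext h7 ▸ h6), b, by omega, h6⟩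
        rintro rfl
        rw [hx.adm.left_inj _ _ _ h6 ha'] at h5
        omega

/-- An arc starting below an open arc has the same sign. -/
theorem Extends.sign_of_open {K b : Fin n} (h : IsInitialPart O K s τ L g)
    (hx : Extends O K s τ L x) (hb : (K, b) ∈ x.2) (hL : L.Nonempty) : x.1 K = g := by
  obtain ⟨l, hl⟩ := hL
  obtain ⟨h1, c, h2, h3⟩ := (hx.open_iff l).1 hl
  rw [← h.open_sign l hl, ← hx.sign_eq l h1]
  have hKc : K ≠ c := by rintro rfl; exact hx.adm.left_ne_right _ _ _ h3 hb
  have hKc : K < c := lt_of_le_of_ne h2 hKc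
  have hbc : b ≠ c := by rintro rfl; exact (Fin.ne_of_lt h1) (hx.adm.right_inj _ _ _ h3 hb)
  -- The open arc ends after `K`, so by noncrossing it encloses the arc that begins there, and
  -- nested arcs have equal signs.
  have : b < c := by
    by_contra h4
    exact hx.adm.noncrossing _ _ _ _ h3 hb h1 hKc (lt_of_le_of_ne (not_lt.1 h4) hbc.symm)
  exact (hx.adm.arc_nested _ _ _ _ h3 hb h1 this).symm

-- Extensions are sorted by the role of `K`: unmatched, left end or right end. The sign of `K` is
-- free in the first case, free in the second only if no arc is open, and forced in the third.
open Classical in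
theorem card_extensions_step {K : Fin n} (h : IsInitialPart O K s τ L g) :
    (extensions O K s τ L).card =
      (∑ ε : ℤˣ, (extensions O (K + 1) (Function.update s K ε) τ L).card) +
      (∑ ε ∈ (if L = ∅ then Finset.univ else {g}),
        (extensions O (K + 1) (Function.update s K ε) τ (insert K L)).card) +
      if hL : L.Nonempty then (extensions O (K + 1) (Function.update s K (-g))
        (insert (L.max' hL, K) τ) (L.erase (L.max' hL))).card else 0 := by
  have e1 := Finset.card_eq_sum_card_fiberwise (f := fun x => x.1 K) (t := Finset.univ)
    (s := (extensions O K s τ L).filter fun x => (∀ b, (K, b) ∉ x.2) ∧ ∀ a, (a, K) ∉ x.2)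
    (fun _ _ => Finset.mem_coe.2 (Finset.mem_univ _))
  have e2 := Finset.card_eq_sum_card_fiberwise (f := fun x => x.1 K)
    (t := if L = ∅ then Finset.univ else {g})
    (s := (extensions O K s τ L).filter fun x => ∃ b, (K, b) ∈ x.2) (by
      intro x hx
      split_ifs with hL
      · exact Finset.mem_coe.2 (Finset.mem_univ _)
      · obtain ⟨hx, b, hb⟩ := Finset.mem_filter.1 (Finset.mem_coe.1 hx)
        rw [mem_extensions] at hx
        simpa using hx.sign_of_open h hb (Finset.nonempty_iff_ne_empty.2 hL))
  have e3 : ((extensions O K s τ L).filter fun x => ∃ a, (a, K) ∈ x.2) =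
      if hL : L.Nonempty then extensions O (K + 1) (Function.update s K (-g))
        (insert (L.max' hL, K) τ) (L.erase (L.max' hL)) else ∅ := by
    ext x
    rw [Finset.mem_filter, mem_extensions]
    split_ifs with hL
    · rw [mem_extensions, extends_close_iff h (L.max'_mem hL) (fun l hl => L.le_max' l hl)]
    · simp only [Finset.notMem_empty, iff_false]
      rintro ⟨hx, a, ha⟩
      exact hL ⟨a, (hx.open_iff a).2 ⟨hx.adm.lt _ _ ha, K, le_rfl, ha⟩⟩
  have e4 : (if hL : L.Nonempty then (extensions O (K + 1) (Function.update s K (-g))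
        (insert (L.max' hL, K) τ) (L.erase (L.max' hL))).card else 0) =
      ((extensions O K s τ L).filter fun x => ∃ a, (a, K) ∈ x.2).card := by
    rw [e3]; split_ifs <;> simp
  have e5 : extensions O K s τ L =
      (((extensions O K s τ L).filter fun x => (∀ b, (K, b) ∉ x.2) ∧ ∀ a, (a, K) ∉ x.2) ∪
      ((extensions O K s τ L).filter fun x => ∃ b, (K, b) ∈ x.2)) ∪
      ((extensions O K s τ L).filter fun x => ∃ a, (a, K) ∈ x.2) := by
    rw [← Finset.filter_or, ← Finset.filter_or, Finset.filter_true_of_mem]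
    intro x _
    by_contra hc
    push Not at hc
    obtain ⟨⟨h1, h2⟩, h3⟩ := hc
    obtain ⟨a, ha⟩ := h1 h2
    exact h3 a ha
  conv_lhs => rw [e5]
  rw [Finset.card_union_of_disjoint, Finset.card_union_of_disjoint, e1, e2, e4]
  · congr 2
    · refine Finset.sum_congr rfl fun ε _ => congrArg _ ?_
      ext x
      rw [Finset.mem_filter, Finset.mem_filter, mem_extensions, mem_extensions,
        extends_unmatched_iff h]
      tauto
    · refine Finset.sum_congr rfl fun ε _ => congrArg _ ?_
      ext x
      rw [Finset.mem_filter, Finset.mem_filter, mem_extensions, mem_extensions,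
        extends_open_iff h]
      tauto
  · refine Finset.disjoint_filter.2 fun x _ h1 h2 => ?_
    obtain ⟨b, hb⟩ := h2
    exact h1.1 b hb
  · rw [← Finset.filter_or]
    refine Finset.disjoint_filter.2 fun x hx h1 h2 => ?_
    obtain ⟨a, ha⟩ := h2
    rcases h1 with h1 | ⟨b, hb⟩
    · exact h1.2 a ha
    · exact (mem_extensions.1 hx).adm.left_ne_right _ _ _ ha hb

/-- The number of signs on the nonzero entries. -/
def signWeight (l : List ℕ) : ℂ := (l.map fun b => if b = 0 then 1 else 2).prod

/-- The number of extensions depends on the initial part only through the number of open arcs, so it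
obeys the recursion of `stackWeight`, up to a factor 2 for each nonzero entry. -/
theorem card_extensions (c : Fin n → ℕ) (m : ℕ) : ∀ (k : ℕ) (_ : k + m = n) (s : Fin n → ℤˣ)
    (τ : Finset (Fin n × Fin n)) (L : Finset (Fin n)) (g : ℤˣ)
    (_ : IsInitialPart {i | c i ≠ 0} k s τ L g),
    ((extensions {i | c i ≠ 0} k s τ L).card : ℂ) =
      signWeight ((List.ofFn c).drop k) * stackWeight L.card ((List.ofFn c).drop k) := by
  induction m with
  | zero =>
    intro k hk s τ L g h
    obtain rfl : k = n := hk
    rw [extensions_end h, List.drop_of_length_le (by simp)]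
    by_cases hL : L = ∅
    · simp [hL, signWeight, stackWeight]
    · simp [hL, signWeight, stackWeight]
  | succ m ih =>
    intro k hk s τ L g h
    let K : Fin n := ⟨k, by omega⟩
    have hd : (List.ofFn c).drop k = c K :: (List.ofFn c).drop (k + 1) := by
      rw [List.drop_eq_getElem_cons (by simp; omega)]
      simp [K]
    rw [hd]
    set l := (List.ofFn c).drop (k + 1) with hl
    replace ih := ih (k + 1) (by omega)
    rw [← hl] at ih
    change IsInitialPart _ (K : ℕ) _ _ _ _ at h
    change ((extensions _ (K : ℕ) _ _ _).card : ℂ) = _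
    change ∀ s τ L g, IsInitialPart _ ((K : ℕ) + 1) s τ L g →
      ((extensions _ ((K : ℕ) + 1) _ _ _).card : ℂ) = _ at ih
    by_cases hc : c K = 0
    · have hw : signWeight (c K :: l) = signWeight l := by simp [signWeight, hc]
      have hK : K ∉ {i | c i ≠ 0} := by simpa using hc
      rw [hw, stackWeight, if_pos hc]
      rcases L.eq_empty_or_nonempty with rfl | hL
      · rw [extensions_skip K hK h, ih _ _ _ _ h.skip]
        simp
      · rw [extensions_skip_of_nonempty K hK hL, if_neg (by simpa using hL.ne_empty)]
        simp
    · have hw : signWeight (c K :: l) = 2 * signWeight l := by simp [signWeight, hc]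
      have hK : K ∈ {i | c i ≠ 0} := hc
      have hKL : K ∉ L := fun hK => lt_irrefl _ (h.open_lt _ hK)
      rw [card_extensions_step h, hw, stackWeight, if_neg hc]
      push_cast
      rw [Finset.sum_congr rfl fun ε _ => ih _ _ _ _ (h.unmatched hK ε)]
      -- There are two signs for the opening end when no arc is open and one otherwise, which is 2
      -- times `openWeight`.
      have h2 : ∑ ε ∈ (if L = ∅ then Finset.univ else {g}),
          ((extensions {i | c i ≠ 0} (K + 1) (Function.update s K ε) τ (insert K L)).card : ℂ) =
          2 * openWeight L.card * (signWeight l * stackWeight (L.card + 1) l) := by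
        rw [Finset.sum_congr rfl fun ε hε => ih _ _ _ ε (h.open hK ε fun hL => by
          rw [if_neg hL.ne_empty] at hε
          simpa using hε), Finset.card_insert_of_notMem hKL]
        by_cases hL : L = ∅
        · simp [hL, openWeight]
        · simp [hL, openWeight]
      rw [h2]
      by_cases hL : L.Nonempty
      · have hL0 : L.card ≠ 0 := by simpa using hL.ne_empty
        rw [dif_pos hL, ih _ _ _ _ (h.close hK (L.max'_mem hL) fun l hl => L.le_max' l hl),
          Finset.card_erase_of_mem (L.max'_mem hL), if_neg hL0]
        simp
        ring
      · rw [Finset.not_nonempty_iff_eq_empty] at hL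
        subst hL
        simp
        ring

end Completions

/-! ### From signs of blocks to signs of positions -/

section Count

variable {n : ℕ}

open Classical in
theorem card_admissible (c : Fin n → ℕ) :
    ((Finset.univ.filter fun x : (Fin n → ℤˣ) × Finset (Fin n × Fin n) =>
      IsAdmissible {i | c i ≠ 0} x.1 x.2).card : ℂ) =
      signWeight (List.ofFn c) * stackWeight 0 (List.ofFn c) := by
  have h := card_extensions c n 0 (by omega) 1 ∅ ∅ 1 (by
    refine ⟨⟨?_, ?_, ?_, ?_, ?_, ?_, ?_, ?_, ?_, ?_, ?_⟩, ?_, ?_, ?_, ?_, ?_, ?_, ?_, ?_, ?_, ?_⟩ <;>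
      simp)
  rw [List.drop_zero] at h
  rw [← Finset.card_empty (α := Fin n), ← h, extensions]
  congr 2
  ext x
  simp only [Finset.mem_filter, Finset.mem_univ, true_and]
  constructor
  · intro hx
    exact ⟨hx, by simp, by simp, by simp⟩
  · exact fun hx => hx.adm

/-- The product of the signs over each block. -/
def blockProd (p : Fin n → Fin n) : (Fin n → ℤˣ) →* (Fin n → ℤˣ) where
  toFun σ k := ∏ i ∈ block p k, σ i
  map_one' := by ext; simp
  map_mul' σ σ' := by ext k; simp [Finset.prod_mul_distrib]

theorem blockProd_apply (p : Fin n → Fin n) (σ : Fin n → ℤˣ) (k : Fin n) :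
    blockProd p σ k = ∏ i ∈ block p k, σ i := rfl

theorem content_ne_zero_iff {p : Fin n → Fin n} {k : Fin n} :
    content p k ≠ 0 ↔ k ∈ Set.range p := by
  rw [content, Finset.card_ne_zero]
  simp [Finset.Nonempty, block]

theorem blockProd_eq_one {p : Fin n → Fin n} (σ : Fin n → ℤˣ) {k : Fin n} (hk : content p k = 0) :
    blockProd p σ k = 1 := by
  rw [blockProd_apply, Finset.card_eq_zero.1 hk, Finset.prod_empty]

theorem mem_range_blockProd {p : Fin n → Fin n} {s : Fin n → ℤˣ} :
    s ∈ Set.range (blockProd p) ↔ ∀ k, content p k = 0 → s k = 1 := by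
  constructor
  · rintro ⟨σ, rfl⟩ k hk
    exact blockProd_eq_one σ hk
  · intro h
    rcases isEmpty_or_nonempty (Fin n) with hn | hn
    · exact ⟨1, funext fun k => isEmptyElim k⟩
    -- The sign of a block is placed on one chosen occurrence of its entry; all other positions get
    -- 1.
    refine ⟨fun i => if i = Function.invFun p (p i) then s (p i) else 1, funext fun k => ?_⟩
    rw [blockProd_apply]
    by_cases hk : content p k = 0
    · rw [Finset.card_eq_zero.1 hk, Finset.prod_empty, h k hk]
    · obtain ⟨i, rfl⟩ := content_ne_zero_iff.1 hk
      have hi : p (Function.invFun p (p i)) = p i := Function.invFun_eq ⟨i, rfl⟩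
      rw [Finset.prod_eq_single (Function.invFun p (p i))]
      · rw [hi, if_pos rfl]
      · intro j hj hne
        rw [block, Finset.mem_filter] at hj
        rw [hj.2, if_neg hne]
      · intro hn
        exact absurd (by simp [block, hi]) hn

open Classical in
theorem card_range_blockProd (p : Fin n → Fin n) :
    ((Finset.univ.filter (· ∈ Set.range (blockProd p))).card : ℂ) =
      signWeight (List.ofFn (content p)) := by
  have : Finset.univ.filter (· ∈ Set.range (blockProd p)) =
      Fintype.piFinset fun k => if content p k = 0 then {1} else Finset.univ := by
    ext s
    simp only [Finset.mem_filter, Finset.mem_univ, true_and, mem_range_blockProd,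
      Fintype.mem_piFinset]
    refine forall_congr' fun k => ?_
    split_ifs with hk <;> simp [hk, Int.units_eq_one_or]
  rw [this, Fintype.card_piFinset, signWeight, List.map_ofFn, List.prod_ofFn]
  push_cast
  refine Finset.prod_congr rfl fun k _ => ?_
  simp only [Function.comp]
  split_ifs <;> simp

theorem blockSign_eq_blockProd {p : Fin n → Fin n} (σ : Fin n → ℤˣ) {k : Fin n}
    (hk : k ∈ Set.range p) : blockSign p σ k = (blockProd p σ k : ℤ) := by
  rw [blockSign, if_neg (content_ne_zero_iff.2 hk), blockProd_apply, Units.coe_prod]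

theorem isAdmissible_iff {p : Fin n → Fin n} {σ : Fin n → ℤˣ} {τ : Finset (Fin n × Fin n)} :
    IsAdmissible {k | content p k ≠ 0} (blockProd p σ) τ ↔ IsNoncrossingMatching p τ ∧
      (∀ a b, (a, b) ∈ τ → blockSign p σ a = -blockSign p σ b) ∧
      (∀ a b c, (a, c) ∈ τ → a < b → b < c → b ∈ Set.range p) ∧
      ∀ a b c d, (a, d) ∈ τ → (b, c) ∈ τ → a < b → b < c → c < d →
        blockSign p σ a = blockSign p σ b := by
  have hO : ∀ k, k ∈ {k | content p k ≠ 0} ↔ k ∈ Set.range p := fun k => content_ne_zero_iff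
  constructor
  · rintro ⟨-, a2, a3, a4, a5, a6, a7, a8, a9, a10, a11⟩
    simp only [hO] at a3 a4 a10
    refine ⟨⟨a2, fun a b h => ⟨a3 a b h, a4 a b h⟩, ?_, ?_⟩, ?_, a10, ?_⟩
    · rintro ⟨a, b⟩ hab ⟨c, d⟩ hcd hne
      refine ⟨?_, ?_, ?_, ?_⟩
      · rintro rfl; exact hne (Prod.ext rfl (a5 _ _ _ hab hcd))
      · rintro rfl; exact a7 _ _ _ hcd hab
      · rintro rfl; exact a7 _ _ _ hab hcd
      · rintro rfl; exact hne (Prod.ext (a6 _ _ _ hab hcd) rfl)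
    · rintro a b c d h1 h2 ⟨h3, h4, h5⟩
      exact a8 _ _ _ _ h1 h2 h3 h4 h5
    · intro a b hab
      rw [blockSign_eq_blockProd σ (a3 _ _ hab), blockSign_eq_blockProd σ (a4 _ _ hab),
        a9 _ _ hab, Units.val_neg]
    · intro a b c d h1 h2 h3 _ h5
      rw [blockSign_eq_blockProd σ (a3 _ _ h1), blockSign_eq_blockProd σ (a3 _ _ h2),
        a11 _ _ _ _ h1 h2 h3 h5]
  · rintro ⟨⟨b1, b2, b3, b4⟩, b5, b6, b7⟩
    refine ⟨fun k hk => blockProd_eq_one σ (not_not.1 hk), b1,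
      fun a b h => (hO a).2 (b2 a b h).1, fun a b h => (hO b).2 (b2 a b h).2, ?_, ?_, ?_, ?_, ?_,
      fun a b c h h1 h2 => (hO b).2 (b6 a b c h h1 h2), ?_⟩
    · intro a b c h1 h2
      by_contra hne
      exact (b3 _ h1 _ h2 fun h => hne (congrArg Prod.snd h)).1 rfl
    · intro a b c h1 h2
      by_contra hne
      exact (b3 _ h1 _ h2 fun h => hne (congrArg Prod.fst h)).2.2.2 rfl
    · intro a b c h1 h2
      exact (b3 _ h1 _ h2 fun h => (b1 _ _ h1).ne (congrArg Prod.fst h)).2.2.1 rfl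
    · exact fun a b c d h1 h2 h3 h4 h5 => b4 a b c d h1 h2 ⟨h3, h4, h5⟩
    · intro a b hab
      have := b5 a b hab
      rw [blockSign_eq_blockProd σ (b2 _ _ hab).1, blockSign_eq_blockProd σ (b2 _ _ hab).2] at this
      exact Units.ext (by rw [this, Units.val_neg])
    · intro a b c d h1 h2 h3 h5
      have := b7 a b c d h1 h2 h3 (b1 _ _ h2) h5
      rw [blockSign_eq_blockProd σ (b2 _ _ h1).1, blockSign_eq_blockProd σ (b2 _ _ h2).1] at this
      exact Units.ext this

/-- The number of odd shifted parking functions with given underlying parking function. -/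
theorem card_OShPf_over {p : Fin n → Fin n} (hp : IsParking p) (ho : OddShape p) :
    (Nat.card {t : OShPf n // t.p = p} : ℂ) =
      2 ^ n * stackWeight 0 (List.ofFn (content p)) := by
  classical
  let A := Finset.univ.filter fun x : (Fin n → ℤˣ) × Finset (Fin n × Fin n) =>
    IsAdmissible {i | content p i ≠ 0} x.1 x.2
  let B := Finset.univ.filter fun x : (Fin n → ℤˣ) × Finset (Fin n × Fin n) =>
    IsAdmissible {i | content p i ≠ 0} (blockProd p x.1) x.2
  let F := (Finset.univ.filter fun σ => blockProd p σ = 1).card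
  -- Taking block products is a group homomorphism, so all its nonempty fibres have the same size.
  have hF : ∀ s ∈ Set.range (blockProd p),
      (Finset.univ.filter fun σ => blockProd p σ = s).card = F := fun s hs =>
    MonoidHom.card_fiber_eq_of_mem_range _ hs ⟨1, map_one _⟩
  have h1 : Nat.card {t : OShPf n // t.p = p} = B.card := by
    rw [← Fintype.card_coe B, ← Nat.card_eq_fintype_card]
    refine Nat.card_congr ⟨fun t => ⟨(t.1.σ, t.1.τ), ?_⟩, fun x => ⟨⟨p, x.1.1, x.1.2, hp, ho,
      (isAdmissible_iff.1 (Finset.mem_filter.1 x.2).2).1,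
      (isAdmissible_iff.1 (Finset.mem_filter.1 x.2).2).2.1,
      (isAdmissible_iff.1 (Finset.mem_filter.1 x.2).2).2.2.1,
      (isAdmissible_iff.1 (Finset.mem_filter.1 x.2).2).2.2.2⟩, rfl⟩, ?_, ?_⟩
    · obtain ⟨t, rfl⟩ := t
      exact (Finset.mem_filter.2 ⟨Finset.mem_univ _, isAdmissible_iff.2
        ⟨t.matching, t.arc_sign, t.arc_cover, t.arc_nested⟩⟩)
    · rintro ⟨t, rfl⟩; rfl
    · rintro ⟨⟨σ, τ⟩, h⟩; rfl
  have h2 : B.card = A.card * F := by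
    rw [Finset.card_eq_sum_card_fiberwise (f := fun x => (blockProd p x.1, x.2)) (t := A)
      (fun x hx => by simpa [A, B] using hx), Finset.sum_const_nat]
    rintro ⟨s, τ⟩ hx
    have hx := (Finset.mem_filter.1 hx).2
    rw [← hF s (mem_range_blockProd.2 fun k hk => hx.support k (by simpa using hk))]
    refine Finset.card_bij' (fun x _ => x.1) (fun σ _ => (σ, τ)) ?_ ?_ ?_ ?_
    · intro x hx
      simp only [Finset.mem_filter, Prod.mk.injEq] at hx ⊢
      exact ⟨Finset.mem_univ _, hx.2.1⟩
    · intro σ hσ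
      simp only [B, Finset.mem_filter, Finset.mem_univ, true_and] at hσ ⊢
      subst hσ
      exact ⟨hx, rfl⟩
    · intro x hx
      simp only [Finset.mem_filter, Prod.mk.injEq] at hx
      exact Prod.ext rfl hx.2.2.symm
    · intro σ _; rfl
  have h3 : 2 ^ n = (Finset.univ.filter (· ∈ Set.range (blockProd p))).card * F := by
    have h4 := Finset.card_eq_sum_card_fiberwise (f := blockProd p) (s := Finset.univ)
      (t := Finset.univ.filter (· ∈ Set.range (blockProd p))) (fun x _ => by simp)
    rw [Finset.sum_const_nat fun s hs => hF s (Finset.mem_filter.1 hs).2] at h4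
    rw [← h4]
    simp
  -- The factor for the signs on blocks and the fibre size combine to the 2^n sign vectors, leaving
  -- only the weight of matchings.
  have h3' : (2 ^ n : ℂ) = signWeight (List.ofFn (content p)) * F := by
    rw [← card_range_blockProd]; exact_mod_cast h3
  rw [h1, h2, h3', Nat.cast_mul, card_admissible]
  ring

end Count

/-! ### Parking functions and lattice paths -/

section ParkingPaths

variable {n : ℕ}

theorem isPath_iff (h : ℕ) (l : List ℕ) : IsPath h l ↔
    (∀ i, i < l.length → i + 1 ≤ h + (l.take (i + 1)).sum) ∧ h + l.sum = l.length := by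
  induction l generalizing h with
  | nil => simp [IsPath]
  | cons b l ih =>
    rw [IsPath, ih]
    simp only [List.length_cons, List.take_succ_cons, List.sum_cons]
    constructor
    · rintro ⟨h0, h1, h2⟩
      refine ⟨fun i hi => ?_, by omega⟩
      cases i with
      | zero => simp; omega
      | succ i => have := h1 i (by omega); omega
    · rintro ⟨h1, h2⟩
      have h0 := h1 0 (by omega)
      simp only [List.take_zero, List.sum_nil] at h0
      refine ⟨by omega, fun i hi => ?_, by omega⟩
      have := h1 (i + 1) (by omega)
      omega

theorem IsPath.sum_eq {α : Fin n → ℕ} (h : IsPath 0 (List.ofFn α)) : ∑ k, α k = n := by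
  have := ((isPath_iff _ _).1 h).2
  rwa [zero_add, List.sum_ofFn, List.length_ofFn] at this

theorem card_le_eq_sum (p : Fin n → Fin n) (k : Fin n) :
    (Finset.univ.filter fun j => p j ≤ k).card =
      ((List.ofFn (content p)).take (k + 1)).sum := by
  rw [List.sum_take_ofFn]
  rw [Finset.card_eq_sum_card_fiberwise (f := p)
    (t := Finset.univ.filter fun i : Fin n => (i : ℕ) < k + 1)
    (fun j hj => by
      have := (Finset.mem_filter.1 (Finset.mem_coe.1 hj)).2
      rw [Fin.le_def] at this
      exact Finset.mem_coe.2 (Finset.mem_filter.2 ⟨Finset.mem_univ _, by omega⟩))]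
  refine Finset.sum_congr rfl fun i hi => ?_
  rw [content, block, Finset.filter_filter]
  congr 1
  refine Finset.filter_congr fun j _ => ?_
  have := (Finset.mem_filter.1 hi).2
  refine and_iff_right_of_imp ?_
  rintro rfl
  rw [Fin.le_def]; omega

/-- Counting from 0, the entry in sorted position i is at most i exactly when at least i + 1 entries
are at most i, and that number is a partial sum of the contents. -/
theorem isParking_iff_isPath (p : Fin n → Fin n) :
    IsParking p ↔ IsPath 0 (List.ofFn (content p)) := by
  rw [isPath_iff, and_iff_left (by
    rw [zero_add, List.sum_ofFn, List.length_ofFn, sum_content])]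
  have hc : content (p ∘ Tuple.sort p) = content p := funext fun k => card_block_comp p _ k
  have h1 : ∀ i : Fin n, p (Tuple.sort p i) ≤ i ↔
      (i : ℕ) + 1 ≤ 0 + ((List.ofFn (content p)).take (i + 1)).sum := by
    intro i
    rw [zero_add, ← hc, ← card_le_eq_sum, Nat.succ_le_iff]
    exact (Tuple.lt_card_le_iff_apply_le_of_monotone (f := p ∘ Tuple.sort p) (a := i) (j := i)
      (Tuple.monotone_sort p)).symm
  constructor
  · intro h i hi
    rw [List.length_ofFn] at hi
    exact (h1 ⟨i, hi⟩).1 (h ⟨i, hi⟩)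
  · intro h i
    exact (h1 i).2 (h i (by simp))

theorem oddShape_iff (p : Fin n → Fin n) :
    OddShape p ↔ ∀ b ∈ List.ofFn (content p), b ≠ 0 → Odd b := by
  simp only [OddShape, shape, Multiset.mem_filter, Multiset.mem_map, Finset.mem_val,
    Finset.mem_univ, true_and, List.forall_mem_ofFn_iff, Nat.pos_iff_ne_zero]
  constructor
  · exact fun h k hk => h _ ⟨⟨k, rfl⟩, hk⟩
  · rintro h _ ⟨⟨k, rfl⟩, hk⟩; exact h k hk

/-- The content of a function, as a function with values in `{0, …, n}`. -/
def finContent (p : Fin n → Fin n) (k : Fin n) : Fin (n + 1) :=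
  ⟨content p k, Nat.lt_succ_of_le ((Finset.card_le_univ _).trans_eq (Fintype.card_fin n))⟩

theorem exists_comp_of_content_eq {p q : Fin n → Fin n} (h : content p = content q) :
    ∃ w : Equiv.Perm (Fin n), p ∘ w = q := by
  have : ∀ k, Nonempty ({i // q i = k} ≃ {i // p i = k}) := fun k => by
    rw [← Fintype.card_eq, Fintype.card_subtype, Fintype.card_subtype]
    exact (congrFun h k).symm
  let e := fun k => (this k).some
  exact ⟨Equiv.ofFiberEquiv e, funext fun i => Equiv.ofFiberEquiv_map e i⟩

theorem content_injOn_monotone {p q : Fin n → Fin n} (hp : Monotone p) (hq : Monotone q)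
    (h : content p = content q) : p = q := by
  obtain ⟨w, rfl⟩ := exists_comp_of_content_eq h
  exact Tuple.unique_monotone (f := p) (σ := 1) (τ := w) hp hq

theorem exists_monotone_content_eq {α : Fin n → ℕ} (hα : ∑ k, α k = n) :
    ∃ p : Fin n → Fin n, Monotone p ∧ content p = α := by
  let e : Fin n ≃ Σ k, Fin (α k) := Fintype.equivOfCardEq (by simp [hα])
  let p : Fin n → Fin n := fun i => (e i).1
  refine ⟨p ∘ Tuple.sort p, Tuple.monotone_sort p, funext fun k => ?_⟩
  rw [card_block_comp, content, block]
  have h1 : (Finset.univ.filter fun i => p i = k).card =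
      (Finset.univ.filter fun x : Σ k, Fin (α k) => x.1 = k).card :=
    Finset.card_equiv e (by simp [p])
  have h2 : (Finset.univ.filter fun x : Σ k, Fin (α k) => x.1 = k) =
      Finset.univ.map (Function.Embedding.sigmaMk k) := by
    ext ⟨j, x⟩
    simp only [Finset.mem_filter, Finset.mem_univ, true_and, Finset.mem_map]
    constructor
    · rintro rfl; exact ⟨x, rfl⟩
    · rintro ⟨y, hy⟩; exact (congrArg Sigma.fst hy).symm
  rw [h1, h2, Finset.card_map, Finset.card_univ, Fintype.card_fin]

-- A weakly increasing function is determined by its content, and every α of sum n is the content of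
-- one. Bounding the entries of α by n loses nothing.
open Classical in
theorem sum_parking_eq_sum_pathWeight {R : Type*} [CommRing R] [Algebra ℂ R] (f : ℕ → R) :
    ∑ p : Fin n → Fin n with IsParking p ∧ Monotone p, ∏ k, f (content p k) =
      ∑ α : Fin n → Fin (n + 1), pathWeight f 0 (List.ofFn fun i => (α i : ℕ)) := by
  have h0 : ∑ α : Fin n → Fin (n + 1), pathWeight f 0 (List.ofFn fun i => (α i : ℕ)) =
      ∑ α : Fin n → Fin (n + 1) with IsPath 0 (List.ofFn fun i => (α i : ℕ)),
        ∏ k, f (α k) := by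
    rw [Finset.sum_filter]
    refine Finset.sum_congr rfl fun α _ => ?_
    rw [pathWeight, List.map_ofFn, List.prod_ofFn]
    rfl
  rw [h0]
  refine Finset.sum_bij (fun p _ => finContent p) ?_ ?_ ?_ ?_
  · intro p hp
    exact Finset.mem_filter.2 ⟨Finset.mem_univ _,
      (isParking_iff_isPath p).1 (Finset.mem_filter.1 hp).2.1⟩
  · intro p hp q hq h
    refine content_injOn_monotone (Finset.mem_filter.1 hp).2.2 (Finset.mem_filter.1 hq).2.2 ?_
    exact funext fun k => congrArg Fin.val (congrFun h k)
  · intro α hα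
    have hα := (Finset.mem_filter.1 hα).2
    obtain ⟨p, hp, hpα⟩ := exists_monotone_content_eq hα.sum_eq
    refine ⟨p, Finset.mem_filter.2 ⟨Finset.mem_univ _, ?_, hp⟩,
      funext fun k => Fin.ext (congrFun hpα k)⟩
    rw [isParking_iff_isPath, hpα]
    exact hα
  · exact fun _ _ => rfl

end ParkingPaths

/-! ### The character -/

section Character

variable {n : ℕ}

/-- The images of the power sums under the shiftification operator. -/
def shPsum (k : ℕ) : Sym := if Odd k then 2 * psum k else 0

theorem shPsum_of_not_odd (k : ℕ) (hk : ¬ Odd k) : shPsum k = 0 := if_neg hk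

theorem sh_psum {k : ℕ} (hk : 0 < k) : sh (psum k) = shPsum k := by
  rw [sh, psum, MvPolynomial.aeval_X, Nat.sub_add_cancel hk, shPsum]

theorem sh_hsym (k : ℕ) : sh (hsym k) = hgen shPsum k := by
  refine (map_hgen sh psum k).trans ?_
  unfold hgen
  refine Finset.sum_congr rfl fun l _ => ?_
  rw [Multiset.map_congr rfl fun m hm => sh_psum (l.parts_pos hm)]

theorem map_shape_prod {S : Type*} [CommMonoid S] (f : ℕ → S) (hf : f 0 = 1)
    (p : Fin n → Fin n) : ((shape p).map f).prod = ∏ k, f (content p k) := by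
  have key : ∀ m : Multiset ℕ, ((m.filter (0 < ·)).map f).prod = (m.map f).prod := by
    intro m
    induction m using Multiset.induction with
    | empty => simp
    | cons b m ih =>
      rcases Nat.eq_zero_or_pos b with rfl | hb
      · simp [hf, ih]
      · simp [hb, ih]
  rw [shape, key, Multiset.map_map]
  rfl

/-- The definition is a sum over all parking contents; since sh kills even power sums, the
generating function identity turns it into the weighted sum over odd contents. -/
theorem SH_eq_sum_oddPathWeight (n : ℕ) : SH n = ∑ α : Fin n → Fin (n + 1),
    oddPathWeight (hgen shPsum) 0 0 (List.ofFn fun i => (α i : ℕ)) := by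
  rw [← sum_pathWeight_eq_sum_oddPathWeight shPsum_of_not_odd, ← sum_parking_eq_sum_pathWeight,
    SH, PF, map_sum]
  refine Finset.sum_congr (by congr) fun p _ => ?_
  rw [map_multiset_prod, Multiset.map_map, ← map_shape_prod _ (hgen_zero _)]
  simp only [Function.comp_def, sh_hsym]

theorem prod_map_shPsum (l : n.Partition) : (l.parts.map shPsum).prod =
    if l ∈ Nat.Partition.odds n then (2 : ℂ) ^ l.parts.card • psumPart l else 0 := by
  split_ifs with hl
  · simp only [Nat.Partition.odds, Nat.Partition.restricted, Finset.mem_filter, Finset.mem_univ,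
      true_and, Nat.not_even_iff_odd] at hl
    have : l.parts.map shPsum = l.parts.map fun m => 2 * psum m :=
      Multiset.map_congr rfl fun m hm => if_pos (hl m hm)
    rw [this, Multiset.prod_map_mul, Multiset.map_const', Multiset.prod_replicate, psumPart,
      Algebra.smul_def, map_pow, map_ofNat]
  · simp only [Nat.Partition.odds, Nat.Partition.restricted, Finset.mem_filter, Finset.mem_univ,
      true_and, Nat.not_even_iff_odd, not_forall] at hl
    obtain ⟨m, hm, ho⟩ := hl
    exact Multiset.prod_eq_zero (Multiset.mem_map.2 ⟨m, hm, if_neg ho⟩)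

open Classical in
/-- The number of odd shifted parking functions of content `α`, by underlying function. -/
def overWeight (n : ℕ) (α : Fin n → ℕ) : ℂ :=
  if IsPath 0 (List.ofFn α) ∧ ∀ b ∈ List.ofFn α, b ≠ 0 → Odd b then
    2 ^ n * stackWeight 0 (List.ofFn α) else 0

theorem card_over_eq_overWeight (p : Fin n → Fin n) :
    (Nat.card {t : OShPf n // t.p = p} : ℂ) = overWeight n (content p) := by
  rw [overWeight]
  split_ifs with h
  · exact card_OShPf_over ((isParking_iff_isPath p).2 h.1) ((oddShape_iff p).2 h.2)
  · have : IsEmpty {t : OShPf n // t.p = p} := ⟨fun ⟨t, ht⟩ => h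
      (ht ▸ ⟨(isParking_iff_isPath _).1 t.parking, (oddShape_iff _).1 t.odd⟩)⟩
    simp

/-- Whether a triple is counted depends only on p, and the number of triples over p only on its
content. -/
theorem card_fixed (g : DoubleCover n) :
    (Nat.card {t : OShPf n // t.p ∘ DoubleCover.proj n g = t.p} : ℂ) =
      ∑ α : Fin n → Fin (n + 1), overWeight n (fun k => α k) *
        Nat.card {p : Fin n → Fin n // p ∘ DoubleCover.proj n g = p ∧
          content p = fun k => (α k : ℕ)} := by
  classical
  have h1 : Nat.card {t : OShPf n // t.p ∘ DoubleCover.proj n g = t.p} =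
      ∑ p : Fin n → Fin n with p ∘ DoubleCover.proj n g = p,
        Nat.card {t : OShPf n // t.p = p} := by
    rw [Nat.card_eq_fintype_card, Fintype.card_subtype,
      Finset.card_eq_sum_card_fiberwise (f := OShPf.p)
        (t := Finset.univ.filter fun p : Fin n → Fin n => p ∘ DoubleCover.proj n g = p)
        (fun t ht => by simpa using ht)]
    refine Finset.sum_congr rfl fun p hp => ?_
    rw [Nat.card_eq_fintype_card, Fintype.card_subtype, Finset.filter_filter]
    congr 1
    refine Finset.filter_congr fun t _ => and_iff_right_of_imp ?_
    rintro rfl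
    exact (Finset.mem_filter.1 hp).2
  rw [h1, Nat.cast_sum, Finset.sum_congr rfl fun p _ => card_over_eq_overWeight p,
    ← Finset.sum_fiberwise_of_maps_to (g := finContent) (t := Finset.univ)
      (fun _ _ => Finset.mem_univ _)]
  refine Finset.sum_congr rfl fun α _ => ?_
  have h2 : ∀ p : Fin n → Fin n, finContent p = α ↔ content p = fun k => (α k : ℕ) := by
    intro p
    simp only [funext_iff, Fin.ext_iff, finContent]
  rw [Finset.sum_congr rfl fun p hp => by rw [(h2 p).1 (Finset.mem_filter.1 hp).2],
    Finset.sum_const, nsmul_eq_mul, mul_comm, Finset.filter_filter, Nat.card_eq_fintype_card,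
    Fintype.card_subtype]
  simp only [h2]

/-- After exchanging the sums over λ and α, the inner sum for each α is the product of the
sh(h_{α_k}) by `prod_hgen`. -/
theorem sum_card_fixed (n : ℕ) : ∑ l : n.Partition, ((zee l : ℂ)⁻¹ *
    Nat.card {t : OShPf n // t.p ∘ DoubleCover.proj n (posRep l) = t.p}) •
      (l.parts.map shPsum).prod = (2 : ℂ) ^ n • SH n := by
  simp only [card_fixed, Finset.mul_sum, Finset.sum_smul]
  rw [Finset.sum_comm, SH_eq_sum_oddPathWeight, Finset.smul_sum]
  refine Finset.sum_congr rfl fun α _ => ?_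
  rw [oddPathWeight, overWeight]
  split_ifs with h
  · have hp := prod_hgen shPsum (fun k => (α k : ℕ)) h.1.sum_eq
    rw [List.map_ofFn, List.prod_ofFn]
    simp only [Function.comp_def] at hp ⊢
    rw [hp, smul_smul, Finset.smul_sum]
    refine Finset.sum_congr rfl fun l _ => ?_
    simp only [Algebra.smul_def, map_mul, map_natCast]
    ring
  · simp

/-- After multiplication by 2^(n/2), the 2^(ℓ/2) in the characteristic and the trace 2^((ℓ-n)/2)
combine to 2^ℓ, which is the factor in sh(p_λ) for odd λ; the other λ are killed by sh. -/
theorem spinCh_eq (π : (Fin n → Fin n) → DoubleCover n)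
    (hπ : ∀ p : Fin n → Fin n, Monotone (p ∘ DoubleCover.proj n (π p))) :
    spinCh n (transport (tensorBasis π hπ).repr.symm (inducedSumRep n)).character =
      ((Real.sqrt 2 : ℝ) : ℂ) ^ n • SH n := by
  have h2 : ((Real.sqrt 2 : ℝ) : ℂ) * ((Real.sqrt 2 : ℝ) : ℂ) = 2 := by
    rw [← Complex.ofReal_mul, Real.mul_self_sqrt (by norm_num)]
    norm_num
  have h0 : ((Real.sqrt 2 : ℝ) : ℂ) ^ n ≠ 0 := by
    refine pow_ne_zero _ fun h => ?_
    rw [h, mul_zero] at h2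
    exact two_ne_zero h2.symm
  refine smul_injective_of_ne_zero h0 ?_
  rw [smul_smul, ← mul_pow, h2, ← sum_card_fixed]
  simp only [prod_map_shPsum, smul_ite, smul_zero]
  rw [← Finset.sum_filter, Finset.filter_univ_mem, spinCh, Finset.smul_sum]
  refine Finset.sum_congr rfl fun l hl => ?_
  have hl' : ∀ m ∈ l.parts, Odd m := by
    simpa [Nat.Partition.odds, Nat.Partition.restricted] using hl
  have ht := tr0_basicSpin_posRep hl'
  rw [character_posRep π hπ hl', smul_smul, smul_smul]
  congr 1
  rw [← h2, mul_pow]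
  generalize (Nat.card {t : OShPf n // t.p ∘ DoubleCover.proj n (posRep l) = t.p} : ℂ) = N
  -- Of the two factors √2^ℓ making up 2^ℓ, one is traded for the trace times √2^n.
  nth_rewrite 3 [← ht]
  ring

end Character

end OddParking

end


theorem corollary3p14 (n : ℕ) (π : (Fin n → Fin n) → OddParking.DoubleCover n)
    (hπ : ∀ p : Fin n → Fin n, Monotone (p ∘ OddParking.DoubleCover.proj n (π p))) :
    ∃ e : (OddParking.OShPf n →₀ ℂ) ≃ₗ[ℂ] OddParking.InducedSum n,
      (∀ t : OddParking.OShPf n,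
        e (Finsupp.single t 1) = OddParking.tensorVector t (π t.p) (hπ t.p)) ∧
      OddParking.transport e (OddParking.inducedSumRep n) OddParking.Cover.z = -1 ∧
      OddParking.spinCh n (OddParking.transport e (OddParking.inducedSumRep n)).character =
        ((Real.sqrt 2 : ℝ) : ℂ) ^ n • OddParking.SH n := by
  refine ⟨(OddParking.tensorBasis π hπ).repr.symm, fun t => ?_, ?_, OddParking.spinCh_eq π hπ⟩
  · rw [Module.Basis.repr_symm_single_one, OddParking.tensorBasis_apply]
  · refine LinearMap.ext fun x => ?_
    change (OddParking.tensorBasis π hπ).repr.symm.symm (OddParking.inducedSumRep n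
      OddParking.Cover.z ((OddParking.tensorBasis π hπ).repr.symm x)) = -x
    rw [OddParking.inducedSumRep_z, LinearMap.neg_apply, Module.End.one_apply, map_neg,
      LinearEquiv.symm_apply_apply]
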